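/- **Theorem 4.1.** Let $\Sigma$ be a closed (compact, without boundary), connected, orientable smooth surface of negative Euler characteristic, and let $p:M\to\Sigma$ be a circle bundle: $M$ is a smooth $3$-manifold, $p$ is smooth, and every point of $\Sigma$ has an open neighbourhood $U$ such that $p^{-1}(U)$ is diffeomorphic to $U\times S^1$ by a diffeomorphism that commutes with the projections to $U$. Suppose that the bundle is non-trivial, that is, there is no homeomorphism $M\to\Sigma\times S^1$ that commutes with the projections to $\Sigma$. Let $h:M\to M$ be a homeomorphism isotopic to the identity (through homeomorphisms). Let $\Lambda$ be a codimension-one lamination of $M$: a closed subset of $M$ covered by flow boxes, i.e. homeomorphisms from open sets $V\subset M$ onto $U\times\mathbb R$ with $U\subset\mathbb R^2$ open and connected, that take $\Lambda\cap V$ to $U\times T$ for some $T\subset\mathbb R$, such that the plaques (the sets corresponding to $U\times\{t\}$, $t\in T$) of any two of the flow boxes agree locally; the leaves of $\Lambda$ are the classes of points that can be joined by finite chains of plaques. Suppose that - $\Lambda$ is *horizontal*: each leaf is topologically transverse to the fibers of $p$, i.e. around each of its points there is a flow box for $\Lambda$ onto $U\times\mathbb R$, with $U\subset\Sigma$ open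 and connected, whose first coordinate is $p$ and whose plaques agree locally with those of $\Lambda$; - $\Lambda$ is *minimal*: every leaf is dense in $\Lambda$; - $\Lambda$ is *$h$-invariant*: $h$ permutes the leaves of $\Lambda$. Then there is an integer $k\ge 1$ such that $h^k(L)=L$ for every leaf $L$ of $\Lambda$. -/

import Mathlib

open Set Topology
open scoped Manifold ContDiff

universe u v w

/-- The Euler characteristic of a space: the alternating sum of its rational Betti numbers,
computed from singular homology. -/
noncomputable def eulerCharacteristic (X : Type u) [TopologicalSpace X] : ℤ :=
  (((AlgebraicTopology.singularChainComplexFunctor (ModuleCat.{u} ℚ)).obj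
    (ModuleCat.of ℚ (ULift.{u} ℚ))).obj (TopCat.of X)).homologyEulerChar

/-- A smooth surface is orientable if it is covered by a family of smooth charts
all of whose coordinate changes have positive Jacobian determinant. -/
def IsOrientableSurface (S : Type u) [TopologicalSpace S]
    [ChartedSpace (EuclideanSpace ℝ (Fin 2)) S] : Prop :=
  ∃ A ⊆ IsManifold.maximalAtlas (𝓡 2) ∞ S,
    (∀ x : S, ∃ e ∈ A, x ∈ e.source) ∧
    ∀ e ∈ A, ∀ e' ∈ A, ∀ y ∈ (e.symm.trans e').source,
      0 < (fderiv ℝ (e.symm.trans e') y).det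

/-- A smooth map `p : M → S` from a `3`-manifold to a surface is a (smooth) circle bundle if every
point of `S` has an open neighbourhood over which `M` is diffeomorphic to the product with the
circle, by a diffeomorphism compatible with the projections. -/
def IsCircleBundle {M : Type u} {S : Type v} [TopologicalSpace M] [TopologicalSpace S]
    [ChartedSpace (EuclideanSpace ℝ (Fin 3)) M] [ChartedSpace (EuclideanSpace ℝ (Fin 2)) S]
    (p : M → S) : Prop :=
  ContMDiff (𝓡 3) (𝓡 2) ∞ p ∧
  ∀ x : S, ∃ e : Bundle.Trivialization Circle p, x ∈ e.baseSet ∧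
    ContMDiffOn (𝓡 3) ((𝓡 2).prod (𝓡 1)) ∞ e e.source ∧
    ContMDiffOn ((𝓡 2).prod (𝓡 1)) (𝓡 3) ∞ e.toOpenPartialHomeomorph.symm e.target

/-- A homeomorphism `h` is isotopic to the identity if there is a path of homeomorphisms,
jointly continuous in the parameter and the point, from the identity to `h`. -/
def IsotopicToId {M : Type u} [TopologicalSpace M] (h : M ≃ₜ M) : Prop :=
  ∃ H : unitInterval → M ≃ₜ M,
    Continuous (fun q : unitInterval × M => H q.1 q.2) ∧ H 0 = Homeomorph.refl M ∧ H 1 = h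

/-- A flow box for a closed set `Λ`: an open subset of `M` with a homeomorphism onto `U × ℝ`,
with `U` connected (and open), that takes `Λ` to `U × T` for some `T ⊆ ℝ`.
The sets corresponding to `U × {t}`, with `t ∈ T`, are the plaques of the flow box. -/
def IsFlowBox {M : Type u} {B : Type v} [TopologicalSpace M] [TopologicalSpace B]
    (Λ : Set M) (φ : OpenPartialHomeomorph M (B × ℝ)) : Prop :=
  ∃ (U : Set B) (T : Set ℝ), IsConnected U ∧ φ.target = U ×ˢ (univ : Set ℝ) ∧
    φ '' (Λ ∩ φ.source) = U ×ˢ T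

/-- The plaques of `φ` and of `ψ` agree locally, at every point of `Λ` where both are defined. -/
def PlaquesAgree {M : Type u} {B : Type v} {B' : Type w}
    [TopologicalSpace M] [TopologicalSpace B] [TopologicalSpace B'] (Λ : Set M)
    (φ : OpenPartialHomeomorph M (B × ℝ)) (ψ : OpenPartialHomeomorph M (B' × ℝ)) : Prop :=
  ∀ x ∈ Λ, x ∈ φ.source → x ∈ ψ.source →
    ∀ᶠ y in 𝓝[Λ] x, (φ y).2 = (φ x).2 ↔ (ψ y).2 = (ψ x).2

/-- A (topological) codimension one lamination of a `3`-manifold: a closed set covered by flow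
boxes modelled on `ℝ² × ℝ` whose plaques agree locally. -/
structure SurfaceLamination (M : Type u) [TopologicalSpace M] where
  /-- the underlying closed set, the union of the leaves -/
  support : Set M
  isClosed_support : IsClosed support
  /-- a lamination atlas -/
  atlas : Set (OpenPartialHomeomorph M (EuclideanSpace ℝ (Fin 2) × ℝ))
  exists_mem_source : ∀ x ∈ support, ∃ φ ∈ atlas, x ∈ φ.source
  isFlowBox : ∀ φ ∈ atlas, IsFlowBox support φ
  plaquesAgree : ∀ φ ∈ atlas, ∀ ψ ∈ atlas, PlaquesAgree support φ ψ

namespace SurfaceLamination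

variable {M : Type u} [TopologicalSpace M]

/-- Two points of the lamination lie on a common plaque of the atlas. -/
def SamePlaque (Λ : SurfaceLamination M) (x y : M) : Prop :=
  ∃ φ ∈ Λ.atlas, x ∈ Λ.support ∩ φ.source ∧ y ∈ Λ.support ∩ φ.source ∧ (φ x).2 = (φ y).2

/-- The leaves: two points of the lamination lie on the same leaf if they are joined by a finite
chain of plaques. -/
def leaves (Λ : SurfaceLamination M) : Set (Set M) :=
  {L | ∃ x ∈ Λ.support, L = {y | Relation.EqvGen Λ.SamePlaque x y}}

/-- The lamination is minimal if each of its leaves is dense in it. -/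
def IsMinimal (Λ : SurfaceLamination M) : Prop :=
  ∀ L ∈ Λ.leaves, closure L = Λ.support

/-- The lamination is `h`-invariant if `h` maps leaves onto leaves and every leaf is the image of
a leaf; in particular `h` maps the union of the leaves onto itself. -/
def IsInvariant (Λ : SurfaceLamination M) (h : M ≃ₜ M) : Prop :=
  (fun L : Set M => h '' L) '' Λ.leaves = Λ.leaves

/-- A leaf is horizontal if it is (topologically) transverse to the fibres of `p`: around each of
its points there is a flow box for the lamination in which the plaques are the horizontal slices
`U × {t}` and the fibres of `p` are the vertical lines `{s} × ℝ`. -/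
def IsHorizontalLeaf {S : Type v} [TopologicalSpace S] (Λ : SurfaceLamination M) (p : M → S)
    (L : Set M) : Prop :=
  ∀ x ∈ L, ∃ ψ : OpenPartialHomeomorph M (S × ℝ), x ∈ ψ.source ∧
    IsFlowBox Λ.support ψ ∧ (∀ φ ∈ Λ.atlas, PlaquesAgree Λ.support φ ψ) ∧
    ∀ y ∈ ψ.source, (ψ y).1 = p y

/-- A lamination is horizontal if all its leaves are. -/
def IsHorizontal {S : Type v} [TopologicalSpace S] (Λ : SurfaceLamination M) (p : M → S) : Prop :=
  ∀ L ∈ Λ.leaves, Λ.IsHorizontalLeaf p L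

end SurfaceLamination

/-! Choose an isotopy from the identity to `h`. Carry a point of the lamination along the isotopy to
its image, then slide the image along its leaf, over the projection of the reversed track, back to
the fibre where it started. This is a return map on each fibre that sends points of a leaf `L` to
points of the leaf `h(L)`. To give it a real displacement, the fibres are parametrized up to
isometry (`exists_isometric_frames`), and one works in the space `Framed` of isometric
parametrizations of fibres that start on the lamination. In its topology the starting point moves
only along its leaf, so `Framed` is a covering of the surface (`Framed.isCoveringMap_proj`), and
tracks in the bundle lift to `Framed` times the line (`Framed.exists_lift`). That `h` is continuous
for this topology, although it is only assumed to permute the leaves, comes from the countability of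
a leaf on a transversal (`HorizontalAtlas.LeafwiseAt.map`). The return map preserves the order of
the points of the lamination on the universal cover of a fibre (`IsotopyLift.disp_lt`), so the
theory of circle homeomorphisms applies.

If an iterate of the return map fixes a framed point, its fixed points form an open and closed set,
hence contain those over a whole leaf. By minimality they are dense in the lamination on every
fibre, and monotonicity makes the iterate the identity (`ReturnMap.ret_eq_self`). The same power of
`h` then preserves every leaf.

Otherwise no displacement vanishes. Its sign orients the fibres, all positively oriented points
share an irrational rotation number (`ReturnMap.exists_rotation_number`), and `ReturnMap.conj`
semiconjugates the return map to the rotation. Height measured by the semiconjugacy is constant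
along leaves. Hence the transition cocycle of local sections of `Framed` is a locally constant
cocycle plus the coboundary of the fibrewise mean of the semiconjugacy (`mean_shift`,
`eventually_coe_conj_eq`). Locally constant circle cocycles on a closed orientable surface split
(`flatCocyclesSplit`), so the bundle is trivial (`IsRotation.isTrivial`), against the assumption.

The splitting says that a flat hermitian line bundle has a section without zeros. A section with
finitely many zeros exists; its zeros can be pushed to one point, and there it can be made a power
of an oriented coordinate or of its conjugate. A positive power is impossible: the form `d arg s`,
cut off where `s` is small, is a global form because the transition functions are locally constant
of modulus one. Its exterior derivative is nonnegative and somewhere positive, against Stokes. The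
conjugate case follows by conjugating the bundle. -/

section

/-! ### Lifts of circle maps to the line -/

section CircleLift

theorem UnitAddCircle.eq_of_coe_eq {X : Type*} [TopologicalSpace X] [PreconnectedSpace X]
    {F G : X → ℝ} (hF : Continuous F) (hG : Continuous G)
    (h : ∀ x, (F x : UnitAddCircle) = G x) (x₀ : X) (h₀ : F x₀ = G x₀) : F = G :=
  (AddCircle.isCoveringMap_coe (1 : ℝ)).eq_of_comp_eq hF hG (funext h) x₀ h₀

theorem UnitAddCircle.coe_eq_coe_iff {r s : ℝ} :
    (r : UnitAddCircle) = s ↔ ∃ n : ℤ, r = s + n := by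
  rw [← sub_eq_zero, ← AddCircle.coe_sub, AddCircle.coe_eq_zero_iff]
  constructor
  · rintro ⟨n, hn⟩
    exact ⟨n, by simp at hn; linarith⟩
  · rintro ⟨n, hn⟩
    exact ⟨n, by simp; linarith⟩

/-- The integer is read at one point; uniqueness of lifts for the covering of the circle by the line
propagates it. -/
theorem UnitAddCircle.exists_int_of_coe_eq {X : Type*} [TopologicalSpace X] [PreconnectedSpace X]
    {F G : X → ℝ} (hF : Continuous F) (hG : Continuous G)
    (h : ∀ x, (F x : UnitAddCircle) = G x) : ∃ n : ℤ, ∀ x, F x = G x + n := by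
  cases isEmpty_or_nonempty X with
  | inl hX => exact ⟨0, fun x => hX.elim x⟩
  | inr hX =>
    obtain ⟨x₀⟩ := hX
    obtain ⟨n, hn⟩ := UnitAddCircle.coe_eq_coe_iff.1 (h x₀)
    refine ⟨n, fun x => ?_⟩
    refine congrFun (UnitAddCircle.eq_of_coe_eq (G := fun x => G x + n) hF
      (hG.add continuous_const) (fun x => ?_) x₀ hn) x
    rw [h x, UnitAddCircle.coe_eq_coe_iff]
    exact ⟨-n, by push_cast; ring⟩

theorem UnitAddCircle.coe_add_int (r : ℝ) (n : ℤ) : ((r + n : ℝ) : UnitAddCircle) = r :=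
  UnitAddCircle.coe_eq_coe_iff.2 ⟨n, rfl⟩

theorem UnitAddCircle.coe_add_one (r : ℝ) : ((r + 1 : ℝ) : UnitAddCircle) = r := by
  exact_mod_cast UnitAddCircle.coe_add_int r 1

theorem UnitAddCircle.exists_coe (x : UnitAddCircle) : ∃ r : ℝ, (r : UnitAddCircle) = x :=
  QuotientAddGroup.mk_surjective x

/-- Lifting a family of curves in the circle to the line. -/
theorem exists_lift_family {B : Type*} [TopologicalSpace B] (f : B × ℝ → UnitAddCircle)
    (hf : Continuous f) : ∃ G : B × ℝ → ℝ, Continuous G ∧ (∀ b, G (b, 0) = 0) ∧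
      ∀ b r, f (b, r) = f (b, 0) + G (b, r) := by
  have cov := AddCircle.isCoveringMap_coe (1 : ℝ)
  -- The family is scaled along the line: time `t` shows the displacement up to `t * r`. It starts
  -- at zero, so homotopy lifting applies, and the end of the lift is the required function.
  let H : C(unitInterval × (B × ℝ), UnitAddCircle) :=
    ⟨fun q => f (q.2.1, q.1 * q.2.2) - f (q.2.1, 0), by fun_prop⟩
  let f0 : C(B × ℝ, ℝ) := ⟨fun _ => 0, continuous_const⟩
  have H0 : ∀ a, H (0, a) = ((f0 a : ℝ) : UnitAddCircle) := by intro a; simp [H, f0]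
  have hl := cov.liftHomotopy_lifts H f0 H0
  have hz := cov.liftHomotopy_zero H f0 H0
  set K := cov.liftHomotopy H f0 H0
  refine ⟨fun q => K (1, q), by fun_prop, fun b => ?_, fun b r => ?_⟩
  · have := UnitAddCircle.eq_of_coe_eq (X := unitInterval) (F := fun t => K (t, (b, 0)))
      (G := fun _ => 0) (by fun_prop) continuous_const (fun t => by
        have := congrFun hl (t, (b, 0)); simp only [Function.comp] at this; rw [this]; simp [H])
      0 (by rw [hz]; rfl)
    exact congrFun this 1
  · have := congrFun hl (1, (b, r))
    simp only [Function.comp] at this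
    rw [this]; simp [H]

theorem exists_lift_curve (f : ℝ → UnitAddCircle) (hf : Continuous f) :
    ∃ G : ℝ → ℝ, Continuous G ∧ G 0 = 0 ∧ ∀ r, f r = f 0 + G r := by
  obtain ⟨G, h1, h2, h3⟩ := exists_lift_family (B := Unit) (fun q => f q.2) (by fun_prop)
  exact ⟨fun r => G ((), r), by fun_prop, h2 (), h3 ()⟩

open Classical in
/-- The lift, starting at `0`, of the displacement of a continuous curve in the circle. -/
noncomputable def circleLift (f : ℝ → UnitAddCircle) : ℝ → ℝ :=
  -- The value `0` for discontinuous curves makes continuity and vanishing at `0` hold without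
  -- hypotheses.
  if hf : Continuous f then (exists_lift_curve f hf).choose else 0

theorem continuous_circleLift (f : ℝ → UnitAddCircle) : Continuous (circleLift f) := by
  unfold circleLift
  split_ifs with hf
  · exact (exists_lift_curve f hf).choose_spec.1
  · exact continuous_const

theorem circleLift_zero (f : ℝ → UnitAddCircle) : circleLift f 0 = 0 := by
  unfold circleLift
  split_ifs with hf
  · exact (exists_lift_curve f hf).choose_spec.2.1
  · rfl

theorem eq_add_circleLift {f : ℝ → UnitAddCircle} (hf : Continuous f) (r : ℝ) :
    f r = f 0 + circleLift f r := by
  unfold circleLift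
  rw [dif_pos hf]
  exact (exists_lift_curve f hf).choose_spec.2.2 r

theorem circleLift_unique {f : ℝ → UnitAddCircle} (hf : Continuous f) {G : ℝ → ℝ}
    (hG : Continuous G) (h0 : G 0 = 0) (h : ∀ r, f r = f 0 + G r) : circleLift f = G :=
  UnitAddCircle.eq_of_coe_eq (continuous_circleLift f) hG
    (fun r => add_left_cancel ((eq_add_circleLift hf r).symm.trans (h r))) 0
    ((circleLift_zero f).trans h0.symm)

/-- The integer is the degree of the closed curve: both sides lift the same curve. -/
theorem circleLift_add_one {f : ℝ → UnitAddCircle} (hf : Continuous f)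
    (hp : ∀ r, f (r + 1) = f r) :
    ∃ w : ℤ, ∀ r, circleLift f (r + 1) = circleLift f r + w := by
  refine UnitAddCircle.exists_int_of_coe_eq
    ((continuous_circleLift f).comp (continuous_id.add continuous_const))
    (continuous_circleLift f) fun r => ?_
  apply add_left_cancel (a := f 0)
  rw [← eq_add_circleLift hf r, ← hp r]
  exact (eq_add_circleLift hf (r + 1)).symm

theorem add_int_of_add_one {G : ℝ → ℝ} {w : ℝ} (h : ∀ r, G (r + 1) = G r + w) (r : ℝ) (n : ℤ) :
    G (r + n) = G r + n * w := by
  induction n using Int.induction_on with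
  | zero => simp
  | succ n ih => push_cast at ih ⊢; rw [← add_assoc, h, ih]; ring
  | pred n ih =>
    have := h (r + (-(n : ℝ) - 1))
    push_cast at ih ⊢
    rw [show r + (-(n : ℝ) - 1) + 1 = r + -n by ring, ih] at this
    linarith

/-- The lift of an injective circle map is strictly monotone, and has degree `±1`. -/
theorem circleLift_of_injective {τ : UnitAddCircle → UnitAddCircle} (hτ : Continuous τ)
    (hi : Function.Injective τ) :
    ∃ σ : ℝ, (σ = 1 ∨ σ = -1) ∧ StrictMono (fun r => σ * circleLift (fun r => τ r) r) ∧
      ∀ r, circleLift (fun r => τ r) (r + 1) = circleLift (fun r => τ r) r + σ := by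
  set f : ℝ → UnitAddCircle := fun r => τ r with hfdef
  have hf : Continuous f := hτ.comp (AddCircle.continuous_mk' 1)
  set G := circleLift f with hG
  have hGc : Continuous G := continuous_circleLift f
  have hG0 : G 0 = 0 := circleLift_zero f
  obtain ⟨w, hw⟩ := circleLift_add_one hf (fun r => by simp only [f]; rw [UnitAddCircle.coe_add_one])
  have key : ∀ r s, G r = G s → ∃ n : ℤ, r = s + n := by
    intro r s h
    have : f r = f s := by rw [eq_add_circleLift hf r, eq_add_circleLift hf s]; simp [← hG, h]
    exact UnitAddCircle.coe_eq_coe_iff.1 (hi this)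
  have key' : ∀ r s : ℝ, ∀ m : ℤ, G r = G s + m → ∃ n : ℤ, r = s + n := by
    intro r s m h
    have : f r = f s := by
      rw [eq_add_circleLift hf r, eq_add_circleLift hf s, ← hG, h, UnitAddCircle.coe_add_int]
    exact UnitAddCircle.coe_eq_coe_iff.1 (hi this)
  have nint : ∀ n : ℤ, (0 : ℝ) < n → (n : ℝ) < 1 → False := by
    intro n h1 h2
    have h1' : 0 < n := by exact_mod_cast h1
    have h2' : n < 1 := by exact_mod_cast h2
    omega
  -- In degree zero the lift returns to its initial value after one turn, so it takes the value `G
  -- (1/2) / 2` on each half of the period, against injectivity on the circle.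
  have hw0 : w ≠ 0 := by
    rintro rfl
    have hG1 : G 1 = 0 := by have := hw 0; rw [zero_add, ← hG, hG0] at this; simpa using this
    have hc : G (1/2) ≠ 0 := by
      intro h
      obtain ⟨n, hn⟩ := key (1/2) 0 (by rw [h, hG0])
      exact nint n (by linarith) (by linarith)
    have h1 : G (1/2) / 2 ∈ uIcc (G 0) (G (1/2)) := by
      rw [hG0, mem_uIcc]; rcases le_total 0 (G (1/2)) with h | h
      · left; constructor <;> linarith
      · right; constructor <;> linarith
    have h2 : G (1/2) / 2 ∈ uIcc (G (1/2)) (G 1) := by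
      rw [hG1, mem_uIcc]; rcases le_total 0 (G (1/2)) with h | h
      · right; constructor <;> linarith
      · left; constructor <;> linarith
    obtain ⟨r, hr, hr'⟩ := intermediate_value_uIcc hGc.continuousOn h1
    obtain ⟨s, hs, hs'⟩ := intermediate_value_uIcc hGc.continuousOn h2
    rw [uIcc_of_le (by norm_num)] at hr hs
    have hr2 : r ≠ 1/2 := by rintro rfl; apply hc; linarith
    have hr0 : r ≠ 0 := by rintro rfl; apply hc; linarith
    have hr3 := lt_of_le_of_ne hr.2 hr2
    have hr4 := lt_of_le_of_ne hr.1 hr0.symm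
    obtain ⟨n, hn⟩ := key s r (by rw [hr', hs'])
    exact nint n (by linarith [hs.1]) (by linarith [hs.2])
  have hinj : Function.Injective G := by
    intro r s h
    obtain ⟨n, hn⟩ := key r s h
    have := add_int_of_add_one hw s n
    rw [← hn] at this
    have h2 : (n : ℝ) * w = 0 := by linarith
    have : (n : ℝ) = 0 := by
      rcases mul_eq_zero.1 h2 with h | h
      · exact h
      · exact absurd (by exact_mod_cast h) hw0
    rw [hn, this, add_zero]
  have hG1 : G 1 = w := by have := hw 0; rw [zero_add, ← hG, hG0] at this; simpa using this
  rcases hGc.strictMono_of_inj hinj with hm | hm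
  · have hpos : (0 : ℝ) < w := by rw [← hG1, ← hG0]; exact hm zero_lt_one
    have hw1 : w = 1 := by
      -- If the degree exceeds one, the lift already takes the value `1` strictly inside the period,
      -- so the circle map repeats its initial value too early.
      by_contra hne
      have h1w : (1 : ℝ) < w := by
        have : 0 < w := by exact_mod_cast hpos
        have : 1 < w := by omega
        exact_mod_cast this
      obtain ⟨r, hr, hr'⟩ := intermediate_value_Icc zero_le_one hGc.continuousOn
        (show (1 : ℝ) ∈ Icc (G 0) (G 1) by rw [hG0, hG1]; exact ⟨by norm_num, h1w.le⟩)
      obtain ⟨n, hn⟩ := key' r 0 1 (by rw [hr', hG0]; norm_num)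
      have h0 : r ≠ 0 := by rintro rfl; rw [hG0] at hr'; norm_num at hr'
      have h1 : r ≠ 1 := by rintro rfl; rw [hG1] at hr'; linarith
      exact nint n (by linarith [lt_of_le_of_ne hr.1 h0.symm]) (by linarith [lt_of_le_of_ne hr.2 h1])
    refine ⟨1, Or.inl rfl, by simpa using hm, fun r => ?_⟩
    have := hw r; rw [hw1] at this; simpa using this
  · have hneg : (w : ℝ) < 0 := by rw [← hG1, ← hG0]; exact hm zero_lt_one
    have hw1 : w = -1 := by
      by_contra hne
      have h1w : (w : ℝ) < -1 := by
        have : w < 0 := by exact_mod_cast hneg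
        have : w < -1 := by omega
        exact_mod_cast this
      obtain ⟨r, hr, hr'⟩ := intermediate_value_Icc' zero_le_one hGc.continuousOn
        (show (-1 : ℝ) ∈ Icc (G 1) (G 0) by rw [hG0, hG1]; exact ⟨h1w.le, by norm_num⟩)
      obtain ⟨n, hn⟩ := key' r 0 (-1) (by rw [hr', hG0]; norm_num)
      have h0 : r ≠ 0 := by rintro rfl; rw [hG0] at hr'; norm_num at hr'
      have h1 : r ≠ 1 := by rintro rfl; rw [hG1] at hr'; linarith
      exact nint n (by linarith [lt_of_le_of_ne hr.1 h0.symm]) (by linarith [lt_of_le_of_ne hr.2 h1])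
    refine ⟨-1, Or.inr rfl, fun r s h => by simpa using hm h, fun r => ?_⟩
    have := hw r; rw [hw1] at this; simpa using this

end CircleLift

/-- Inverting a continuous family of strictly increasing maps of the line. -/
theorem exists_inverse_family {B : Type*} [TopologicalSpace B] {V : Set B} (hV : IsOpen V)
    (Θ : B → ℝ → ℝ) (hc : ∀ b ∈ V, ∀ r, ContinuousAt (fun q : B × ℝ => Θ q.1 q.2) (b, r))
    (hm : ∀ b ∈ V, StrictMono (Θ b)) (hp : ∀ b ∈ V, ∀ r, Θ b (r + 1) = Θ b r + 1) :
    ∃ J : B → ℝ → ℝ, ∀ b ∈ V, (∀ s, Θ b (J b s) = s) ∧ (∀ r, J b (Θ b r) = r) ∧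
      (∀ s, ContinuousAt (fun q : B × ℝ => J q.1 q.2) (b, s)) ∧
      ∀ s, J b (s + 1) = J b s + 1 := by
  have hcb : ∀ b ∈ V, Continuous (Θ b) := fun b hb => continuous_iff_continuousAt.2 fun r =>
    (hc b hb r).comp (f := fun r => (b, r)) (by fun_prop)
  have hsurj : ∀ b ∈ V, Function.Surjective (Θ b) := by
    intro b hb s
    have hp' : ∀ n : ℤ, Θ b (0 + n) = Θ b 0 + n * 1 := fun n => add_int_of_add_one (hp b hb) 0 n
    -- Translation equivariance brackets `s` between the values at `n` and `n + 1`.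
    set n := ⌊s - Θ b 0⌋
    have h1 : Θ b n ≤ s := by
      have := hp' n; rw [zero_add] at this; rw [this]; linarith [Int.floor_le (s - Θ b 0)]
    have h2 : s ≤ Θ b (n + 1) := by
      have := hp' (n + 1); push_cast at this; rw [zero_add] at this; rw [this]
      linarith [Int.lt_floor_add_one (s - Θ b 0)]
    obtain ⟨r, -, hr⟩ := intermediate_value_Icc (by linarith : (n : ℝ) ≤ n + 1)
      (hcb b hb).continuousOn ⟨h1, h2⟩
    exact ⟨r, hr⟩
  classical
  let J : B → ℝ → ℝ := fun b s => if hb : b ∈ V then (hsurj b hb s).choose else 0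
  have hJ : ∀ b ∈ V, ∀ s, Θ b (J b s) = s := fun b hb s => by
    simp only [J, dif_pos hb]; exact (hsurj b hb s).choose_spec
  have hJ' : ∀ b ∈ V, ∀ r, J b (Θ b r) = r := fun b hb r => (hm b hb).injective (hJ b hb _)
  refine ⟨J, fun b hb => ⟨hJ b hb, hJ' b hb, fun s => ?_, fun s => ?_⟩⟩
  · have hlt : ∀ r, r < J b s → ∀ᶠ q : B × ℝ in 𝓝 (b, s), r < J q.1 q.2 := by
      intro r hr
      have h1 : ContinuousAt (fun q : B × ℝ => Θ q.1 r) (b, s) :=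
        ContinuousAt.comp (x := (b, s)) (f := fun q : B × ℝ => (q.1, r))
        (g := fun q : B × ℝ => Θ q.1 q.2) (hc b hb r) (by fun_prop)
      have h2 : Θ b r < s := by conv_rhs => rw [← hJ b hb s]
                                exact hm b hb hr
      have h3 := h1.eventually_lt (g := fun q : B × ℝ => q.2) continuousAt_snd h2
      have h4 : ∀ᶠ q : B × ℝ in 𝓝 (b, s), q.1 ∈ V :=
        continuousAt_fst.eventually_mem (hV.mem_nhds hb)
      filter_upwards [h3, h4] with q h5 h6
      rwa [← (hm _ h6).lt_iff_lt, hJ _ h6]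
    have hgt : ∀ r, J b s < r → ∀ᶠ q : B × ℝ in 𝓝 (b, s), J q.1 q.2 < r := by
      intro r hr
      have h1 : ContinuousAt (fun q : B × ℝ => Θ q.1 r) (b, s) :=
        ContinuousAt.comp (x := (b, s)) (f := fun q : B × ℝ => (q.1, r))
        (g := fun q : B × ℝ => Θ q.1 q.2) (hc b hb r) (by fun_prop)
      have h2 : s < Θ b r := by conv_lhs => rw [← hJ b hb s]
                                exact hm b hb hr
      have h3 := ContinuousAt.eventually_lt (f := fun q : B × ℝ => q.2) continuousAt_snd h1 h2
      have h4 : ∀ᶠ q : B × ℝ in 𝓝 (b, s), q.1 ∈ V :=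
        continuousAt_fst.eventually_mem (hV.mem_nhds hb)
      filter_upwards [h3, h4] with q h5 h6
      rwa [← (hm _ h6).lt_iff_lt, hJ _ h6]
    exact tendsto_order.2 ⟨hlt, hgt⟩
  · apply (hm b hb).injective
    rw [hJ b hb, hp b hb, hJ b hb]

end

/-! ### Reduction of the structure group of the circle bundle to isometries -/

section

section Frames

variable {S : Type u} {M : Type v} [TopologicalSpace S] [TopologicalSpace M] {p : M → S}

/-- The inverse of a trivialization of a circle bundle, with the circle written additively. -/
noncomputable def trivInv (e : Bundle.Trivialization Circle p) (b : S) (τ : UnitAddCircle) : M :=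
  e.toOpenPartialHomeomorph.symm (b, AddCircle.homeomorphCircle one_ne_zero τ)

/-- The circle coordinate of a trivialization of a circle bundle, written additively. -/
noncomputable def trivAng (e : Bundle.Trivialization Circle p) (m : M) : UnitAddCircle :=
  (AddCircle.homeomorphCircle one_ne_zero).symm (e m).2

theorem proj_trivInv (e : Bundle.Trivialization Circle p) {b : S} (hb : b ∈ e.baseSet)
    (τ : UnitAddCircle) : p (trivInv e b τ) = b :=
  e.proj_symm_apply' hb

theorem trivAng_trivInv (e : Bundle.Trivialization Circle p) {b : S} (hb : b ∈ e.baseSet)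
    (τ : UnitAddCircle) : trivAng e (trivInv e b τ) = τ := by
  simp [trivAng, trivInv, e.apply_symm_apply' hb]

theorem trivInv_trivAng (e : Bundle.Trivialization Circle p) {m : M} (hm : p m ∈ e.baseSet) :
    trivInv e (p m) (trivAng e m) = m := by
  simp only [trivAng, trivInv, Homeomorph.apply_symm_apply]
  exact e.symm_apply_mk_proj (e.mem_source.2 hm)

theorem continuousAt_trivInv (e : Bundle.Trivialization Circle p) {b : S} (hb : b ∈ e.baseSet)
    (τ : UnitAddCircle) : ContinuousAt (fun q : S × UnitAddCircle => trivInv e q.1 q.2) (b, τ) := by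
  have h : (b, AddCircle.homeomorphCircle one_ne_zero τ) ∈ e.target := by
    rw [e.mem_target]; exact hb
  exact ContinuousAt.comp (x := (b, τ))
    (g := e.toOpenPartialHomeomorph.symm)
    (f := fun q : S × UnitAddCircle => (q.1, AddCircle.homeomorphCircle (one_ne_zero' ℝ) q.2))
    (e.toOpenPartialHomeomorph.continuousAt_symm h) (by fun_prop)

theorem continuousAt_trivAng (e : Bundle.Trivialization Circle p) {m : M} (hm : p m ∈ e.baseSet) :
    ContinuousAt (trivAng e) m := by
  have h := e.toOpenPartialHomeomorph.continuousAt (e.mem_source.2 hm)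
  exact (AddCircle.homeomorphCircle (one_ne_zero' ℝ)).symm.continuous.continuousAt.comp
    (continuousAt_snd.comp h)

/-- The coordinate change between two trivializations over `b`. -/
noncomputable def trivChange (e e' : Bundle.Trivialization Circle p) (b : S) (τ : UnitAddCircle) :
    UnitAddCircle := trivAng e' (trivInv e b τ)

theorem trivInv_trivChange (e e' : Bundle.Trivialization Circle p) {b : S} (hb : b ∈ e.baseSet)
    (hb' : b ∈ e'.baseSet) (τ : UnitAddCircle) :
    trivInv e' b (trivChange e e' b τ) = trivInv e b τ := by
  have h := proj_trivInv e hb τ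
  have := trivInv_trivAng e' (m := trivInv e b τ) (by rw [h]; exact hb')
  rwa [h] at this

theorem trivChange_trans (e e' e'' : Bundle.Trivialization Circle p) {b : S} (hb : b ∈ e.baseSet)
    (hb' : b ∈ e'.baseSet) (τ : UnitAddCircle) :
    trivChange e' e'' b (trivChange e e' b τ) = trivChange e e'' b τ := by
  rw [trivChange, trivInv_trivChange e e' hb hb', trivChange]

theorem continuousAt_trivChange (e e' : Bundle.Trivialization Circle p) {b : S}
    (hb : b ∈ e.baseSet) (hb' : b ∈ e'.baseSet) (τ : UnitAddCircle) :
    ContinuousAt (fun q : S × UnitAddCircle => trivChange e e' q.1 q.2) (b, τ) := by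
  have h := proj_trivInv e hb τ
  exact ContinuousAt.comp (x := (b, τ)) (g := trivAng e')
    (f := fun q : S × UnitAddCircle => trivInv e q.1 q.2)
    (continuousAt_trivAng e' (by rw [h]; exact hb')) (continuousAt_trivInv e hb τ)

theorem continuous_trivChange (e e' : Bundle.Trivialization Circle p) {b : S}
    (hb : b ∈ e.baseSet) (hb' : b ∈ e'.baseSet) : Continuous (trivChange e e' b) :=
  continuous_iff_continuousAt.2 fun τ => ContinuousAt.comp (x := τ)
    (f := fun τ => (b, τ)) (g := fun q : S × UnitAddCircle => trivChange e e' q.1 q.2)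
    (continuousAt_trivChange e e' hb hb' τ) (by fun_prop)

theorem trivChange_injective (e e' : Bundle.Trivialization Circle p) {b : S}
    (hb : b ∈ e.baseSet) (hb' : b ∈ e'.baseSet) : Function.Injective (trivChange e e' b) := by
  intro τ τ' h
  have := congrArg (trivInv e' b) h
  rw [trivInv_trivChange e e' hb hb', trivInv_trivChange e e' hb hb'] at this
  rw [← trivAng_trivInv e hb τ, this, trivAng_trivInv e hb]

/-- The normalized lift of a coordinate change: zero at zero and increasing. -/
noncomputable def trivLift (e e' : Bundle.Trivialization Circle p) (b : S) (r : ℝ) : ℝ :=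
  circleLift (fun r => trivChange e e' b r) r

/-- Over the overlap of the base sets the lift of the whole family is jointly continuous, and it
restricts to the lift on each fibre by uniqueness. -/
theorem continuousAt_trivLift (e e' : Bundle.Trivialization Circle p) {b : S}
    (hb : b ∈ e.baseSet) (hb' : b ∈ e'.baseSet) (r : ℝ) :
    ContinuousAt (fun q : S × ℝ => trivLift e e' q.1 q.2) (b, r) := by
  let V : Set S := e.baseSet ∩ e'.baseSet
  have hV : IsOpen V := e.open_baseSet.inter e'.open_baseSet
  have hcc : ∀ b : V, Continuous (fun r : ℝ => trivChange e e' b r) := fun b =>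
    (continuous_trivChange e e' b.2.1 b.2.2).comp (AddCircle.continuous_mk' 1)
  obtain ⟨G, hG, hG0, hG1⟩ := exists_lift_family (B := V)
    (fun q => trivChange e e' q.1 (q.2 : UnitAddCircle)) (by
      refine continuous_iff_continuousAt.2 fun q => ?_
      refine ContinuousAt.comp (x := q) (g := fun q : S × UnitAddCircle => trivChange e e' q.1 q.2)
        (f := fun q : V × ℝ => ((q.1 : S), (q.2 : UnitAddCircle)))
        (continuousAt_trivChange e e' q.1.2.1 q.1.2.2 _) ?_
      exact (continuous_subtype_val.comp continuous_fst).prodMk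
        ((AddCircle.continuous_mk' 1).comp continuous_snd) |>.continuousAt)
  have heq : ∀ b : V, ∀ r, trivLift e e' b r = G (b, r) := fun b r =>
    congrFun (circleLift_unique (hcc b) (G := fun r => G (b, r)) (by fun_prop) (hG0 b)
      (hG1 b)) r
  have ho : IsOpenEmbedding (fun q : V × ℝ => ((q.1 : S), q.2)) :=
    hV.isOpenEmbedding_subtypeVal.prodMap .id
  have := ho.continuousAt_iff (g := fun q : S × ℝ => trivLift e e' q.1 q.2)
    (x := ((⟨b, hb, hb'⟩ : V), r))
  refine this.1 ?_
  have h2 : (fun q : S × ℝ => trivLift e e' q.1 q.2) ∘ (fun q : V × ℝ => ((q.1 : S), q.2)) = G := by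
    ext q; exact heq q.1 q.2
  rw [h2]
  exact hG.continuousAt

theorem trivLift_zero (e e' : Bundle.Trivialization Circle p) (b : S) : trivLift e e' b 0 = 0 :=
  circleLift_zero _

/-- The lift vanishes at `0`, so its value at `1` is the degree; multiplying by it turns the lift
into an increasing map that commutes with unit translation. -/
theorem trivLift_spec (e e' : Bundle.Trivialization Circle p) {b : S}
    (hb : b ∈ e.baseSet) (hb' : b ∈ e'.baseSet) :
    (trivLift e e' b 1 = 1 ∨ trivLift e e' b 1 = -1) ∧
    StrictMono (fun r => trivLift e e' b 1 * trivLift e e' b r) ∧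
    (∀ r, trivLift e e' b (r + 1) = trivLift e e' b r + trivLift e e' b 1) ∧
    ∀ r : ℝ, trivChange e e' b r = trivChange e e' b 0 + trivLift e e' b r := by
  obtain ⟨σ, h1, h2, h3⟩ := circleLift_of_injective (continuous_trivChange e e' hb hb')
    (trivChange_injective e e' hb hb')
  have h4 : trivLift e e' b 1 = σ := by
    have := h3 0
    rw [zero_add, circleLift_zero, zero_add] at this
    exact this
  rw [h4]
  refine ⟨h1, h2, h3, fun r => ?_⟩
  have := eq_add_circleLift (f := fun r : ℝ => trivChange e e' b r)
    ((continuous_trivChange e e' hb hb').comp (AddCircle.continuous_mk' 1)) r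
  simpa [trivLift] using this

/-- Both sides lift the same composite coordinate change and agree at `0`. The number `t` records
where the first change sends the base point. -/
theorem trivLift_comp (e e' e'' : Bundle.Trivialization Circle p) {b : S}
    (hb : b ∈ e.baseSet) (hb' : b ∈ e'.baseSet) (hb'' : b ∈ e''.baseSet) {t : ℝ}
    (ht : (t : UnitAddCircle) = trivChange e e' b 0) (r : ℝ) :
    trivLift e' e'' b (t + trivLift e e' b r) = trivLift e' e'' b t + trivLift e e'' b r := by
  have c1 : ∀ e e' : Bundle.Trivialization Circle p, Continuous (trivLift e e' b) := fun e e' =>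
    continuous_circleLift _
  have := UnitAddCircle.eq_of_coe_eq (X := ℝ)
    (F := fun r => trivLift e' e'' b (t + trivLift e e' b r))
    (G := fun r => trivLift e' e'' b t + trivLift e e'' b r)
    ((c1 _ _).comp (continuous_const.add (c1 _ _))) (continuous_const.add (c1 _ _)) (fun r => ?_) 0
    (by simp [trivLift_zero])
  · exact congrFun this r
  · have h1 := (trivLift_spec e' e'' hb' hb'').2.2.2
    have h2 := (trivLift_spec e e' hb hb').2.2.2
    have h3 := (trivLift_spec e e'' hb hb'').2.2.2
    apply add_left_cancel (a := trivChange e' e'' b 0)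
    rw [← h1, AddCircle.coe_add, AddCircle.coe_add, ht, ← h2, trivChange_trans _ _ _ hb hb',
      ← add_assoc, ← h1, ht, trivChange_trans _ _ _ hb hb', ← h3]

theorem trivLift_one_mul (e e' e'' : Bundle.Trivialization Circle p) {b : S}
    (hb : b ∈ e.baseSet) (hb' : b ∈ e'.baseSet) (hb'' : b ∈ e''.baseSet) :
    trivLift e e'' b 1 = trivLift e e' b 1 * trivLift e' e'' b 1 := by
  obtain ⟨t, ht⟩ := UnitAddCircle.exists_coe (trivChange e e' b 0)
  have h := trivLift_comp e e' e'' hb hb' hb'' ht 1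
  have h2 := (trivLift_spec e' e'' hb' hb'').2.2.1
  rcases (trivLift_spec e e' hb hb').1 with h1 | h1
  · rw [h1] at h ⊢; rw [h2] at h; linarith
  · rw [h1] at h ⊢
    have := h2 (t + -1)
    rw [neg_add_cancel_right] at this
    linarith

/-- A circle bundle over a compact Hausdorff space has a covering family of local parametrizations
of its fibres by the circle, which differ by isometries of the circle. -/
theorem exists_isometric_frames [CompactSpace S] [T2Space S]
    (hp : ∀ x : S, ∃ e : Bundle.Trivialization Circle p, x ∈ e.baseSet) :
    ∃ (ι : Type u) (U : ι → Set S) (Fr : ι → S → UnitAddCircle → M),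
      (∀ i, IsOpen (U i)) ∧ (∀ b, ∃ i, b ∈ U i) ∧
      (∀ i, ∀ b ∈ U i, ∀ r, p (Fr i b r) = b) ∧
      (∀ i, ∀ b ∈ U i, Function.Injective (Fr i b)) ∧
      (∀ i, ∀ b ∈ U i, ∀ m, p m = b → ∃ r, Fr i b r = m) ∧
      (∀ i, ∀ b ∈ U i, ∀ r, ContinuousAt (fun q : S × UnitAddCircle => Fr i q.1 q.2) (b, r)) ∧
      ∀ i j b, b ∈ U i → b ∈ U j → ∃ s, (∀ r, Fr j b r = Fr i b (s + r)) ∨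
        ∀ r, Fr j b r = Fr i b (s - r) := by
  choose e he using hp
  obtain ⟨t, ht⟩ := isCompact_univ.elim_finite_subcover (fun x => (e x).baseSet)
    (fun x => (e x).open_baseSet) (fun x _ => mem_iUnion.2 ⟨x, he x⟩)
  have hcov : ∀ b, ∃ i : t, b ∈ (e i).baseSet := fun b => by
    obtain ⟨i, hi, hb⟩ := mem_iUnion₂.1 (ht (mem_univ b))
    exact ⟨⟨i, hi⟩, hb⟩
  obtain ⟨χ, hχ⟩ := PartitionOfUnity.exists_isSubordinate isClosed_univ
    (fun i : t => (e i).baseSet) (fun i => (e i).open_baseSet)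
    (fun b _ => mem_iUnion.2 (hcov b))
  have hχ1 : ∀ b, ∑ k, χ k b = 1 := fun b => by
    rw [← finsum_eq_sum_of_fintype]; exact χ.sum_eq_one (mem_univ b)
  have hχU : ∀ k b, χ k b ≠ 0 → b ∈ (e k).baseSet := fun k b h =>
    hχ k (subset_tsupport _ h)
  -- Average of the orientation-corrected lifts from the frame `i` to all frames. Strict
  -- monotonicity and equivariance under unit translation survive convex combinations, so each
  -- average is again an admissible coordinate on the universal cover of the fibre.
  let Θ : t → S → ℝ → ℝ := fun i b r =>
    ∑ k, χ k b * (trivLift (e i) (e k) b 1 * trivLift (e i) (e k) b r)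
  have hΘc : ∀ i : t, ∀ b ∈ (e i).baseSet, ∀ r,
      ContinuousAt (fun q : S × ℝ => Θ i q.1 q.2) (b, r) := by
    intro i b hb r
    refine tendsto_finsetSum _ fun k _ => ?_
    -- Off the support the term vanishes nearby, so the poor behaviour of the lift outside the
    -- overlap does no harm.
    by_cases hk : b ∈ tsupport (χ k)
    · have hbk := hχ k hk
      refine ContinuousAt.mul ((χ k).continuous.comp continuous_fst).continuousAt
        (ContinuousAt.mul ?_ (continuousAt_trivLift _ _ hb hbk r))
      exact ContinuousAt.comp (x := (b, r)) (f := fun q : S × ℝ => (q.1, (1 : ℝ)))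
        (g := fun q : S × ℝ => trivLift (e i) (e k) q.1 q.2)
        (continuousAt_trivLift _ _ hb hbk 1) (by fun_prop)
    · have h1 : ∀ᶠ q : S × ℝ in 𝓝 (b, r), χ k q.1 = 0 := by
        have := (isClosed_tsupport (χ k)).isOpen_compl.mem_nhds hk
        filter_upwards [continuousAt_fst.eventually_mem (x := (b, r)) this] with q hq
        exact image_eq_zero_of_notMem_tsupport hq
      have h2 : χ k b = 0 := image_eq_zero_of_notMem_tsupport hk
      have h3 : Filter.Tendsto (fun _ : S × ℝ => (0 : ℝ)) (𝓝 (b, r)) (𝓝 0) := tendsto_const_nhds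
      simp only [h2, zero_mul]
      refine h3.congr' ?_
      filter_upwards [h1] with q hq
      rw [hq, zero_mul]
  have hΘm : ∀ i : t, ∀ b ∈ (e i).baseSet, StrictMono (Θ i b) := by
    intro i b hb r s hrs
    have hle : ∀ k : t, χ k b * (trivLift (e i) (e k) b 1 * trivLift (e i) (e k) b r) ≤
        χ k b * (trivLift (e i) (e k) b 1 * trivLift (e i) (e k) b s) := by
      intro k
      by_cases h : χ k b = 0
      · simp [h]
      · exact mul_le_mul_of_nonneg_left
          ((trivLift_spec _ _ hb (hχU k b h)).2.1.monotone hrs.le) (χ.nonneg k b)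
    obtain ⟨k, hk⟩ : ∃ k, χ k b ≠ 0 := by
      by_contra! h
      have := hχ1 b
      simp [h] at this
    refine Finset.sum_lt_sum (fun k _ => hle k) ⟨k, Finset.mem_univ _, ?_⟩
    exact mul_lt_mul_of_pos_left ((trivLift_spec _ _ hb (hχU k b hk)).2.1 hrs)
      (lt_of_le_of_ne (χ.nonneg k b) hk.symm)
  have hΘp : ∀ i : t, ∀ b ∈ (e i).baseSet, ∀ r, Θ i b (r + 1) = Θ i b r + 1 := by
    intro i b hb r
    have hsum : Θ i b r + 1 = ∑ k, (χ k b *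
        (trivLift (e i) (e k) b 1 * trivLift (e i) (e k) b r) + χ k b) := by
      rw [Finset.sum_add_distrib, hχ1 b]
    rw [hsum]
    refine Finset.sum_congr rfl fun k _ => ?_
    by_cases h : χ k b = 0
    · simp [h]
    · obtain ⟨h1, -, h2, -⟩ := trivLift_spec (e i) (e k) hb (hχU k b h)
      rw [h2]
      rcases h1 with h1 | h1 <;> rw [h1] <;> ring
  choose J hJ using fun i : t =>
    exists_inverse_family (e i).open_baseSet (Θ i) (hΘc i) (hΘm i) (hΘp i)
  choose rep hrep using UnitAddCircle.exists_coe
  -- The new frame is the trivialization reparametrized by the inverse of the average. The choice of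
  -- representative is immaterial because `J` commutes with integer translations.
  let Fr : t → S → UnitAddCircle → M := fun i b τ => trivInv (e i) b (J i b (rep τ))
  have hFr : ∀ i : t, ∀ b ∈ (e i).baseSet, ∀ s : ℝ, Fr i b s = trivInv (e i) b (J i b s) := by
    intro i b hb s
    obtain ⟨n, hn⟩ := UnitAddCircle.coe_eq_coe_iff.1 (hrep s)
    simp only [Fr, hn]
    rw [add_int_of_add_one (w := 1) (hJ i b hb).2.2.2, mul_one, UnitAddCircle.coe_add_int]
  have hopen : IsOpenMap (fun q : S × ℝ => (q.1, (q.2 : UnitAddCircle))) :=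
    IsOpenMap.id.prodMap QuotientAddGroup.isOpenMap_coe
  refine ⟨ULift.{u} t, fun i => (e i.down).baseSet, fun i => Fr i.down,
    fun i => (e i.down).open_baseSet, fun b => (hcov b).imp' ULift.up fun i hi => hi,
    fun i b hb r => proj_trivInv _ hb _, ?_, ?_, ?_, ?_⟩
  · intro i b hb r r' h
    obtain ⟨r, rfl⟩ := UnitAddCircle.exists_coe r
    obtain ⟨r', rfl⟩ := UnitAddCircle.exists_coe r'
    simp only [hFr _ b hb] at h
    have h2 := congrArg (trivAng (e i.down)) h
    rw [trivAng_trivInv _ hb, trivAng_trivInv _ hb] at h2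
    obtain ⟨n, hn⟩ := UnitAddCircle.coe_eq_coe_iff.1 h2
    have h3 := congrArg (Θ i.down b) hn
    rw [(hJ i.down b hb).1, add_int_of_add_one (w := 1) (hΘp i.down b hb), (hJ i.down b hb).1,
      mul_one] at h3
    rw [h3, UnitAddCircle.coe_add_int]
  · intro i b hb m hm
    subst hm
    obtain ⟨r, hr⟩ := UnitAddCircle.exists_coe (trivAng (e i.down) m)
    refine ⟨(Θ i.down (p m) r : ℝ), ?_⟩
    show Fr i.down (p m) _ = m
    rw [hFr _ _ hb, (hJ i.down (p m) hb).2.1, hr, trivInv_trivAng _ hb]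
  · intro i b hb r
    obtain ⟨r, rfl⟩ := UnitAddCircle.exists_coe r
    have h1 : Filter.Tendsto ((fun q : S × UnitAddCircle => Fr i.down q.1 q.2) ∘
        (fun q : S × ℝ => (q.1, (q.2 : UnitAddCircle)))) (𝓝 (b, r))
        (𝓝 (Fr i.down b r)) := by
      have h2 : ContinuousAt (fun q : S × ℝ =>
          trivInv (e i.down) q.1 (J i.down q.1 q.2 : ℝ)) (b, r) := by
        refine ContinuousAt.comp (x := (b, r))
          (g := fun q : S × UnitAddCircle => trivInv (e i.down) q.1 q.2)
          (f := fun q : S × ℝ => (q.1, ((J i.down q.1 q.2 : ℝ) : UnitAddCircle)))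
          (continuousAt_trivInv _ hb _) ?_
        exact continuousAt_fst.prodMk
          ((AddCircle.continuous_mk' (1 : ℝ)).continuousAt.comp ((hJ i.down b hb).2.2.1 r))
      have h3 := h2.tendsto
      rw [← hFr i.down b hb r] at h3
      refine h3.congr' ?_
      have : ∀ᶠ q : S × ℝ in 𝓝 (b, r), q.1 ∈ (e i.down).baseSet :=
        continuousAt_fst.eventually_mem ((e i.down).open_baseSet.mem_nhds hb)
      filter_upwards [this] with q hq
      exact (hFr i.down q.1 hq q.2).symm
    -- Continuity descends to the circle because the quotient map from the line is open.
    rw [ContinuousAt, Filter.tendsto_def]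
    intro s hs
    have h4 := h1 hs
    exact hopen.nhds_le (b, r) h4
  · rintro ⟨i⟩ ⟨j⟩ b hb hb'
    simp only at hb hb' ⊢
    obtain ⟨t0, ht0⟩ := UnitAddCircle.exists_coe (trivChange (e j) (e i) b 0)
    obtain ⟨h1, h2, h3, h4⟩ := trivLift_spec (e j) (e i) hb' hb
    set σ := trivLift (e j) (e i) b 1 with hσ
    have hσ2 : σ * σ = 1 := by rcases h1 with h | h <;> rw [h] <;> norm_num
    -- Composition of lifts and multiplicativity of the degree, applied term by term: changing the
    -- frame alters the average by a sign and an additive constant, that is, by an isometry.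
    have key : ∀ r : ℝ, Θ i b (t0 + trivLift (e j) (e i) b r) = Θ i b t0 + σ * Θ j b r := by
      intro r
      simp only [Θ]
      rw [Finset.mul_sum, ← Finset.sum_add_distrib]
      refine Finset.sum_congr rfl fun k _ => ?_
      by_cases h : χ k b = 0
      · simp [h]
      · have hk := hχU k b h
        rw [trivLift_comp _ _ _ hb' hb hk ht0, trivLift_one_mul (e j) (e i) (e k) hb' hb hk, ← hσ]
        linear_combination (- χ k b * trivLift (e i) (e k) b 1 * trivLift (e j) (e k) b r) * hσ2
    have main : ∀ r : ℝ, Fr j b r = Fr i b ((Θ i b t0 : ℝ) + ((σ * r : ℝ) : UnitAddCircle)) := by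
      intro r
      set x := J j b r with hx
      have hx' : Θ j b x = r := (hJ j b hb').1 r
      have h5 := key x
      rw [hx'] at h5
      rw [← AddCircle.coe_add, hFr j b hb', hFr i b hb, ← h5, (hJ i b hb).2.1, ← hx,
        AddCircle.coe_add, ht0, ← h4 x, trivInv_trivChange _ _ hb' hb]
    refine ⟨(Θ i b t0 : ℝ), ?_⟩
    rcases h1 with h1 | h1
    · left
      intro r
      obtain ⟨r, rfl⟩ := UnitAddCircle.exists_coe r
      rw [main r, h1, one_mul]
    · right
      intro r
      obtain ⟨r, rfl⟩ := UnitAddCircle.exists_coe r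
      rw [main r, h1, neg_one_mul, AddCircle.coe_neg, sub_eq_add_neg]

end Frames

end

/-! ### Coverings built from local sections -/

section

section Sheets

variable {E B ι : Type*} [TopologicalSpace B]

/-- The final topology for a family of partial sections of a map `E → B`. -/
@[reducible]
def sheetTopology (V : ι → Set B) (hV : ∀ i, IsOpen (V i)) (s : ι → B → E) :
    TopologicalSpace E where
  IsOpen O := ∀ i, IsOpen {b | b ∈ V i ∧ s i b ∈ O}
  isOpen_univ i := by simpa using hV i
  isOpen_inter O O' h h' i := by
    convert (h i).inter (h' i) using 1
    ext b; simp +contextual; try tauto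
  isOpen_sUnion 𝒪 h i := by
    have : {b | b ∈ V i ∧ s i b ∈ ⋃₀ 𝒪} = ⋃ O ∈ 𝒪, {b | b ∈ V i ∧ s i b ∈ O} := by
      ext b; simp +contextual; try tauto
    rw [this]
    exact isOpen_biUnion fun O hO => h O hO i

variable {V : ι → Set B} {hV : ∀ i, IsOpen (V i)} {s : ι → B → E} {q : E → B}

/-- Sections are determined by base points, so one sheet meets another exactly over the open set
where the two agree. -/
theorem sheetTopology.isOpen_image (hs : ∀ i, ∀ b ∈ V i, q (s i b) = b)
    (hco : ∀ i j, IsOpen {b | b ∈ V i ∧ b ∈ V j ∧ s i b = s j b}) (i : ι) {W : Set B}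
    (hW : IsOpen W) (hWV : W ⊆ V i) :
    IsOpen[sheetTopology V hV s] (s i '' W) := by
  intro j
  have : {b | b ∈ V j ∧ s j b ∈ s i '' W} = W ∩ {b | b ∈ V i ∧ b ∈ V j ∧ s i b = s j b} := by
    ext b
    constructor
    · rintro ⟨hb, c, hc, hcb⟩
      have : c = b := by rw [← hs i c (hWV hc), hcb, hs j b hb]
      subst this
      exact ⟨hc, hWV hc, hb, hcb⟩
    · rintro ⟨hb, h1, h2, h3⟩
      exact ⟨h2, b, hb, h3⟩
  rw [this]
  exact hW.inter (hco i j)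

theorem sheetTopology.continuousAt (i : ι) {b : B} (hb : b ∈ V i) :
    letI := sheetTopology V hV s
    ContinuousAt (s i) b := by
  let := sheetTopology V hV s
  refine continuousAt_def.2 fun A hA => ?_
  obtain ⟨O, hOA, hO, hbO⟩ := mem_nhds_iff.1 hA
  have h1 : IsOpen {b | b ∈ V i ∧ s i b ∈ O} := hO i
  exact Filter.mem_of_superset (h1.mem_nhds ⟨hb, hbO⟩) fun c hc => hOA hc.2

/-- Two sheets over all of `W` that meet over `W` coincide there. A point over `W` is therefore
labelled by the value over `b₀` of the sheet through it, and base point and label trivialize the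
projection. -/
theorem sheetTopology.isCoveringMap (hs : ∀ i, ∀ b ∈ V i, q (s i b) = b)
    (hco : ∀ i j, IsOpen {b | b ∈ V i ∧ b ∈ V j ∧ s i b = s j b})
    (hev : ∀ b₀, ∃ W, IsOpen W ∧ b₀ ∈ W ∧ (∀ e, q e ∈ W → ∃ i, W ⊆ V i ∧ s i (q e) = e) ∧
      ∀ i j, W ⊆ V i → W ⊆ V j → (∃ b ∈ W, s i b = s j b) → ∀ b ∈ W, s i b = s j b) :
    @IsCoveringMap E B (sheetTopology V hV s) _ q := by
  let tE := sheetTopology V hV s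
  have hqc : Continuous q := by
    refine continuous_def.2 fun O hO i => ?_
    convert (hV i).inter hO using 1
    ext b
    constructor
    · rintro ⟨h1, h2⟩; exact ⟨h1, by simpa [hs i b h1] using h2⟩
    · rintro ⟨h1, h2⟩; exact ⟨h1, by simpa [hs i b h1] using h2⟩
  intro b₀
  obtain ⟨W, hW, hb₀, hex, huni⟩ := hev b₀
  -- An index is chosen for every point, also off `W`, so that the labelling needs no membership
  -- proofs.
  have hex' : ∀ e, ∃ i, q e ∈ W → W ⊆ V i ∧ s i (q e) = e := fun e => by
    obtain ⟨W', -, h1, h2, -⟩ := hev (q e)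
    obtain ⟨i, -⟩ := h2 e h1
    by_cases h : q e ∈ W
    · obtain ⟨j, hj⟩ := hex e h
      exact ⟨j, fun _ => hj⟩
    · exact ⟨i, fun h' => absurd h' h⟩
  choose idx hidx₀ using hex'
  have hidx : ∀ e, q e ∈ W → W ⊆ V (idx e) := fun e h => (hidx₀ e h).1
  have hidx' : ∀ e, q e ∈ W → s (idx e) (q e) = e := fun e h => (hidx₀ e h).2
  let I := {k : E // q k = b₀}
  let : TopologicalSpace I := ⊥
  have : DiscreteTopology I := ⟨rfl⟩
  have hk : ∀ k : I, W ⊆ V (idx k) ∧ s (idx k) b₀ = k := fun k =>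
    have h : q k ∈ W := by rw [k.2]; exact hb₀
    ⟨hidx k h, by have := hidx' k h; rwa [k.2] at this⟩
  have hlab : ∀ e : q ⁻¹' W, q (s (idx e) b₀) = b₀ := fun e => hs _ _ (hidx e e.2 hb₀)
  let lab : q ⁻¹' W → I := fun e => ⟨s (idx e) b₀, hlab e⟩
  have hlabs : ∀ e : q ⁻¹' W, ∀ b ∈ W, s (idx (lab e : E)) b = s (idx e) b := fun e =>
    huni _ _ (hk (lab e)).1 (hidx e e.2) ⟨b₀, hb₀, (hk (lab e)).2⟩
  have hmem : ∀ (k : I) (b : W), s (idx k) b ∈ q ⁻¹' W := fun k b => by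
    show q _ ∈ W
    rw [hs _ _ ((hk k).1 b.2)]; exact b.2
  let H : q ⁻¹' W ≃ₜ W × I :=
    { toFun := fun e => (⟨q e, e.2⟩, lab e)
      invFun := fun x => ⟨s (idx x.2) x.1, hmem x.2 x.1⟩
      left_inv := fun e => Subtype.ext (by
        show s (idx (lab e : E)) (q e) = e
        rw [hlabs e _ e.2, hidx' _ e.2])
      right_inv := fun x => by
        obtain ⟨b, k⟩ := x
        have h1 : q (s (idx k) b) = b := hs _ _ ((hk k).1 b.2)
        refine Prod.ext (Subtype.ext h1) (Subtype.ext ?_)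
        show s (idx (s (idx k) b)) b₀ = k
        refine Eq.trans ?_ (hk k).2
        have h2 : q (s (idx k) b) ∈ W := hmem k b
        refine huni _ _ (hidx _ h2) (hk k).1 ⟨b, b.2, ?_⟩ b₀ hb₀
        have h3 := hidx' _ h2
        rw [h1] at h3
        exact h3
      continuous_toFun := by
        refine Continuous.prodMk ((hqc.comp continuous_subtype_val).subtype_mk _) ?_
        refine continuous_discrete_rng.2 fun k => ?_
        refine ⟨s (idx k) '' W, sheetTopology.isOpen_image hs hco _ hW (hk k).1, ?_⟩
        ext e
        constructor
        · rintro ⟨b, hb, hbe⟩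
          have h1 : q e = b := by rw [← hbe, hs _ _ ((hk k).1 hb)]
          refine Subtype.ext ?_
          show s (idx e) b₀ = k
          refine Eq.trans ?_ (hk k).2
          refine huni _ _ (hidx _ e.2) (hk k).1 ⟨b, hb, ?_⟩ b₀ hb₀
          have h3 := hidx' _ e.2
          rw [h1] at h3
          rw [h3, hbe]
        · intro h
          have h' : lab e = k := h
          subst h'
          exact ⟨q e, e.2, by rw [hlabs e _ e.2, hidx' _ e.2]⟩
      continuous_invFun := by
        refine Continuous.subtype_mk ?_ _
        refine continuous_iff_continuousAt.2 fun ⟨b, k⟩ => ?_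
        have h1 : ContinuousAt (s (idx k)) b := sheetTopology.continuousAt _ ((hk k).1 b.2)
        have h2 : ContinuousAt (fun x : W × I => s (idx k) x.1) (b, k) :=
          ContinuousAt.comp (x := (b, k)) (f := fun x : W × I => (x.1 : B)) h1 (by fun_prop)
        refine h2.congr ?_
        have h3 : ∀ᶠ x : W × I in 𝓝 (b, k), x.2 = k :=
          continuousAt_snd.eventually_mem (x := (b, k)) (s := {k}) (by simp)
        filter_upwards [h3] with x hx
        rw [hx] }
  exact IsEvenlyCovered.to_isEvenlyCovered_preimage (I := I)
    ⟨inferInstance, W, hb₀, hW, hW.preimage hqc, H, fun e => rfl⟩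

end Sheets

end

/-! ### Frame atlases and leafwise maps -/

section

/-- Local parametrizations of the fibres of a circle bundle by the circle, which differ by
isometries of the circle. -/
structure FrameAtlas {S : Type u} {M : Type v} [TopologicalSpace S] [TopologicalSpace M]
    (p : M → S) where
  /-- the index type of the local parametrizations -/
  ι : Type u
  /-- the domains of the local parametrizations -/
  U : ι → Set S
  /-- the local parametrizations -/
  Fr : ι → S → UnitAddCircle → M
  continuous_proj : Continuous p
  isOpen_U : ∀ i, IsOpen (U i)
  exists_mem_U : ∀ b, ∃ i, b ∈ U i
  proj : ∀ i, ∀ b ∈ U i, ∀ r, p (Fr i b r) = b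
  injective : ∀ i, ∀ b ∈ U i, Function.Injective (Fr i b)
  exists_eq : ∀ i, ∀ b ∈ U i, ∀ m, p m = b → ∃ r, Fr i b r = m
  continuousAt : ∀ i, ∀ b ∈ U i, ∀ r,
    ContinuousAt (fun q : S × UnitAddCircle => Fr i q.1 q.2) (b, r)
  trans : ∀ i j b, b ∈ U i → b ∈ U j → ∃ s, (∀ r, Fr j b r = Fr i b (s + r)) ∨
    ∀ r, Fr j b r = Fr i b (s - r)

/-- Flow boxes for a closed set in which the fibres of `p` are vertical. -/
structure HorizontalAtlas {S : Type u} {M : Type v} [TopologicalSpace S] [TopologicalSpace M]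
    (p : M → S) (Λ : Set M) where
  /-- the flow boxes -/
  boxes : Set (OpenPartialHomeomorph M (S × ℝ))
  isClosed : IsClosed Λ
  exists_mem_source : ∀ x ∈ Λ, ∃ ψ ∈ boxes, x ∈ ψ.source
  isFlowBox : ∀ ψ ∈ boxes, IsFlowBox Λ ψ
  agree : ∀ ψ ∈ boxes, ∀ ψ' ∈ boxes, PlaquesAgree Λ ψ ψ'
  fst_eq : ∀ ψ ∈ boxes, ∀ y ∈ ψ.source, (ψ y).1 = p y

variable {S : Type u} {M : Type v} [TopologicalSpace S] [TopologicalSpace M] {p : M → S}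

namespace FrameAtlas

variable (𝔄 : FrameAtlas p)

/-- An isometric parametrization of a fibre. -/
def IsFrame (f : UnitAddCircle → M) : Prop :=
  ∃ i b s, b ∈ 𝔄.U i ∧ ((∀ r, f r = 𝔄.Fr i b (s + r)) ∨ ∀ r, f r = 𝔄.Fr i b (s - r))

/-- Over a compact set inside a chart the total space is the image of that set times the circle;
finitely many such pieces cover. -/
theorem compactSpace {p : M → S} (𝔄 : FrameAtlas p) [CompactSpace S] [T2Space S] : CompactSpace M := by
  have hloc : ∀ b : S, ∃ K ∈ 𝓝 b, IsCompact (p ⁻¹' K) := by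
    intro b
    obtain ⟨i, hi⟩ := 𝔄.exists_mem_U b
    obtain ⟨K, hK, hKU, hKc⟩ := local_compact_nhds ((𝔄.isOpen_U i).mem_nhds hi)
    refine ⟨K, hK, ?_⟩
    have : p ⁻¹' K = (fun q : S × UnitAddCircle => 𝔄.Fr i q.1 q.2) '' (K ×ˢ univ) := by
      ext m
      constructor
      · intro hm
        obtain ⟨r, hr⟩ := 𝔄.exists_eq i (p m) (hKU hm) m rfl
        exact ⟨(p m, r), ⟨hm, trivial⟩, hr⟩
      · rintro ⟨⟨b, r⟩, ⟨hb, -⟩, rfl⟩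
        show p _ ∈ K
        rw [𝔄.proj i b (hKU hb)]; exact hb
    rw [this]
    exact (hKc.prod isCompact_univ).image_of_continuousOn fun q hq =>
      (𝔄.continuousAt i q.1 (hKU hq.1) q.2).continuousWithinAt
  choose K hK hKc using hloc
  obtain ⟨t, ht⟩ := CompactSpace.elim_nhds_subcover K hK
  refine ⟨?_⟩
  have : (univ : Set M) = ⋃ b ∈ t, p ⁻¹' K b := by
    rw [← preimage_iUnion₂, ht]; simp
  rw [this]
  exact t.isCompact_biUnion fun b _ => hKc b

open Classical in
/-- The angular coordinate of a local parametrization. -/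
noncomputable def ang (i : 𝔄.ι) (m : M) : UnitAddCircle :=
  if h : p m ∈ 𝔄.U i then (𝔄.exists_eq i (p m) h m rfl).choose else 0

theorem Fr_ang {i : 𝔄.ι} {m : M} (h : p m ∈ 𝔄.U i) : 𝔄.Fr i (p m) (𝔄.ang i m) = m := by
  rw [ang, dif_pos h]
  exact (𝔄.exists_eq i (p m) h m rfl).choose_spec

theorem ang_Fr {i : 𝔄.ι} {b : S} (h : b ∈ 𝔄.U i) (r : UnitAddCircle) :
    𝔄.ang i (𝔄.Fr i b r) = r := by
  have h1 := 𝔄.proj i b h r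
  apply 𝔄.injective i b h
  have := 𝔄.Fr_ang (i := i) (m := 𝔄.Fr i b r) (by rw [h1]; exact h)
  rwa [h1] at this

/-- The parametrization of the bundle over a compact neighbourhood is a closed map, since its source
is compact and the bundle is Hausdorff; so its inverse is continuous. -/
theorem continuousAt_ang [CompactSpace S] [T2Space S] [T2Space M] {i : 𝔄.ι} {m : M}
    (h : p m ∈ 𝔄.U i) : ContinuousAt (𝔄.ang i) m := by
  obtain ⟨K, hK, hKU, hKc⟩ := local_compact_nhds ((𝔄.isOpen_U i).mem_nhds h)
  have hn : p ⁻¹' K ∈ 𝓝 m := 𝔄.continuous_proj.continuousAt hK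
  refine ContinuousOn.continuousAt (s := p ⁻¹' K) ?_ hn
  rw [continuousOn_iff_isClosed]
  intro C hC
  refine ⟨(fun q : S × UnitAddCircle => 𝔄.Fr i q.1 q.2) '' (K ×ˢ C), ?_, ?_⟩
  · exact ((hKc.prod hC.isCompact).image_of_continuousOn fun q hq =>
      (𝔄.continuousAt i q.1 (hKU hq.1) q.2).continuousWithinAt).isClosed
  · ext x
    constructor
    · rintro ⟨h1, h2⟩
      exact ⟨⟨(p x, 𝔄.ang i x), ⟨h2, h1⟩, 𝔄.Fr_ang (hKU h2)⟩, h2⟩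
    · rintro ⟨⟨⟨b, r⟩, ⟨hb, hr⟩, rfl⟩, h2⟩
      refine ⟨?_, h2⟩
      show 𝔄.ang i _ ∈ C
      rw [𝔄.ang_Fr (hKU hb)]
      exact hr

variable {𝔄}

namespace IsFrame

variable {f f' : UnitAddCircle → M}

theorem proj_eq (hf : 𝔄.IsFrame f) (r : UnitAddCircle) : p (f r) = p (f 0) := by
  obtain ⟨i, b, s, hb, h | h⟩ := hf <;> rw [h, h, 𝔄.proj i b hb, 𝔄.proj i b hb]

theorem injective (hf : 𝔄.IsFrame f) : Function.Injective f := by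
  obtain ⟨i, b, s, hb, h | h⟩ := hf <;> intro r r' hr <;> rw [h, h] at hr
  · exact add_left_cancel (𝔄.injective i b hb hr)
  · exact sub_right_injective (𝔄.injective i b hb hr)

theorem exists_eq (hf : 𝔄.IsFrame f) {m : M} (hm : p m = p (f 0)) : ∃ r, f r = m := by
  obtain ⟨i, b, s, hb, h⟩ := hf
  have h0 : p (f 0) = b := by
    rcases h with h | h <;> rw [h, 𝔄.proj i b hb]
  obtain ⟨r, hr⟩ := 𝔄.exists_eq i b hb m (hm.trans h0)
  rcases h with h | h
  · exact ⟨r - s, by rw [h, ← hr]; congr 1; abel⟩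
  · exact ⟨s - r, by rw [h, ← hr]; congr 1; abel⟩

theorem shift (hf : 𝔄.IsFrame f) (s : UnitAddCircle) : 𝔄.IsFrame fun r => f (s + r) := by
  obtain ⟨i, b, s', hb, h | h⟩ := hf
  · exact ⟨i, b, s' + s, hb, Or.inl fun r => (h _).trans (by congr 1; abel)⟩
  · exact ⟨i, b, s' - s, hb, Or.inr fun r => (h _).trans (by congr 1; abel)⟩

theorem rev (hf : 𝔄.IsFrame f) : 𝔄.IsFrame fun r => f (-r) := by
  obtain ⟨i, b, s', hb, h | h⟩ := hf
  · exact ⟨i, b, s', hb, Or.inr fun r => (h _).trans (by congr 1; abel)⟩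
  · exact ⟨i, b, s', hb, Or.inl fun r => (h _).trans (by congr 1; abel)⟩

/-- Composing the two isometries leaves a rotation or a reflection, and its constant can only be the
angle of the starting point. -/
theorem eq_Fr (hf : 𝔄.IsFrame f) {i : 𝔄.ι} (hi : p (f 0) ∈ 𝔄.U i) :
    (∀ r, f r = 𝔄.Fr i (p (f 0)) (𝔄.ang i (f 0) + r)) ∨
      ∀ r, f r = 𝔄.Fr i (p (f 0)) (𝔄.ang i (f 0) - r) := by
  have hang := 𝔄.Fr_ang hi
  obtain ⟨j, b, s, hb, h⟩ := hf
  have h0 : p (f 0) = b := by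
    rcases h with h | h <;> rw [h, 𝔄.proj j b hb]
  rw [h0] at hi hang ⊢
  obtain ⟨t, ht⟩ := 𝔄.trans i j b hi hb
  rcases h with h | h <;> rcases ht with ht | ht
  · left
    intro r
    have h1 : 𝔄.Fr i b (𝔄.ang i (f 0)) = 𝔄.Fr i b (t + s) := by rw [hang, h, ht, add_zero]
    rw [𝔄.injective i b hi h1, h, ht]; congr 1; abel
  · right
    intro r
    have h1 : 𝔄.Fr i b (𝔄.ang i (f 0)) = 𝔄.Fr i b (t - s) := by rw [hang, h, ht, add_zero]
    rw [𝔄.injective i b hi h1, h, ht]; congr 1; abel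
  · right
    intro r
    have h1 : 𝔄.Fr i b (𝔄.ang i (f 0)) = 𝔄.Fr i b (t + s) := by rw [hang, h, ht, sub_zero]
    rw [𝔄.injective i b hi h1, h, ht]; congr 1; abel
  · left
    intro r
    have h1 : 𝔄.Fr i b (𝔄.ang i (f 0)) = 𝔄.Fr i b (t - s) := by rw [hang, h, ht, sub_zero]
    rw [𝔄.injective i b hi h1, h, ht]; congr 1; abel

theorem eq_or_eq (hf : 𝔄.IsFrame f) (hf' : 𝔄.IsFrame f') (h : p (f' 0) = p (f 0)) :
    ∃ s, f s = f' 0 ∧ ((∀ r, f' r = f (s + r)) ∨ ∀ r, f' r = f (s - r)) := by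
  obtain ⟨s, hs⟩ := hf.exists_eq h
  refine ⟨s, hs, ?_⟩
  obtain ⟨i, hi⟩ := 𝔄.exists_mem_U (p (f 0))
  have hi' : p (f' 0) ∈ 𝔄.U i := by rwa [h]
  have e1 := hf.eq_Fr hi
  have e2 := hf'.eq_Fr hi'
  rw [h] at e2
  have key : ∀ a, f' 0 = 𝔄.Fr i (p (f 0)) a → 𝔄.ang i (f' 0) = a := by
    intro a ha
    rw [ha, 𝔄.ang_Fr hi]
  rcases e1 with e1 | e1 <;> rcases e2 with e2 | e2 <;> rw [e1] at hs
  · left; intro r; rw [e2, e1 (s + r), key _ hs.symm, add_assoc]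
  · right; intro r; rw [e2, e1 (s - r), key _ hs.symm]; congr 1; abel
  · right; intro r; rw [e2, e1 (s - r), key _ hs.symm]; congr 1; abel
  · left; intro r; rw [e2, e1 (s + r), key _ hs.symm]; congr 1; abel

theorem continuous (hf : 𝔄.IsFrame f) : Continuous f := by
  obtain ⟨i, b, s, hb, h⟩ := hf
  have hc : Continuous (𝔄.Fr i b) := continuous_iff_continuousAt.2 fun r =>
    ContinuousAt.comp (x := r) (g := fun q : S × UnitAddCircle => 𝔄.Fr i q.1 q.2)
      (f := fun r => (b, r)) (𝔄.continuousAt i b hb r) (by fun_prop)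
  rcases h with h | h
  · rw [funext h]; fun_prop
  · rw [funext h]; fun_prop

end IsFrame

end FrameAtlas

namespace HorizontalAtlas

variable {Λ : Set M} (ℋ : HorizontalAtlas p Λ) {A : Type*} [TopologicalSpace A]

/-- A map into the lamination which stays locally in a plaque. -/
def LeafwiseAt (m : A → M) (a : A) : Prop :=
  ContinuousAt m a ∧ (∀ᶠ a' in 𝓝 a, m a' ∈ Λ) ∧
    ∀ ψ ∈ ℋ.boxes, m a ∈ ψ.source → ∀ᶠ a' in 𝓝 a, (ψ (m a')).2 = (ψ (m a)).2

variable {ℋ} {m m' : A → M} {a : A}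

theorem LeafwiseAt.continuousAt (h : ℋ.LeafwiseAt m a) : ContinuousAt m a := h.1

theorem LeafwiseAt.mem (h : ℋ.LeafwiseAt m a) : m a ∈ Λ := h.2.1.self_of_nhds

/-- One box suffices, because plaques of any two boxes agree locally along the lamination. -/
theorem leafwiseAt_of_box {ψ : OpenPartialHomeomorph M (S × ℝ)} (hψ : ψ ∈ ℋ.boxes)
    (hm : ContinuousAt m a) (hΛ : ∀ᶠ a' in 𝓝 a, m a' ∈ Λ) (ha : m a ∈ ψ.source)
    (h : ∀ᶠ a' in 𝓝 a, (ψ (m a')).2 = (ψ (m a)).2) : ℋ.LeafwiseAt m a := by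
  refine ⟨hm, hΛ, fun ψ' hψ' ha' => ?_⟩
  have h1 := ℋ.agree ψ hψ ψ' hψ' (m a) hΛ.self_of_nhds ha ha'
  have h2 : Filter.Tendsto m (𝓝 a) (𝓝[Λ] (m a)) :=
    tendsto_nhdsWithin_iff.2 ⟨hm, hΛ⟩
  filter_upwards [h, h2.eventually h1] with a' h3 h4
  exact h4.1 h3

theorem LeafwiseAt.congr (h : ℋ.LeafwiseAt m a) (he : m =ᶠ[𝓝 a] m') : ℋ.LeafwiseAt m' a := by
  have h0 : m a = m' a := he.self_of_nhds
  refine ⟨h.1.congr he, ?_, fun ψ hψ ha => ?_⟩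
  · filter_upwards [h.2.1, he] with a' h1 h2
    rwa [← h2]
  · rw [← h0] at ha ⊢
    filter_upwards [h.2.2 ψ hψ ha, he] with a' h1 h2
    rwa [← h2]

theorem LeafwiseAt.comp {A' : Type*} [TopologicalSpace A'] {g : A' → A} {a' : A'}
    (h : ℋ.LeafwiseAt m (g a')) (hg : ContinuousAt g a') : ℋ.LeafwiseAt (fun x => m (g x)) a' :=
  ⟨ContinuousAt.comp (f := g) h.1 hg, hg.eventually h.2.1, fun ψ hψ ha =>
    hg.eventually (h.2.2 ψ hψ ha)⟩

/-- Uniqueness of leafwise lifts: inside a horizontal box a point is determined by its plaque and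
its projection. -/
theorem LeafwiseAt.eventuallyEq (h : ℋ.LeafwiseAt m a) (h' : ℋ.LeafwiseAt m' a)
    (ha : m a = m' a) (hp : ∀ᶠ a' in 𝓝 a, p (m a') = p (m' a')) : m =ᶠ[𝓝 a] m' := by
  obtain ⟨ψ, hψ, hs⟩ := ℋ.exists_mem_source _ h.mem
  have hs' : m' a ∈ ψ.source := ha ▸ hs
  have e1 := h.1.eventually_mem (ψ.open_source.mem_nhds hs)
  have e2 := h'.1.eventually_mem (ψ.open_source.mem_nhds hs')
  filter_upwards [h.2.2 ψ hψ hs, h'.2.2 ψ hψ hs', e1, e2, hp] with x h1 h2 h3 h4 h5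
  refine ψ.injOn h3 h4 (Prod.ext ?_ ?_)
  · rw [ℋ.fst_eq ψ hψ _ h3, ℋ.fst_eq ψ hψ _ h4, h5]
  · rw [h1, h2, ha]

variable (ℋ)

/-- Plaques over a common connected base through all points over it. -/
theorem exists_plaques [CompactSpace M] [T2Space M] [LocallyConnectedSpace S] [T2Space S]
    (hp : Continuous p) (b₀ : S) {N : Set S} (hN : N ∈ 𝓝 b₀) :
    ∃ W, IsOpen W ∧ b₀ ∈ W ∧ W ⊆ N ∧ IsPreconnected W ∧ ∀ y ∈ Λ, p y ∈ W →
      ∃ l : S → M, l (p y) = y ∧ ∀ b ∈ W, p (l b) = b ∧ ℋ.LeafwiseAt l b := by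
  have hK : IsCompact (Λ ∩ p ⁻¹' {b₀}) :=
    (ℋ.isClosed.inter (isClosed_singleton.preimage hp)).isCompact
  obtain ⟨t, htb, htf, ht⟩ := hK.elim_finite_subcover_image (b := ℋ.boxes ∩
      {ψ | ∃ x, x ∈ Λ ∧ p x = b₀ ∧ x ∈ ψ.source})
    (c := fun ψ : OpenPartialHomeomorph M (S × ℝ) => ψ.source)
    (fun ψ _ => ψ.open_source) (fun x hx => by
      obtain ⟨ψ, hψ, hxψ⟩ := ℋ.exists_mem_source x hx.1
      exact mem_biUnion (⟨hψ, x, hx.1, hx.2, hxψ⟩ :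
        ψ ∈ ℋ.boxes ∩ {ψ | ∃ x, x ∈ Λ ∧ p x = b₀ ∧ x ∈ ψ.source}) hxψ)
  have hbase : ∀ ψ ∈ ℋ.boxes, ∃ U : Set S, ∃ T : Set ℝ, IsOpen U ∧ (∀ x ∈ ψ.source, p x ∈ U) ∧
      ψ.target = U ×ˢ (univ : Set ℝ) ∧ ψ '' (Λ ∩ ψ.source) = U ×ˢ T := by
    intro ψ hψ
    obtain ⟨U, T, hU, hT, hΛ⟩ := ℋ.isFlowBox ψ hψ
    refine ⟨U, T, ?_, fun x hx => ?_, hT, hΛ⟩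
    · have h1 : U = (fun b => (b, (0 : ℝ))) ⁻¹' ψ.target := by ext b; simp [hT]
      rw [h1]
      exact ψ.open_target.preimage (by fun_prop)
    · rw [← ℋ.fst_eq ψ hψ x hx]
      have := ψ.map_source hx
      rw [hT] at this
      exact this.1
  choose! U T hUo hU hT hΛ using hbase
  -- The part of the lamination missed by the finitely many boxes is compact, so its projection is
  -- closed and avoids `b₀`. Over a small neighbourhood the boxes therefore catch every point of the
  -- lamination.
  have hclosed : IsClosed (p '' (Λ \ ⋃ ψ ∈ t, ψ.source)) := by
    have h1 : IsClosed (Λ \ ⋃ ψ ∈ t, ψ.source) :=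
      ℋ.isClosed.sdiff (isOpen_biUnion fun ψ _ => ψ.open_source)
    exact (h1.isCompact.image hp).isClosed
  have hb₀ : b₀ ∉ p '' (Λ \ ⋃ ψ ∈ t, ψ.source) := by
    rintro ⟨x, ⟨hx, hx'⟩, hxb⟩
    exact hx' (ht ⟨hx, hxb⟩)
  have hnb : N ∩ (p '' (Λ \ ⋃ ψ ∈ t, ψ.source))ᶜ ∩ ⋂ ψ ∈ t, U ψ ∈ 𝓝 b₀ := by
    refine Filter.inter_mem (Filter.inter_mem hN (hclosed.isOpen_compl.mem_nhds hb₀)) ?_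
    refine (Filter.biInter_mem htf).2 fun ψ hψ => ?_
    obtain ⟨h1, x, -, h3, h4⟩ := htb hψ
    exact (hUo ψ h1).mem_nhds (h3 ▸ hU ψ h1 x h4)
  obtain ⟨W, hW, hWo, hbW, hWc⟩ := locallyConnectedSpace_iff_subsets_isOpen_isConnected.1
    inferInstance b₀ _ hnb
  refine ⟨W, hWo, hbW, fun b hb => (hW hb).1.1, hWc.isPreconnected, fun y hy hyW => ?_⟩
  obtain ⟨ψ, hψt, hyψ⟩ : ∃ ψ ∈ t, y ∈ ψ.source := by
    by_contra! h
    exact (hW hyW).1.2 ⟨y, ⟨hy, by simpa using h⟩, rfl⟩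
  have hψ : ψ ∈ ℋ.boxes := (htb hψt).1
  have hWU : W ⊆ U ψ := fun b hb => by
    have := (hW hb).2
    simp only [mem_iInter] at this
    exact this ψ hψt
  have htar : ∀ b ∈ W, (b, (ψ y).2) ∈ ψ.target := fun b hb => by
    rw [hT ψ hψ]; exact ⟨hWU hb, trivial⟩
  have hTy : (ψ y).2 ∈ T ψ := by
    have : ψ y ∈ U ψ ×ˢ T ψ := by rw [← hΛ ψ hψ]; exact mem_image_of_mem _ ⟨hy, hyψ⟩
    exact this.2
  have hmem : ∀ b ∈ W, ψ.symm (b, (ψ y).2) ∈ Λ := by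
    intro b hb
    have : (b, (ψ y).2) ∈ ψ '' (Λ ∩ ψ.source) := by rw [hΛ ψ hψ]; exact ⟨hWU hb, hTy⟩
    obtain ⟨z, ⟨hz, hzs⟩, hzb⟩ := this
    rw [← hzb, ψ.left_inv hzs]; exact hz
  have hsrc : ∀ b ∈ W, ψ.symm (b, (ψ y).2) ∈ ψ.source := fun b hb => ψ.map_target (htar b hb)
  -- The section keeps the height of `y` in a box that contains it.
  refine ⟨fun b => ψ.symm (b, (ψ y).2), ?_, fun b hb => ⟨?_, ?_⟩⟩
  · have : (p y, (ψ y).2) = ψ y := Prod.ext (ℋ.fst_eq ψ hψ y hyψ).symm rfl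
    show ψ.symm (p y, (ψ y).2) = y
    rw [this, ψ.left_inv hyψ]
  · rw [← ℋ.fst_eq ψ hψ _ (hsrc b hb), ψ.right_inv (htar b hb)]
  · refine leafwiseAt_of_box hψ ?_ ?_ (hsrc b hb) ?_
    · exact ContinuousAt.comp (x := b) (f := fun b => (b, (ψ y).2)) (g := ψ.symm)
        (ψ.continuousAt_symm (htar b hb)) (by fun_prop)
    · filter_upwards [hWo.mem_nhds hb] with b' hb' using hmem b' hb'
    · filter_upwards [hWo.mem_nhds hb] with b' hb'
      rw [ψ.right_inv (htar b' hb'), ψ.right_inv (htar b hb)]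

end HorizontalAtlas

end

/-! ### The covering space of framed points -/

section

variable {S : Type u} {M : Type v} [TopologicalSpace S] [TopologicalSpace M] {p : M → S}
  {Λ : Set M}

/-- Isometric parametrizations of fibres that start at a point of the lamination. -/
@[ext]
structure Framed (𝔄 : FrameAtlas p) (ℋ : HorizontalAtlas p Λ) : Type v where
  /-- the parametrization -/
  toFun : UnitAddCircle → M
  isFrame : 𝔄.IsFrame toFun
  mem : toFun 0 ∈ Λ

namespace Framed

variable {𝔄 : FrameAtlas p} {ℋ : HorizontalAtlas p Λ}

instance : CoeFun (Framed 𝔄 ℋ) fun _ => UnitAddCircle → M := ⟨fun f => f.toFun⟩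

theorem ext_apply {f g : Framed 𝔄 ℋ} (h : ∀ r, f r = g r) : f = g := Framed.ext (funext h)

/-- The base point of the fibre. -/
def proj (f : Framed 𝔄 ℋ) : S := p (f 0)

theorem proj_apply (f : Framed 𝔄 ℋ) (r : UnitAddCircle) : p (f r) = f.proj := f.isFrame.proj_eq r

/-- `g` is obtained from `f` by moving the starting point by `s`. -/
def IsShift (f g : Framed 𝔄 ℋ) (s : UnitAddCircle) : Prop := ∀ r, g r = f (s + r)

/-- Moving the starting point. -/
def shift (f : Framed 𝔄 ℋ) (s : UnitAddCircle) (h : f s ∈ Λ) : Framed 𝔄 ℋ :=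
  ⟨fun r => f (s + r), f.isFrame.shift s, by simpa using h⟩

theorem isShift_shift (f : Framed 𝔄 ℋ) (s : UnitAddCircle) (h : f s ∈ Λ) :
    IsShift f (f.shift s h) s := fun _ => rfl

/-- Reversing the orientation of the fibre. -/
def rev (f : Framed 𝔄 ℋ) : Framed 𝔄 ℋ :=
  ⟨fun r => f (-r), f.isFrame.rev, by simpa using f.mem⟩

theorem rev_apply (f : Framed 𝔄 ℋ) (r : UnitAddCircle) : f.rev r = f (-r) := rfl

theorem IsShift.zero {f g : Framed 𝔄 ℋ} {s : UnitAddCircle} (h : IsShift f g s) : g 0 = f s := by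
  rw [h, add_zero]

theorem IsShift.eq {f g : Framed 𝔄 ℋ} (h : IsShift f g 0) : g = f :=
  ext_apply fun r => by rw [h, zero_add]

theorem IsShift.proj_eq {f g : Framed 𝔄 ℋ} {s : UnitAddCircle} (h : IsShift f g s) :
    g.proj = f.proj := by
  rw [proj, h.zero, proj_apply (p := p)]

theorem isShift_refl (f : Framed 𝔄 ℋ) : IsShift f f 0 := fun r => by rw [zero_add]

theorem IsShift.trans {f g k : Framed 𝔄 ℋ} {s t : UnitAddCircle} (h : IsShift f g s)
    (h' : IsShift g k t) : IsShift f k (s + t) := fun r => by rw [h', h, add_assoc]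

theorem IsShift.symm {f g : Framed 𝔄 ℋ} {s : UnitAddCircle} (h : IsShift f g s) :
    IsShift g f (-s) := fun r => by rw [h, add_neg_cancel_left]

theorem IsShift.unique {f g g' : Framed 𝔄 ℋ} {s : UnitAddCircle} (h : IsShift f g s)
    (h' : IsShift f g' s) : g = g' := ext_apply fun r => by rw [h, h']

theorem isShift_or_rev (f g : Framed 𝔄 ℋ) (h : g.proj = f.proj) :
    (∃ s, IsShift f g s) ∨ ∃ s, IsShift f g.rev s := by
  obtain ⟨s, -, h | h⟩ := f.isFrame.eq_or_eq g.isFrame h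
  · exact Or.inl ⟨s, h⟩
  · exact Or.inr ⟨s, fun r => by rw [rev_apply, h, sub_neg_eq_add]⟩

section Topology

variable {A : Type*} [TopologicalSpace A]

/-- A family of framed points that depends continuously on the parameter, and whose starting
points stay locally in a plaque. -/
def GoodAt (F : A → Framed 𝔄 ℋ) (a : A) : Prop :=
  ℋ.LeafwiseAt (fun a => F a 0) a ∧
    ∀ r, ContinuousAt (fun q : A × UnitAddCircle => F q.1 q.2) (a, r)

theorem GoodAt.congr {F F' : A → Framed 𝔄 ℋ} {a : A} (h : GoodAt F a) (he : F =ᶠ[𝓝 a] F') :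
    GoodAt F' a := by
  refine ⟨h.1.congr ?_, fun r => (h.2 r).congr ?_⟩
  · filter_upwards [he] with x hx
    rw [hx]
  · have h1 : ∀ᶠ q : A × UnitAddCircle in 𝓝 (a, r), F q.1 = F' q.1 := Filter.Tendsto.eventually (f := Prod.fst) (continuousAt_fst (p := (a, r))) he
    filter_upwards [h1] with x hx
    rw [hx]

theorem GoodAt.comp {A' : Type*} [TopologicalSpace A'] {F : A → Framed 𝔄 ℋ} {g : A' → A} {a : A'}
    (h : GoodAt F (g a)) (hg : ContinuousAt g a) : GoodAt (fun x => F (g x)) a :=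
  ⟨h.1.comp hg, fun r => ContinuousAt.comp (x := (a, r))
    (f := fun q : A' × UnitAddCircle => (g q.1, q.2)) (g := fun q : A × UnitAddCircle => F q.1 q.2)
    (h.2 r) ((hg.comp continuousAt_fst).prodMk continuousAt_snd)⟩

/-- The starting points agree by leafwise uniqueness, which leaves only the identity or the
reflection between the frames; continuity excludes the reflection. -/
theorem GoodAt.eventuallyEq [T2Space M] {F F' : A → Framed 𝔄 ℋ} {a : A} (h : GoodAt F a)
    (h' : GoodAt F' a) (ha : F a = F' a) (hp : ∀ᶠ x in 𝓝 a, (F x).proj = (F' x).proj) :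
    F =ᶠ[𝓝 a] F' := by
  have h0 := h.1.eventuallyEq h'.1 (by rw [ha]) hp
  -- A reflection fixing the starting point exchanges the two quarter turns, which are distinct
  -- points of the fibre.
  have hne : F' a ((1 / 4 : ℝ) : UnitAddCircle) ≠ F a (-((1 / 4 : ℝ) : UnitAddCircle)) := by
    rw [ha]
    intro h
    have := (F' a).isFrame.injective h
    rw [← AddCircle.coe_neg, UnitAddCircle.coe_eq_coe_iff] at this
    obtain ⟨n, hn⟩ := this
    have h1 : (2 * n : ℝ) = 1 := by linarith
    have h2 : 2 * n = 1 := by exact_mod_cast h1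
    omega
  have c1 : ContinuousAt (fun x => F' x ((1 / 4 : ℝ) : UnitAddCircle)) a :=
    ContinuousAt.comp (x := a) (f := fun x => (x, ((1 / 4 : ℝ) : UnitAddCircle)))
      (g := fun q : A × UnitAddCircle => F' q.1 q.2) (h'.2 _) (by fun_prop)
  have c2 : ContinuousAt (fun x => F x (-((1 / 4 : ℝ) : UnitAddCircle))) a :=
    ContinuousAt.comp (x := a) (f := fun x => (x, -((1 / 4 : ℝ) : UnitAddCircle)))
      (g := fun q : A × UnitAddCircle => F q.1 q.2) (h.2 _) (by fun_prop)
  filter_upwards [h0, hp, (c1.prodMk c2).eventually (isClosed_diagonal.isOpen_compl.mem_nhds hne)] with x h1 h2 h3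
  obtain ⟨s, hs, h4⟩ := (F x).isFrame.eq_or_eq (F' x).isFrame h2.symm
  have hs0 : s = 0 := (F x).isFrame.injective (hs.trans h1.symm)
  subst hs0
  rcases h4 with h4 | h4
  · exact ext_apply fun r => by rw [h4, zero_add]
  · exact absurd (show F' x _ = F x _ by rw [h4, zero_sub]) h3

variable (𝔄 ℋ) in
/-- Local sections of the space of framed points. -/
def Sec : Type (max u v) :=
  {x : Set S × (S → Framed 𝔄 ℋ) // IsOpen x.1 ∧ ∀ b ∈ x.1, (x.2 b).proj = b ∧ GoodAt x.2 b}

/-- A leaf topology: moving the starting point within its fibre is not continuous here, even where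
the lamination is not discrete. This is what makes the projection to the surface a covering. -/
instance : TopologicalSpace (Framed 𝔄 ℋ) :=
  sheetTopology (fun i : Sec 𝔄 ℋ => i.1.1) (fun i => i.2.1) (fun i => i.1.2)

theorem isOpen_agree [T2Space M] (i j : Sec 𝔄 ℋ) :
    IsOpen {b | b ∈ i.1.1 ∧ b ∈ j.1.1 ∧ i.1.2 b = j.1.2 b} := by
  rw [isOpen_iff_mem_nhds]
  rintro b ⟨hi, hj, hb⟩
  have h1 := (i.2.2 b hi).2.eventuallyEq (j.2.2 b hj).2 hb (by
    filter_upwards [i.2.1.mem_nhds hi, j.2.1.mem_nhds hj] with x h1 h2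
    rw [(i.2.2 x h1).1, (j.2.2 x h2).1])
  filter_upwards [i.2.1.mem_nhds hi, j.2.1.mem_nhds hj, h1] with x h1 h2 h3 using ⟨h1, h2, h3⟩

/-- Agreement of sections is open by local uniqueness and disagreement is open because the bundle is
Hausdorff. -/
theorem sec_eq_of_preconnected [T2Space M] (i j : Sec 𝔄 ℋ) {W : Set S} (hW : IsPreconnected W)
    (hi : W ⊆ i.1.1) (hj : W ⊆ j.1.1) (h : ∃ b ∈ W, i.1.2 b = j.1.2 b) :
    ∀ b ∈ W, i.1.2 b = j.1.2 b := by
  by_contra! hcon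
  obtain ⟨b, hb, hne⟩ := hcon
  obtain ⟨c, hc, heq⟩ := h
  have hv : IsOpen {b | b ∈ i.1.1 ∧ b ∈ j.1.1 ∧ i.1.2 b ≠ j.1.2 b} := by
    rw [isOpen_iff_mem_nhds]
    rintro b ⟨hbi, hbj, hb⟩
    obtain ⟨r, hr⟩ : ∃ r, i.1.2 b r ≠ j.1.2 b r := by
      by_contra! h
      exact hb (ext_apply h)
    have c : ∀ k : Sec 𝔄 ℋ, b ∈ k.1.1 → ContinuousAt (fun x => k.1.2 x r) b := fun k hk =>
      ContinuousAt.comp (x := b) (f := fun x => (x, r))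
        (g := fun q : S × UnitAddCircle => k.1.2 q.1 q.2) ((k.2.2 b hk).2.2 _) (by fun_prop)
    filter_upwards [i.2.1.mem_nhds hbi, j.2.1.mem_nhds hbj,
      ((c i hbi).prodMk (c j hbj)).eventually (isClosed_diagonal.isOpen_compl.mem_nhds hr)] with x h1 h2 h3
    exact ⟨h1, h2, fun h => h3 (show i.1.2 x r = j.1.2 x r by rw [h])⟩
  obtain ⟨x, -, h1, h2⟩ := hW _ _ (isOpen_agree i j) hv (fun x hx => by
    by_cases h : i.1.2 x = j.1.2 x
    · exact Or.inl ⟨hi hx, hj hx, h⟩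
    · exact Or.inr ⟨hi hx, hj hx, h⟩) ⟨c, hc, hi hc, hj hc, heq⟩ ⟨b, hb, hi hb, hj hb, hne⟩
  exact h2.2.2 h1.2.2

variable [CompactSpace S] [T2Space S] [T2Space M] [LocallyConnectedSpace S]

/-- Over a base small enough for both plaques and a frame chart, a framed point extends by following
the plaque of its starting point and keeping its orientation in the chart. -/
theorem exists_sections (b₀ : S) : ∃ W, IsOpen W ∧ b₀ ∈ W ∧ IsPreconnected W ∧
    ∀ f : Framed 𝔄 ℋ, f.proj ∈ W → ∃ i : Sec 𝔄 ℋ, W ⊆ i.1.1 ∧ i.1.2 f.proj = f := by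
  have := 𝔄.compactSpace
  obtain ⟨k, hk⟩ := 𝔄.exists_mem_U b₀
  obtain ⟨W, hWo, hbW, hWk, hWc, hpl⟩ :=
    ℋ.exists_plaques 𝔄.continuous_proj b₀ ((𝔄.isOpen_U k).mem_nhds hk)
  refine ⟨W, hWo, hbW, hWc, fun f hf => ?_⟩
  obtain ⟨l, hl, hl'⟩ := hpl (f 0) f.mem hf
  have hlc : ∀ b ∈ W, ContinuousAt (fun x => 𝔄.ang k (l x)) b := fun b hb =>
    ContinuousAt.comp (g := 𝔄.ang k) (f := l)
      (𝔄.continuousAt_ang (by rw [(hl' b hb).1]; exact hWk hb)) (hl' b hb).2.1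
  have hFl : ∀ b ∈ W, 𝔄.Fr k b (𝔄.ang k (l b)) = l b := fun b hb => by
    have := 𝔄.Fr_ang (i := k) (m := l b) (by rw [(hl' b hb).1]; exact hWk hb)
    rwa [(hl' b hb).1] at this
  -- Here `σ` is the identity or the negation, according to the orientation of the frame in the
  -- chart.
  have hmain : ∀ σ : UnitAddCircle → UnitAddCircle, Continuous σ → σ 0 = 0 →
      (∀ b ∈ 𝔄.U k, ∀ s, 𝔄.IsFrame fun r => 𝔄.Fr k b (s + σ r)) →
      (∀ r, f r = 𝔄.Fr k f.proj (𝔄.ang k (f 0) + σ r)) →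
      ∃ i : Sec 𝔄 ℋ, W ⊆ i.1.1 ∧ i.1.2 f.proj = f := by
    intro σ hσ hσ0 hfr hf'
    classical
    let F : S → Framed 𝔄 ℋ := fun b => if hb : b ∈ W then
      ⟨fun r => 𝔄.Fr k b (𝔄.ang k (l b) + σ r), hfr b (hWk hb) _, by
        show 𝔄.Fr k b (𝔄.ang k (l b) + σ 0) ∈ Λ
        rw [hσ0, add_zero, hFl b hb]; exact (hl' b hb).2.mem⟩ else f
    have hF : ∀ b ∈ W, ∀ r, F b r = 𝔄.Fr k b (𝔄.ang k (l b) + σ r) := fun b hb r => by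
      simp only [F]; rw [dif_pos hb]
    have hF0 : ∀ b ∈ W, F b 0 = l b := fun b hb => by
      rw [hF b hb, hσ0, add_zero, hFl b hb]
    refine ⟨⟨(W, F), hWo, fun b hb => ⟨?_, ?_, fun r => ?_⟩⟩, Subset.rfl, ?_⟩
    · show p (F b 0) = b
      rw [hF0 b hb, (hl' b hb).1]
    · refine (hl' b hb).2.congr ?_
      filter_upwards [hWo.mem_nhds hb] with x hx
      rw [hF0 x hx]
    · have h1 : ContinuousAt (fun q : S × UnitAddCircle => (q.1, 𝔄.ang k (l q.1) + σ q.2)) (b, r) :=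
        continuousAt_fst.prodMk (ContinuousAt.add (ContinuousAt.comp (x := (b, r))
          (f := Prod.fst) (g := fun x => 𝔄.ang k (l x)) (hlc b hb) continuousAt_fst)
          (hσ.comp continuous_snd).continuousAt)
      have h2 := ContinuousAt.comp (x := (b, r)) (g := fun q : S × UnitAddCircle => 𝔄.Fr k q.1 q.2)
        (𝔄.continuousAt k b (hWk hb) _) h1
      refine h2.congr ?_
      have h3 : ∀ᶠ q : S × UnitAddCircle in 𝓝 (b, r), q.1 ∈ W :=
        continuousAt_fst.eventually_mem (hWo.mem_nhds hb)
      filter_upwards [h3] with q hq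
      exact (hF q.1 hq q.2).symm
    · refine ext_apply fun r => ?_
      show F f.proj r = f r
      rw [hF _ hf, hf', show l f.proj = f 0 from hl]
  rcases f.isFrame.eq_Fr (i := k) (hWk hf) with h | h
  · exact hmain id continuous_id rfl (fun b hb s => ⟨k, b, s, hb, Or.inl fun r => rfl⟩) h
  · exact hmain (fun r => -r) continuous_neg neg_zero
      (fun b hb s => ⟨k, b, s, hb, Or.inr fun r => by rw [sub_eq_add_neg]⟩)
      (fun r => by rw [h, sub_eq_add_neg]; rfl)

theorem isCoveringMap_proj : IsCoveringMap (proj : Framed 𝔄 ℋ → S) := by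
  refine sheetTopology.isCoveringMap (hV := fun i : Sec 𝔄 ℋ => i.2.1)
    (s := fun i : Sec 𝔄 ℋ => i.1.2) (V := fun i : Sec 𝔄 ℋ => i.1.1) (fun i b hb => (i.2.2 b hb).1) isOpen_agree fun b₀ => ?_
  obtain ⟨W, h1, h2, h3, h4⟩ := exists_sections (𝔄 := 𝔄) (ℋ := ℋ) b₀
  exact ⟨W, h1, h2, h4, fun i j hi hj => sec_eq_of_preconnected i j h3 hi hj⟩

theorem continuous_proj : Continuous (proj : Framed 𝔄 ℋ → S) := isCoveringMap_proj.continuous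

/-- Both conditions amount to saying that `F` factors locally through its projection and a single
sheet. One direction uses that sheets are open, the other local uniqueness. -/
theorem continuousAt_iff_goodAt {F : A → Framed 𝔄 ℋ} {a : A} : ContinuousAt F a ↔ GoodAt F a := by
  obtain ⟨W, hWo, hbW, -, hW⟩ := exists_sections (𝔄 := 𝔄) (ℋ := ℋ) (F a).proj
  obtain ⟨i, hi, hia⟩ := hW (F a) hbW
  have hib := hi hbW
  have key : ContinuousAt (fun x => (F x).proj) a → (∀ᶠ x in 𝓝 a, i.1.2 (F x).proj = F x) →
      ContinuousAt F a ∧ GoodAt F a := by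
    intro h1 h2
    refine ⟨?_, ?_⟩
    · have h3 : ContinuousAt i.1.2 (F a).proj :=
        sheetTopology.continuousAt (hV := fun i : Sec 𝔄 ℋ => i.2.1) (s := fun i : Sec 𝔄 ℋ => i.1.2)
          (V := fun i : Sec 𝔄 ℋ => i.1.1) i hib
      exact (ContinuousAt.comp (f := fun x => (F x).proj) h3 h1).congr h2
    · exact (GoodAt.comp (g := fun x => (F x).proj) (a := a) (i.2.2 _ hib).2 h1).congr h2
  constructor
  · intro h
    have h1 : ContinuousAt (fun x => (F x).proj) a := continuous_proj.continuousAt.comp h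
    refine (key h1 ?_).2
    have h2 : IsOpen (i.1.2 '' i.1.1) := sheetTopology.isOpen_image (hV := fun i : Sec 𝔄 ℋ => i.2.1)
      (s := fun i : Sec 𝔄 ℋ => i.1.2) (V := fun i : Sec 𝔄 ℋ => i.1.1) (q := proj)
      (fun i b hb => (i.2.2 b hb).1) isOpen_agree i i.2.1 Subset.rfl
    filter_upwards [h.eventually_mem (h2.mem_nhds ⟨_, hib, hia⟩)] with x hx
    obtain ⟨b, hb, hbx⟩ := hx
    rw [← hbx, (i.2.2 b hb).1]
  · intro h
    have h1 : ContinuousAt (fun x => (F x).proj) a :=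
      ContinuousAt.comp (f := fun x => F x 0) (x := a) 𝔄.continuous_proj.continuousAt h.1.1
    refine (key h1 ?_).1
    refine (GoodAt.comp (g := fun x => (F x).proj) (a := a) (i.2.2 _ hib).2 h1).eventuallyEq
      h hia ?_
    filter_upwards [h1.eventually_mem (i.2.1.mem_nhds hib)] with x hx
    exact (i.2.2 _ hx).1

theorem continuous_iff_goodAt {F : A → Framed 𝔄 ℋ} : Continuous F ↔ ∀ a, GoodAt F a :=
  continuous_iff_continuousAt.trans (forall_congr' fun _ => continuousAt_iff_goodAt)

theorem leafwiseAt {F : A → Framed 𝔄 ℋ} (hF : Continuous F) (a : A) :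
    ℋ.LeafwiseAt (fun a => F a 0) a := (continuous_iff_goodAt.1 hF a).1

theorem continuous_apply {F : A → Framed 𝔄 ℋ} (hF : Continuous F) {θ : A → UnitAddCircle}
    (hθ : Continuous θ) : Continuous fun a => F a (θ a) :=
  continuous_iff_continuousAt.2 fun a => ContinuousAt.comp (x := a)
    (f := fun a => (a, θ a)) (g := fun q : A × UnitAddCircle => F q.1 q.2)
    ((continuous_iff_goodAt.1 hF a).2 _) (by fun_prop)

/-- Turning a frame by a continuous angle is continuous in the leaf topology once the new starting
points also move along leaves. -/
theorem continuous_of_isShift {F G : A → Framed 𝔄 ℋ} (hF : Continuous F) {θ : A → UnitAddCircle}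
    (hθ : Continuous θ) (hG : ∀ a, IsShift (F a) (G a) (θ a))
    (hl : ∀ a, ℋ.LeafwiseAt (fun a => G a 0) a) : Continuous G := by
  refine continuous_iff_goodAt.2 fun a => ⟨hl a, fun r => ?_⟩
  have : (fun q : A × UnitAddCircle => G q.1 q.2) =
      fun q : A × UnitAddCircle => F q.1 (θ q.1 + q.2) := by
    ext q; exact hG q.1 q.2
  rw [this]
  exact (continuous_apply (hF.comp continuous_fst)
    ((hθ.comp continuous_fst).add continuous_snd)).continuousAt

theorem continuous_rev : Continuous (rev : Framed 𝔄 ℋ → Framed 𝔄 ℋ) := by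
  refine continuous_iff_goodAt.2 fun f => ⟨?_, fun r => ?_⟩
  · simpa only [rev_apply, neg_zero] using leafwiseAt (F := fun f : Framed 𝔄 ℋ => f) continuous_id f
  · exact (continuous_apply (F := fun q : Framed 𝔄 ℋ × UnitAddCircle => q.1) continuous_fst
      (θ := fun q => -q.2) (by fun_prop)).continuousAt

/-- The angle is unique because frames are injective, and its graph is closed; a function into a
compact space with closed graph is continuous. -/
theorem exists_angle {F : A → Framed 𝔄 ℋ} (hF : Continuous F) {m : A → M} (hm : Continuous m)
    (h : ∀ a, p (m a) = (F a).proj) :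
    ∃ θ : A → UnitAddCircle, Continuous θ ∧ ∀ a, F a (θ a) = m a := by
  choose θ hθ using fun a => (F a).isFrame.exists_eq (h a)
  refine ⟨θ, ?_, hθ⟩
  refine continuous_iff_continuousAt.2 fun a => ?_
  refine continuous_iff_continuousAt.1 ?_ a
  have hg : IsClosed {q : A × UnitAddCircle | F q.1 q.2 = m q.1} :=
    isClosed_eq (continuous_apply (hF.comp continuous_fst) continuous_snd)
      (hm.comp continuous_fst)
  refine continuous_iff_isClosed.2 fun C hC => ?_
  have : θ ⁻¹' C = Prod.fst '' ({q : A × UnitAddCircle | F q.1 q.2 = m q.1} ∩ (univ ×ˢ C)) := by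
    ext x
    constructor
    · intro hx
      exact ⟨(x, θ x), ⟨hθ x, trivial, hx⟩, rfl⟩
    · rintro ⟨⟨y, r⟩, ⟨h1, -, h2⟩, rfl⟩
      have : θ y = r := (F y).isFrame.injective ((hθ y).trans (Eq.symm h1))
      show θ y ∈ C
      rw [this]; exact h2
  rw [this]
  exact isClosedMap_fst_of_compactSpace _ (hg.inter (isClosed_univ.prod hC))

/-- Homotopies in the total space lift to the product of the space of framed points with the line. -/
theorem exists_lift {Q : unitInterval × A → M} (hQ : Continuous Q) {F₀ : A → Framed 𝔄 ℋ}
    (hF₀ : Continuous F₀) {a₀ : A → ℝ} (ha₀ : Continuous a₀)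
    (h : ∀ x, Q (0, x) = F₀ x (a₀ x)) :
    ∃ (F : unitInterval × A → Framed 𝔄 ℋ) (a : unitInterval × A → ℝ), Continuous F ∧
      Continuous a ∧ (∀ x, Q x = F x (a x)) ∧ (∀ x, F (0, x) = F₀ x) ∧ ∀ x, a (0, x) = a₀ x := by
  have cov := isCoveringMap_proj (𝔄 := 𝔄) (ℋ := ℋ)
  -- Two successive lifts: the projected homotopy lifts to the covering of framed points, and then
  -- the angle of the homotopy in the lifted frame lifts from the circle to the line.
  let H : C(unitInterval × A, S) := ⟨fun x => p (Q x), 𝔄.continuous_proj.comp hQ⟩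
  let f₀ : C(A, Framed 𝔄 ℋ) := ⟨F₀, hF₀⟩
  have h0 : ∀ x, H (0, x) = proj (f₀ x) := fun x => by
    show p (Q (0, x)) = _
    rw [h, proj_apply (p := p)]; rfl
  have hl := cov.liftHomotopy_lifts H f₀ h0
  have hz := cov.liftHomotopy_zero H f₀ h0
  set F := cov.liftHomotopy H f₀ h0
  obtain ⟨θ, hθ, hθ'⟩ := exists_angle F.continuous hQ (fun x => (congrFun hl x).symm)
  let H' : C(unitInterval × A, UnitAddCircle) := ⟨θ, hθ⟩
  let g₀ : C(A, ℝ) := ⟨a₀, ha₀⟩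
  have h0' : ∀ x, H' (0, x) = ((g₀ x : ℝ) : UnitAddCircle) := fun x => by
    apply (F (0, x)).isFrame.injective
    rw [show H' (0, x) = θ (0, x) from rfl, hθ', h, hz]; rfl
  have cov' := AddCircle.isCoveringMap_coe (1 : ℝ)
  have hl' := cov'.liftHomotopy_lifts H' g₀ h0'
  have hz' := cov'.liftHomotopy_zero H' g₀ h0'
  refine ⟨F, cov'.liftHomotopy H' g₀ h0', F.continuous, ContinuousMap.continuous _, fun x => ?_,
    hz, hz'⟩
  have := congrFun hl' x
  simp only [Function.comp] at this
  rw [this, ← hθ' x]; rfl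

variable [PreconnectedSpace A]

/-- The framed part is unique in the covering of the surface; the heights then lift the same angle
and differ by an integer. -/
theorem lift_unique {F F' : A → Framed 𝔄 ℋ} (hF : Continuous F) (hF' : Continuous F')
    {a a' : A → ℝ} (ha : Continuous a) (ha' : Continuous a')
    (h : ∀ x, F x (a x) = F' x (a' x)) (x₀ : A) (h0 : F x₀ = F' x₀) :
    F = F' ∧ ∃ n : ℤ, ∀ x, a x = a' x + n := by
  have h1 : F = F' := isCoveringMap_proj.eq_of_comp_eq hF hF' (funext fun x => by
    show (F x).proj = (F' x).proj
    rw [← proj_apply (F x) (a x), h, proj_apply (p := p)]) x₀ h0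
  refine ⟨h1, ?_⟩
  subst h1
  exact UnitAddCircle.exists_int_of_coe_eq ha ha' fun x => (F x).isFrame.injective (h x)

theorem lift_unique' {F F' : A → Framed 𝔄 ℋ} (hF : Continuous F) (hF' : Continuous F')
    {a a' : A → ℝ} (ha : Continuous a) (ha' : Continuous a')
    (h : ∀ x, F x (a x) = F' x (a' x)) (x₀ : A) (h0 : F x₀ = F' x₀) (h0' : a x₀ = a' x₀) :
    F = F' ∧ a = a' := by
  obtain ⟨h1, n, hn⟩ := lift_unique hF hF' ha ha' h x₀ h0
  refine ⟨h1, funext fun x => ?_⟩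
  have := hn x₀
  rw [hn x]; linarith

/-- Having the same orientation propagates over a connected parameter space: rotate `F` to the
starting point of `F'` and use uniqueness of lifts in the covering. -/
theorem exists_isShift {F F' : A → Framed 𝔄 ℋ} (hF : Continuous F) (hF' : Continuous F')
    (hp : ∀ x, (F x).proj = (F' x).proj) (x₀ : A) (h0 : ∃ s, IsShift (F x₀) (F' x₀) s) :
    ∃ θ : A → UnitAddCircle, Continuous θ ∧ ∀ x, IsShift (F x) (F' x) (θ x) := by
  obtain ⟨θ, hθ, hθ'⟩ := exists_angle hF (continuous_apply hF' continuous_const)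
    (m := fun x => F' x 0) (fun x => (hp x).symm)
  let G : A → Framed 𝔄 ℋ := fun x => (F x).shift (θ x) (by rw [hθ' x]; exact (F' x).mem)
  have hG0 : ∀ x, G x 0 = F' x 0 := fun x => by
    rw [← hθ' x]; exact (isShift_shift (F x) (θ x) _).zero
  have hG : Continuous G := continuous_of_isShift hF hθ (fun x => isShift_shift _ _ _) (by
    simp only [hG0]; exact leafwiseAt hF')
  have : G = F' := by
    refine isCoveringMap_proj.eq_of_comp_eq hG hF' (funext fun x => ?_) x₀ ?_
    · show p (G x 0) = p (F' x 0)
      rw [hG0]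
    · obtain ⟨s, hs⟩ := h0
      have h1 : θ x₀ = s := (F x₀).isFrame.injective ((hθ' x₀).trans hs.zero)
      refine IsShift.unique (f := F x₀) (s := s) ?_ hs
      rw [← h1]; exact isShift_shift _ _ _
  exact ⟨θ, hθ, fun x => this ▸ isShift_shift _ _ _⟩

theorem lift_isShift {F F' : A → Framed 𝔄 ℋ} (hF : Continuous F) (hF' : Continuous F')
    {a a' : A → ℝ} (h : ∀ x, F x (a x) = F' x (a' x)) (x₀ : A)
    (h0 : ∃ s, IsShift (F x₀) (F' x₀) s) (x : A) :
    IsShift (F x) (F' x) ((a x - a' x : ℝ) : UnitAddCircle) := by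
  obtain ⟨θ, -, hθ⟩ := exists_isShift hF hF' (fun x => by
    rw [← proj_apply (F x) (a x), h, proj_apply (p := p)]) x₀ h0
  have : θ x = ((a x - a' x : ℝ) : UnitAddCircle) := by
    rw [AddCircle.coe_sub, eq_sub_iff_add_eq]
    apply (F x).isFrame.injective
    rw [h x, hθ x]
  rw [← this]; exact hθ x

/-- Two lifts with the same orientation never cross. -/
theorem lift_lt {F F' : A → Framed 𝔄 ℋ} (hF : Continuous F) (hF' : Continuous F')
    {a a' : A → ℝ} (ha : Continuous a) (ha' : Continuous a')
    (h : ∀ x, F x (a x) = F' x (a' x)) (x₀ : A)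
    (h0 : ∃ s, IsShift (F x₀) (F' x₀) s) (hlt : a' x₀ < a x₀) (x : A) : a' x < a x := by
  by_contra! hle
  -- At a crossing the shift is zero, so the two lifts coincide there and hence everywhere, against
  -- the strict inequality.
  obtain ⟨y, hy⟩ := mem_range_of_exists_le_of_exists_ge (ha.sub ha') (c := 0)
    ⟨x, by simpa using hle⟩ ⟨x₀, by simpa using hlt.le⟩
  have hy' : a y = a' y := by simpa [sub_eq_zero] using hy
  have h1 := lift_isShift hF hF' h x₀ h0 y
  rw [hy', sub_self, AddCircle.coe_zero] at h1
  obtain ⟨-, h2⟩ := lift_unique' hF hF' ha ha' h y h1.eq.symm hy'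
  rw [h2] at hlt
  exact lt_irrefl _ hlt

/-- The height of a leafwise map over the leaf where it starts is zero. -/
theorem lift_eq_zero {F : A → Framed 𝔄 ℋ} (hF : Continuous F) {a : A → ℝ} (ha : Continuous a)
    {m : A → M} (hm : ∀ x, ℋ.LeafwiseAt m x) (h : ∀ x, m x = F x (a x)) (x₀ : A)
    (h0 : a x₀ = 0) (x : A) : a x = 0 := by
  -- Near a zero the leafwise map agrees with the starting point of the frame, so its height is an
  -- integer; being small, it is zero.
  have hcl : IsClopen {x | a x = 0} := by
    refine ⟨isClosed_eq ha continuous_const, isOpen_iff_mem_nhds.2 fun y hy => ?_⟩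
    have hy' : a y = 0 := hy
    have h1 := (hm y).eventuallyEq (leafwiseAt hF y) (by rw [h y, hy']; simp) (by
      refine Filter.Eventually.of_forall fun x => ?_
      rw [h x, proj_apply (p := p)]; rfl)
    have h2 : ∀ᶠ x in 𝓝 y, |a x| < 1 := by
      have : ContinuousAt (fun x => |a x|) y := ha.abs.continuousAt
      refine this.eventually_lt_const ?_
      show |a y| < 1
      rw [hy']; norm_num
    filter_upwards [h1, h2] with z h3 h4
    have h5 : ((a z : ℝ) : UnitAddCircle) = (0 : ℝ) := (F z).isFrame.injective (by
      rw [← h z, h3]; simp)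
    obtain ⟨n, hn⟩ := UnitAddCircle.coe_eq_coe_iff.1 h5
    rw [zero_add] at hn
    rw [hn] at h4
    have : |n| < 1 := by exact_mod_cast h4
    have : n = 0 := Int.abs_lt_one_iff.1 this
    show a z = 0
    rw [hn, this]; simp
  have := hcl.eq_univ ⟨x₀, h0⟩
  exact this.ge (mem_univ x)

end Topology

end Framed

end

/-! ### Leaves, countability on transversals, and leaf-preserving maps -/

section

namespace HorizontalAtlas

variable {S : Type u} {M : Type v} [TopologicalSpace S] [TopologicalSpace M] {p : M → S}
  {Λ : Set M} (ℋ : HorizontalAtlas p Λ)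

/-- A local section of `p` over `W` with values in a leaf. -/
structure IsLeafSection (W : Set S) (l : S → M) : Prop where
  isOpen : IsOpen W
  isPreconnected : IsPreconnected W
  proj : ∀ b ∈ W, p (l b) = b
  leafwiseAt : ∀ b ∈ W, ℋ.LeafwiseAt l b

/-- Two points on a common leaf. -/
def Joined : M → M → Prop :=
  Relation.EqvGen fun x y => ∃ W l, ℋ.IsLeafSection W l ∧ ∃ b ∈ W, ∃ c ∈ W, l b = x ∧ l c = y

variable {ℋ}

theorem Joined.symm {x y : M} (h : ℋ.Joined x y) : ℋ.Joined y x := Relation.EqvGen.symm _ _ h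

theorem Joined.trans {x y z : M} (h : ℋ.Joined x y) (h' : ℋ.Joined y z) : ℋ.Joined x z :=
  Relation.EqvGen.trans _ _ _ h h'

theorem Joined.refl (x : M) : ℋ.Joined x x := Relation.EqvGen.refl _

theorem IsLeafSection.eventuallyEq {W W' : Set S} {l l' : S → M} (h : ℋ.IsLeafSection W l)
    (h' : ℋ.IsLeafSection W' l') {b : S} (hb : b ∈ W) (hb' : b ∈ W') (he : l b = l' b) :
    l =ᶠ[𝓝 b] l' := by
  refine (h.leafwiseAt b hb).eventuallyEq (h'.leafwiseAt b hb') he ?_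
  filter_upwards [h.isOpen.mem_nhds hb, h'.isOpen.mem_nhds hb'] with x h1 h2
  rw [h.proj x h1, h'.proj x h2]

theorem IsLeafSection.eqOn [T2Space M] {W : Set S} {l l' : S → M} (h : ℋ.IsLeafSection W l)
    (h' : ℋ.IsLeafSection W l') {b : S} (hb : b ∈ W) (he : l b = l' b) : EqOn l l' W := by
  by_contra hcon
  simp only [EqOn, not_forall] at hcon
  obtain ⟨c, hc, hne⟩ := hcon
  have h1 : IsOpen {x | x ∈ W ∧ l x = l' x} := isOpen_iff_mem_nhds.2 fun x hx => by
    filter_upwards [h.isOpen.mem_nhds hx.1, h.eventuallyEq h' hx.1 hx.1 hx.2] with y h1 h2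
    exact ⟨h1, h2⟩
  have h2 : IsOpen {x | x ∈ W ∧ l x ≠ l' x} := isOpen_iff_mem_nhds.2 fun x hx => by
    filter_upwards [h.isOpen.mem_nhds hx.1,
      ((h.leafwiseAt x hx.1).continuousAt.ne_iff_eventually_ne
        (h'.leafwiseAt x hx.1).continuousAt).1 hx.2] with y h1 h2
    exact ⟨h1, h2⟩
  obtain ⟨x, -, h3, h4⟩ := h.isPreconnected _ _ h1 h2 (fun x hx => by
    by_cases e : l x = l' x
    · exact Or.inl ⟨hx, e⟩
    · exact Or.inr ⟨hx, e⟩) ⟨b, hb, hb, he⟩ ⟨c, hc, hc, hne⟩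
  exact h4.2 h3.2

section

variable [CompactSpace M] [T2Space M] [LocallyConnectedSpace S] [T2Space S]

theorem exists_leafSection (hp : Continuous p) (b₀ : S) : ∃ W, IsOpen W ∧ b₀ ∈ W ∧
    ∀ y ∈ Λ, p y ∈ W → ∃ l, ℋ.IsLeafSection W l ∧ l (p y) = y := by
  obtain ⟨W, h1, h2, -, h3, h4⟩ := ℋ.exists_plaques hp b₀ Filter.univ_mem
  refine ⟨W, h1, h2, fun y hy hyW => ?_⟩
  obtain ⟨l, hl, hl'⟩ := h4 y hy hyW
  exact ⟨l, ⟨h1, h3, fun b hb => (hl' b hb).1, fun b hb => (hl' b hb).2⟩, hl⟩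

variable {A : Type*} [TopologicalSpace A]

/-- A leafwise map locally factors through a section of `p`. -/
theorem LeafwiseAt.exists_section (hp : Continuous p) {m : A → M} {a : A}
    (h : ℋ.LeafwiseAt m a) : ∃ W l, ℋ.IsLeafSection W l ∧ p (m a) ∈ W ∧
      l (p (m a)) = m a ∧ ∀ᶠ x in 𝓝 a, p (m x) ∈ W ∧ l (p (m x)) = m x := by
  obtain ⟨W, hW, haW, hpl⟩ := exists_leafSection (ℋ := ℋ) hp (p (m a))
  obtain ⟨l, hl, hl'⟩ := hpl (m a) h.mem haW
  have hc : ContinuousAt (fun x => p (m x)) a := ContinuousAt.comp hp.continuousAt h.continuousAt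
  have hm := hc.eventually_mem (hW.mem_nhds haW)
  have h1 : (fun x => l (p (m x))) =ᶠ[𝓝 a] m := by
    refine LeafwiseAt.eventuallyEq (LeafwiseAt.comp (g := fun x => p (m x))
      (hl.leafwiseAt _ haW) hc) h hl' ?_
    filter_upwards [hm] with x hx
    exact hl.proj _ hx
  refine ⟨W, l, hl, haW, hl', ?_⟩
  filter_upwards [hm, h1] with x h2 h3 using ⟨h2, h3⟩

/-- Locally the map runs in one leaf section, so the classes of parameters with values on a common
leaf are open and closed. -/
theorem joined_of_leafwise (hp : Continuous p) [PreconnectedSpace A] {m : A → M}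
    (h : ∀ a, ℋ.LeafwiseAt m a) (a b : A) : ℋ.Joined (m a) (m b) := by
  have key : ∀ x, ∀ᶠ y in 𝓝 x, ℋ.Joined (m x) (m y) := fun x => by
    obtain ⟨W, l, hl, h1, h2, h3⟩ := (h x).exists_section hp
    filter_upwards [h3] with y hy
    exact Relation.EqvGen.rel _ _ ⟨W, l, hl, _, h1, _, hy.1, h2, hy.2⟩
  have hcl : IsClopen {x | ℋ.Joined (m a) (m x)} := by
    constructor
    · refine ⟨isOpen_iff_mem_nhds.2 fun x hx => ?_⟩
      filter_upwards [key x] with y hy h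
      exact hx (h.trans hy.symm)
    · refine isOpen_iff_mem_nhds.2 fun x hx => ?_
      filter_upwards [key x] with y hy
      exact Joined.trans hx hy
  have := hcl.eq_univ ⟨a, Joined.refl _⟩
  exact this.ge (mem_univ b)

theorem joined_of_leafwiseOn (hp : Continuous p) {V : Set A} (hV : IsPreconnected V)
    {m : A → M} (h : ∀ a ∈ V, ℋ.LeafwiseAt m a) {a b : A} (ha : a ∈ V) (hb : b ∈ V) :
    ℋ.Joined (m a) (m b) := by
  have := isPreconnected_iff_preconnectedSpace.1 hV
  exact joined_of_leafwise (A := V) (m := fun x => m x) hp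
    (fun x => (h x x.2).comp continuousAt_subtype_val) ⟨a, ha⟩ ⟨b, hb⟩

/-- A leaf meets each fibre in a countable set. -/
theorem countable_leaf_inter_fibre [CompactSpace S] [SecondCountableTopology S]
    (hp : Continuous p) {x₀ : M} (hx₀ : x₀ ∈ Λ) (b₀ : S) :
    {y | ℋ.Joined x₀ y ∧ p y = b₀}.Countable := by
  have : Nonempty M := ⟨x₀⟩
  choose W hWo hbW hW using fun b => exists_leafSection (ℋ := ℋ) hp b
  choose! l hl hly using hW
  obtain ⟨t, ht⟩ := CompactSpace.elim_nhds_subcover W fun b => (hWo b).mem_nhds (hbW b)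
  obtain ⟨D, hDc, hDd⟩ := TopologicalSpace.exists_countable_dense S
  have hcov : ∀ b, ∃ c ∈ t, b ∈ W c := fun b => by
    have : b ∈ ⋃ c ∈ t, W c := ht ▸ mem_univ b
    simpa using this
  -- From a point already reached, follow each of the finitely many chosen plaque families to the
  -- base points of a countable dense set. Iterating stays countable.
  let next : Set M → Set M := fun X =>
    ⋃ x ∈ X, ⋃ c ∈ t, ⋃ d ∈ D, {y | x ∈ Λ ∧ p x ∈ W c ∧ d ∈ W c ∧ y = l c x d}
  have hnext : ∀ X : Set M, X.Countable → (next X).Countable := fun X hX =>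
    hX.biUnion fun x _ => t.countable_toSet.biUnion fun c _ => hDc.biUnion fun d _ =>
      (countable_singleton (l c x d)).mono fun y hy => hy.2.2.2
  let E : ℕ → Set M := fun n => next^[n] {x₀}
  have hE : (⋃ n, E n).Countable := countable_iUnion fun n => by
    induction n with
    | zero => exact countable_singleton _
    | succ n ih =>
      have : E (n + 1) = next (E n) := Function.iterate_succ_apply' _ _ _
      rw [this]; exact hnext _ ih
  have hE' : ∀ x ∈ ⋃ n, E n, x ∈ Λ → ∀ c ∈ t, p x ∈ W c → ∀ d ∈ D, d ∈ W c →
      l c x d ∈ ⋃ n, E n := by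
    intro x hx hxΛ c hc hxc d hd hdc
    obtain ⟨n, hn⟩ := mem_iUnion.1 hx
    refine mem_iUnion.2 ⟨n + 1, ?_⟩
    have : E (n + 1) = next (E n) := Function.iterate_succ_apply' _ _ _
    rw [this]
    simp only [next, mem_iUnion]
    exact ⟨x, hn, c, hc, d, hd, hxΛ, hxc, hdc, rfl⟩
  -- The points on some chosen plaque through a reached point; this set will be saturated by leaves.
  let Sat : Set M := {y | ∃ x ∈ ⋃ n, E n, x ∈ Λ ∧ ∃ c ∈ t, p x ∈ W c ∧ p y ∈ W c ∧
    l c x (p y) = y}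
  -- Passing to another family: the plaques of the two families through `y` agree near it, hence at
  -- a base point of the dense set, where the common point is reached by construction. Uniqueness of
  -- sections brings its plaque back to `y`.
  have key : ∀ y ∈ Sat, ∀ c ∈ t, p y ∈ W c → ∃ x ∈ ⋃ n, E n, x ∈ Λ ∧ p x ∈ W c ∧
      l c x (p y) = y := by
    rintro y ⟨x, hxE, hxΛ, c, hc, hxc, hyc, hy⟩ c' hc' hyc'
    have hs := hl c x hxΛ hxc
    have hyΛ : y ∈ Λ := hy ▸ (hs.leafwiseAt _ hyc).mem
    have hs' := hl c' y hyΛ hyc'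
    have heq := hs.eventuallyEq hs' hyc hyc' (by rw [hy, hly c' y hyΛ hyc'])
    obtain ⟨d, hd, hdD⟩ := mem_closure_iff_nhds.1 (hDd (p y)) _
      (Filter.inter_mem (Filter.inter_mem ((hWo c).mem_nhds hyc) ((hWo c').mem_nhds hyc')) heq)
    obtain ⟨⟨hdc, hdc'⟩, hdeq⟩ := hd
    have hxΛ' : l c x d ∈ Λ := (hs.leafwiseAt _ hdc).mem
    have hpd : p (l c x d) = d := hs.proj d hdc
    have hs'' := hl c' (l c x d) hxΛ' (by rw [hpd]; exact hdc')
    refine ⟨l c x d, hE' x hxE hxΛ c hc hxc d hdD hdc, hxΛ', by rw [hpd]; exact hdc', ?_⟩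
    have h1 := hly c' (l c x d) hxΛ' (by rw [hpd]; exact hdc')
    rw [hpd] at h1
    have h2 := hs''.eqOn hs' hdc' (h1.trans hdeq)
    rw [h2 hyc', hly c' y hyΛ hyc']
  -- Along a leaf section both membership in `Sat` and its negation are open conditions, so a
  -- connected section lies entirely inside or outside.
  have hsec : ∀ V k, ℋ.IsLeafSection V k → ∀ b ∈ V, ∀ c ∈ V, k b ∈ Sat → k c ∈ Sat := by
    intro V k hk b hb c hc hbS
    by_contra hcS
    have h1 : IsOpen {x | x ∈ V ∧ k x ∈ Sat} := by
      refine isOpen_iff_mem_nhds.2 fun x hx => ?_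
      obtain ⟨hxV, z, hzE, hzΛ, e, he, hze, hxe, hx⟩ := hx
      rw [hk.proj x hxV] at hxe hx
      filter_upwards [hk.isOpen.mem_nhds hxV, (hWo e).mem_nhds hxe,
        (hl e z hzΛ hze).eventuallyEq hk hxe hxV hx] with y h1 h2 h3
      exact ⟨h1, z, hzE, hzΛ, e, he, hze, by rw [hk.proj y h1]; exact h2,
        by rw [hk.proj y h1]; exact h3⟩
    have h2 : IsOpen {x | x ∈ V ∧ k x ∉ Sat} := by
      refine isOpen_iff_mem_nhds.2 fun x hx => ?_
      obtain ⟨hxV, hxS⟩ := hx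
      obtain ⟨e, he, hxe⟩ := hcov x
      have hkx : p (k x) ∈ W e := by rw [hk.proj x hxV]; exact hxe
      have hkΛ := (hk.leafwiseAt x hxV).mem
      have hs := hl e (k x) hkΛ hkx
      have hsx : l e (k x) x = k x := by
        have := hly e (k x) hkΛ hkx
        rwa [hk.proj x hxV] at this
      filter_upwards [hk.isOpen.mem_nhds hxV, (hWo e).mem_nhds hxe,
        hs.eventuallyEq hk hxe hxV hsx] with y h1 h2 h3
      refine ⟨h1, fun hy => hxS ?_⟩
      obtain ⟨z, hzE, hzΛ, hze, hzy⟩ := key _ hy e he (by rw [hk.proj y h1]; exact h2)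
      rw [hk.proj y h1] at hzy
      have h4 := (hl e z hzΛ hze).eqOn hs h2 (hzy.trans h3.symm)
      exact ⟨z, hzE, hzΛ, e, he, hze, hkx, by rw [hk.proj x hxV, h4 hxe, hsx]⟩
    obtain ⟨x, -, h3, h4⟩ := hk.isPreconnected _ _ h1 h2 (fun x hx => by
      by_cases e : k x ∈ Sat
      · exact Or.inl ⟨hx, e⟩
      · exact Or.inr ⟨hx, e⟩) ⟨b, hb, hb, hbS⟩ ⟨c, hc, hc, hcS⟩
    exact h4.2 h3.2
  have hjoin : ∀ y z, ℋ.Joined y z → (y ∈ Sat ↔ z ∈ Sat) := by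
    intro y z h
    induction h with
    | rel y z h =>
      obtain ⟨V, k, hk, b, hb, c, hc, rfl, rfl⟩ := h
      exact ⟨hsec V k hk b hb c hc, hsec V k hk c hc b hb⟩
    | refl => rfl
    | symm _ _ _ ih => exact ih.symm
    | trans _ _ _ _ _ ih ih' => exact ih.trans ih'
  have hx₀S : x₀ ∈ Sat := by
    obtain ⟨c, hc, hxc⟩ := hcov (p x₀)
    exact ⟨x₀, mem_iUnion.2 ⟨0, rfl⟩, hx₀, c, hc, hxc, hxc, hly c x₀ hx₀ hxc⟩
  have hcount : (⋃ x ∈ ⋃ n, E n, ⋃ c ∈ t, {y | y = l c x b₀}).Countable :=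
    hE.biUnion fun x _ => t.countable_toSet.biUnion fun c _ => countable_singleton (l c x b₀)
  refine hcount.mono ?_
  rintro y ⟨hy, rfl⟩
  obtain ⟨x, hx, -, c, hc, -, -, hxy⟩ := (hjoin _ _ hy).1 hx₀S
  exact mem_iUnion₂.2 ⟨x, hx, mem_iUnion₂.2 ⟨c, hc, hxy.symm⟩⟩

/-- A plaque of the box projects onto the whole base of the box, so a point of the lamination can
slide along it to the fibre of any other point of the box. -/
theorem joined_slide (hp : Continuous p) {ψ : OpenPartialHomeomorph M (S × ℝ)}
    (hψ : ψ ∈ ℋ.boxes) {x y : M} (hx : x ∈ ψ.source) (hyΛ : y ∈ Λ) (hys : y ∈ ψ.source) :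
    ℋ.Joined y (ψ.symm (p x, (ψ y).2)) ∧ (p x, (ψ y).2) ∈ ψ.target := by
  obtain ⟨U, T, hU, hT, hΛ⟩ := ℋ.isFlowBox ψ hψ
  set t := (ψ y).2 with ht
  have htar : ∀ c ∈ U, (c, t) ∈ ψ.target := fun c hc => by rw [hT]; exact ⟨hc, trivial⟩
  have hy1 : ψ y ∈ U ×ˢ T := by rw [← hΛ]; exact mem_image_of_mem _ ⟨hyΛ, hys⟩
  have hxU : p x ∈ U := by
    have := ψ.map_source hx
    rw [hT] at this
    rw [← ℋ.fst_eq ψ hψ x hx]; exact this.1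
  have hUo : IsOpen U := by
    have h1 : U = (fun b => (b, (0 : ℝ))) ⁻¹' ψ.target := by ext b; simp [hT]
    rw [h1]
    exact ψ.open_target.preimage (by fun_prop)
  have hmem : ∀ c ∈ U, ψ.symm (c, t) ∈ Λ := by
    intro c hc
    have : (c, t) ∈ ψ '' (Λ ∩ ψ.source) := by rw [hΛ]; exact ⟨hc, hy1.2⟩
    obtain ⟨z, ⟨hz, hzs⟩, hzb⟩ := this
    rw [← hzb, ψ.left_inv hzs]; exact hz
  have hlw : ∀ c ∈ U, ℋ.LeafwiseAt (fun c => ψ.symm (c, t)) c := fun c hc => by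
    refine leafwiseAt_of_box hψ ?_ ?_ (ψ.map_target (htar c hc)) ?_
    · exact ContinuousAt.comp (x := c) (f := fun b => (b, t)) (g := ψ.symm)
        (ψ.continuousAt_symm (htar c hc)) (by fun_prop)
    · filter_upwards [hUo.mem_nhds hc] with b' hb' using hmem b' hb'
    · filter_upwards [hUo.mem_nhds hc] with b' hb'
      rw [ψ.right_inv (htar b' hb'), ψ.right_inv (htar c hc)]
  have hj := joined_of_leafwiseOn hp hU.isPreconnected hlw hy1.1 hxU
  have : ψ.symm ((ψ y).1, t) = y := ψ.left_inv hys
  rw [this] at hj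
  exact ⟨hj, htar _ hxU⟩

/-- Sliding all plaques of the box to one fibre keeps their heights, and the leaf meets that fibre
in a countable set. -/
theorem countable_levels [CompactSpace S] [SecondCountableTopology S]
    (hp : Continuous p) {x₀ : M} (hx₀ : x₀ ∈ Λ) {ψ : OpenPartialHomeomorph M (S × ℝ)}
    (hψ : ψ ∈ ℋ.boxes) :
    {t | ∃ y ∈ Λ, y ∈ ψ.source ∧ ℋ.Joined x₀ y ∧ (ψ y).2 = t}.Countable := by
  by_cases hne : ψ.source.Nonempty
  · obtain ⟨x, hx⟩ := hne
    refine ((countable_leaf_inter_fibre (ℋ := ℋ) hp hx₀ (p x)).image fun y => (ψ y).2).mono ?_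
    rintro t ⟨y, hyΛ, hys, hy, rfl⟩
    obtain ⟨hj, htar⟩ := joined_slide hp hψ hx hyΛ hys
    refine ⟨ψ.symm (p x, (ψ y).2), ⟨hy.trans hj, ?_⟩, ?_⟩
    · rw [← ℋ.fst_eq ψ hψ _ (ψ.map_target htar), ψ.right_inv htar]
    · show (ψ (ψ.symm (p x, (ψ y).2))).2 = _
      rw [ψ.right_inv htar]
  · refine countable_empty.mono ?_
    rintro t ⟨y, -, hys, -⟩
    exact hne ⟨y, hys⟩

/-- A continuous map which preserves the partition into leaves is leafwise. -/
theorem LeafwiseAt.map [CompactSpace S] [SecondCountableTopology S] (hp : Continuous p)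
    {k : M → M} (hk : Continuous k) (hΛ : ∀ x ∈ Λ, k x ∈ Λ)
    (hj : ∀ x ∈ Λ, ∀ y, ℋ.Joined x y → ℋ.Joined (k x) (k y)) {m : A → M} {a : A}
    (hm : ℋ.LeafwiseAt m a) : ℋ.LeafwiseAt (fun x => k (m x)) a := by
  obtain ⟨W, l, hl, haW, hla, hev⟩ := hm.exists_section hp
  -- Factoring through a leaf section makes the parameter space locally connected.
  suffices h : ℋ.LeafwiseAt (fun b => k (l b)) (p (m a)) by
    have h1 := LeafwiseAt.comp (g := fun x => p (m x)) h
      (ContinuousAt.comp hp.continuousAt hm.continuousAt)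
    refine h1.congr ?_
    filter_upwards [hev] with x hx
    show k (l (p (m x))) = k (m x)
    rw [hx.2]
  have hc : ContinuousAt (fun b => k (l b)) (p (m a)) :=
    ContinuousAt.comp hk.continuousAt (hl.leafwiseAt _ haW).continuousAt
  refine ⟨hc, ?_, fun ψ hψ hs => ?_⟩
  · filter_upwards [hl.isOpen.mem_nhds haW] with b hb using hΛ _ (hl.leafwiseAt b hb).mem
  · obtain ⟨V, hV, hVo, hbV, hVc⟩ := locallyConnectedSpace_iff_subsets_isOpen_isConnected.1
      inferInstance (p (m a)) _ (Filter.inter_mem (hl.isOpen.mem_nhds haW)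
        (hc (ψ.open_source.mem_nhds hs)))
    -- The levels form a connected set of reals, countable because the image stays on one leaf;
    -- hence a single level. No continuity of the map along leaves had to be assumed.
    have hsub : ((fun b => (ψ (k (l b))).2) '' V).Subsingleton := by
      refine Set.Countable.isTotallyDisconnected ?_ _ Subset.rfl ?_
      · refine (countable_levels (ℋ := ℋ) hp (hΛ _ (hl.leafwiseAt _ haW).mem) hψ).mono ?_
        rintro _ ⟨b, hb, rfl⟩
        exact ⟨k (l b), hΛ _ (hl.leafwiseAt b (hV hb).1).mem, (hV hb).2,
          hj _ (hl.leafwiseAt _ haW).mem _ (Relation.EqvGen.rel _ _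
            ⟨W, l, hl, _, haW, _, (hV hb).1, rfl, rfl⟩), rfl⟩
      · refine hVc.isPreconnected.image _ fun b hb => ?_
        refine ContinuousAt.continuousWithinAt ?_
        have h1 : ContinuousAt (fun b => k (l b)) b :=
          ContinuousAt.comp hk.continuousAt (hl.leafwiseAt _ (hV hb).1).continuousAt
        exact continuous_snd.continuousAt.comp
          (ContinuousAt.comp (f := fun b => k (l b)) (ψ.continuousAt (hV hb).2) h1)
    filter_upwards [hVo.mem_nhds hbV] with b hb
    exact hsub (mem_image_of_mem _ hb) (mem_image_of_mem _ hbV)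

end

end HorizontalAtlas

end

/-! ### From the lamination to its horizontal atlas -/

section

namespace SurfaceLamination

variable {S : Type u} {M : Type v} [TopologicalSpace S] [TopologicalSpace M] {p : M → S}
  (Λ : SurfaceLamination M)

theorem SamePlaque.mem {Λ : SurfaceLamination M} {x y : M} (h : Λ.SamePlaque x y) :
    x ∈ Λ.support ∧ y ∈ Λ.support := by
  obtain ⟨φ, -, h1, h2, -⟩ := h
  exact ⟨h1.1, h2.1⟩

theorem mem_support_iff {Λ : SurfaceLamination M} {x y : M}
    (h : Relation.EqvGen Λ.SamePlaque x y) : x ∈ Λ.support ↔ y ∈ Λ.support := by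
  induction h with
  | rel x y h => exact ⟨fun _ => h.mem.2, fun _ => h.mem.1⟩
  | refl => rfl
  | symm _ _ _ ih => exact ih.symm
  | trans _ _ _ _ _ ih ih' => exact ih.trans ih'

/-- The horizontal flow boxes of a horizontal lamination. -/
def horizontalAtlas (hΛ : Λ.IsHorizontal p) : HorizontalAtlas p Λ.support where
  boxes := {ψ | IsFlowBox Λ.support ψ ∧ (∀ φ ∈ Λ.atlas, PlaquesAgree Λ.support φ ψ) ∧
    ∀ y ∈ ψ.source, (ψ y).1 = p y}
  isClosed := Λ.isClosed_support
  exists_mem_source x hx := by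
    obtain ⟨ψ, h1, h2, h3, h4⟩ := hΛ _ ⟨x, hx, rfl⟩ x (Relation.EqvGen.refl x)
    exact ⟨ψ, ⟨h2, h3, h4⟩, h1⟩
  isFlowBox ψ h := h.1
  fst_eq ψ h := h.2.2
  agree ψ h ψ' h' x hx hxs hxs' := by
    obtain ⟨φ, hφ, hxφ⟩ := Λ.exists_mem_source x hx
    filter_upwards [h.2.1 φ hφ x hx hxφ hxs, h'.2.1 φ hφ x hx hxφ hxs'] with y h1 h2
    exact h1.symm.trans h2

/-- The image of the leaf of `x` is the leaf of some `z`; both image points are compared through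
`z`. -/
theorem IsInvariant.map {Λ : SurfaceLamination M} {h : M ≃ₜ M} (hinv : Λ.IsInvariant h) {x : M}
    (hx : x ∈ Λ.support) : h x ∈ Λ.support ∧
      ∀ y, Relation.EqvGen Λ.SamePlaque x y → Relation.EqvGen Λ.SamePlaque (h x) (h y) := by
  have h1 : h '' {y | Relation.EqvGen Λ.SamePlaque x y} ∈ Λ.leaves :=
    hinv.le (mem_image_of_mem _ ⟨x, hx, rfl⟩)
  obtain ⟨z, hz, hzL⟩ := h1
  have h2 : ∀ y, Relation.EqvGen Λ.SamePlaque x y → Relation.EqvGen Λ.SamePlaque z (h y) :=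
    fun y hy => hzL.le (mem_image_of_mem _ hy)
  have h3 := h2 x (Relation.EqvGen.refl _)
  exact ⟨(mem_support_iff h3).1 hz, fun y hy => (h3.symm).trans _ _ _ (h2 y hy)⟩

theorem IsInvariant.symm_map {Λ : SurfaceLamination M} {h : M ≃ₜ M} (hinv : Λ.IsInvariant h)
    {x : M} (hx : x ∈ Λ.support) : h.symm x ∈ Λ.support ∧
      ∀ y, Relation.EqvGen Λ.SamePlaque x y →
        Relation.EqvGen Λ.SamePlaque (h.symm x) (h.symm y) := by
  have h1 : {y | Relation.EqvGen Λ.SamePlaque x y} ∈ Λ.leaves := ⟨x, hx, rfl⟩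
  rw [← hinv] at h1
  obtain ⟨L, ⟨z, hz, rfl⟩, hL⟩ := h1
  have h2 : ∀ y, Relation.EqvGen Λ.SamePlaque x y →
      Relation.EqvGen Λ.SamePlaque z (h.symm y) := fun y hy => by
    obtain ⟨w, hw, rfl⟩ := hL.ge hy
    rwa [h.symm_apply_apply]
  have h3 := h2 x (Relation.EqvGen.refl _)
  exact ⟨(mem_support_iff h3).1 hz, fun y hy => (h3.symm).trans _ _ _ (h2 y hy)⟩

variable [CompactSpace M] [T2Space M] [LocallyConnectedSpace S] [T2Space S]

/-- Plaques of the given atlas are locally plaques of horizontal boxes and conversely, so a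
connected piece of either kind stays in one class of the other. Hence the two notions of leaf
coincide. -/
theorem joined_iff (hp : Continuous p) (hΛ : Λ.IsHorizontal p) {x y : M} :
    (Λ.horizontalAtlas hΛ).Joined x y ↔ Relation.EqvGen Λ.SamePlaque x y := by
  constructor
  · intro h
    induction h with
    | rel x y h =>
      obtain ⟨W, l, hl, b, hb, c, hc, rfl, rfl⟩ := h
      have key : ∀ x ∈ W, ∀ᶠ y in 𝓝 x, y ∈ W ∧ Λ.SamePlaque (l x) (l y) := by
        intro x hx
        have hlx := hl.leafwiseAt x hx
        obtain ⟨φ, hφ, hxφ⟩ := Λ.exists_mem_source (l x) hlx.mem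
        obtain ⟨ψ, hψ, hxψ⟩ := (Λ.horizontalAtlas hΛ).exists_mem_source (l x) hlx.mem
        have h1 := hψ.2.1 φ hφ (l x) hlx.mem hxφ hxψ
        have h2 : Filter.Tendsto l (𝓝 x) (𝓝[Λ.support] (l x)) :=
          tendsto_nhdsWithin_iff.2 ⟨hlx.continuousAt, hlx.2.1⟩
        filter_upwards [hl.isOpen.mem_nhds hx, h2.eventually h1, hlx.2.2 ψ hψ hxψ, hlx.2.1,
          hlx.continuousAt.eventually_mem (φ.open_source.mem_nhds hxφ)] with y h3 h4 h5 h6 h7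
        exact ⟨h3, φ, hφ, ⟨hlx.mem, hxφ⟩, ⟨h6, h7⟩, (h4.2 h5).symm⟩
      by_contra hcon
      have h1 : IsOpen {x | x ∈ W ∧ Relation.EqvGen Λ.SamePlaque (l b) (l x)} := by
        refine isOpen_iff_mem_nhds.2 fun x hx => ?_
        filter_upwards [key x hx.1] with y hy
        exact ⟨hy.1, hx.2.trans _ _ _ (Relation.EqvGen.rel _ _ hy.2)⟩
      have h2 : IsOpen {x | x ∈ W ∧ ¬ Relation.EqvGen Λ.SamePlaque (l b) (l x)} := by
        refine isOpen_iff_mem_nhds.2 fun x hx => ?_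
        filter_upwards [key x hx.1] with y hy
        exact ⟨hy.1, fun h => hx.2 (h.trans _ _ _ (Relation.EqvGen.symm _ _
          (Relation.EqvGen.rel _ _ hy.2)))⟩
      obtain ⟨x, -, h3, h4⟩ := hl.isPreconnected _ _ h1 h2 (fun x hx => by
        by_cases e : Relation.EqvGen Λ.SamePlaque (l b) (l x)
        · exact Or.inl ⟨hx, e⟩
        · exact Or.inr ⟨hx, e⟩) ⟨b, hb, hb, Relation.EqvGen.refl _⟩ ⟨c, hc, hc, hcon⟩
      exact h4.2 h3.2
    | refl => exact Relation.EqvGen.refl _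
    | symm _ _ _ ih => exact ih.symm
    | trans _ _ _ _ _ ih ih' => exact ih.trans _ _ _ ih'
  · intro h
    induction h with
    | rel x y h =>
      obtain ⟨φ, hφ, ⟨hxΛ, hxs⟩, ⟨hyΛ, hys⟩, hxy⟩ := h
      obtain ⟨U, T, hU, hT, hT'⟩ := Λ.isFlowBox φ hφ
      have hUo : IsOpen U := by
        have h1 : U = (fun b => (b, (0 : ℝ))) ⁻¹' φ.target := by ext b; simp [hT]
        rw [h1]
        exact φ.open_target.preimage (by fun_prop)
      set t := (φ x).2 with ht
      have htar : ∀ c ∈ U, (c, t) ∈ φ.target := fun c hc => by rw [hT]; exact ⟨hc, trivial⟩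
      have hx1 : φ x ∈ U ×ˢ T := by rw [← hT']; exact mem_image_of_mem _ ⟨hxΛ, hxs⟩
      have hy1 : φ y ∈ U ×ˢ T := by rw [← hT']; exact mem_image_of_mem _ ⟨hyΛ, hys⟩
      have hmem : ∀ c ∈ U, φ.symm (c, t) ∈ Λ.support := by
        intro c hc
        have : (c, t) ∈ φ '' (Λ.support ∩ φ.source) := by rw [hT']; exact ⟨hc, hx1.2⟩
        obtain ⟨z, ⟨hz, hzs⟩, hzb⟩ := this
        rw [← hzb, φ.left_inv hzs]; exact hz
      have hlw : ∀ c ∈ U, (Λ.horizontalAtlas hΛ).LeafwiseAt (fun c => φ.symm (c, t)) c := by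
        intro c hc
        have hct : ContinuousAt (fun c => φ.symm (c, t)) c :=
          ContinuousAt.comp (x := c) (f := fun b => (b, t)) (g := φ.symm)
            (φ.continuousAt_symm (htar c hc)) (by fun_prop)
        have hcm : ∀ᶠ b in 𝓝 c, φ.symm (b, t) ∈ Λ.support := by
          filter_upwards [hUo.mem_nhds hc] with b hb using hmem b hb
        refine ⟨hct, hcm, fun ψ hψ hs => ?_⟩
        have h1 := hψ.2.1 φ hφ _ (hmem c hc) (φ.map_target (htar c hc)) hs
        have h2 : Filter.Tendsto (fun c => φ.symm (c, t)) (𝓝 c)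
            (𝓝[Λ.support] (φ.symm (c, t))) := tendsto_nhdsWithin_iff.2 ⟨hct, hcm⟩
        filter_upwards [h2.eventually h1, hUo.mem_nhds hc] with b h3 h4
        exact h3.1 (by rw [φ.right_inv (htar b h4), φ.right_inv (htar c hc)])
      have hj := HorizontalAtlas.joined_of_leafwiseOn hp hU.isPreconnected hlw hx1.1 hy1.1
      have e1 : φ.symm ((φ x).1, t) = x := φ.left_inv hxs
      have e2 : φ.symm ((φ y).1, t) = y := by rw [hxy]; exact φ.left_inv hys
      rwa [e1, e2] at hj
    | refl => exact Relation.EqvGen.refl _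
    | symm _ _ _ ih => exact ih.symm
    | trans _ _ _ _ _ ih ih' => exact ih.trans ih'

end SurfaceLamination

end

/-! ### Lifting the isotopy and the return map -/

section

open scoped unitInterval

variable {S : Type u} {M : Type v} [TopologicalSpace S] [TopologicalSpace M] {p : M → S}
  {Λ : Set M}

/-- Maps which send leaves into leaves. -/
def HorizontalAtlas.Preserves (ℋ : HorizontalAtlas p Λ) (k : M → M) : Prop :=
  (∀ x ∈ Λ, k x ∈ Λ) ∧ ∀ x ∈ Λ, ∀ y, ℋ.Joined x y → ℋ.Joined (k x) (k y)

/-- An isotopy from the identity to a homeomorphism that permutes the leaves. -/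
structure LeafIsotopy (ℋ : HorizontalAtlas p Λ) where
  /-- the isotopy -/
  H : I → M ≃ₜ M
  continuous : Continuous fun q : I × M => H q.1 q.2
  zero : ∀ x, H 0 x = x
  preserves : ℋ.Preserves (H 1)
  preserves_symm : ℋ.Preserves (H 1).symm

namespace LeafIsotopy

variable {ℋ : HorizontalAtlas p Λ}

/-- The isotopy from the identity to the inverse of the end. -/
def symm (𝓘 : LeafIsotopy ℋ) : LeafIsotopy ℋ where
  H t := (𝓘.H 1).symm.trans (𝓘.H (σ t))
  continuous := 𝓘.continuous.comp (f := fun q : I × M => (σ q.1, (𝓘.H 1).symm q.2)) (by fun_prop)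
  zero x := by simp
  preserves := by
    have : ⇑((𝓘.H 1).symm.trans (𝓘.H (σ 1))) = (𝓘.H 1).symm := by
      ext x; simp [𝓘.zero]
    rw [this]; exact 𝓘.preserves_symm
  preserves_symm := by
    have : ⇑((𝓘.H 1).symm.trans (𝓘.H (σ 1))).symm = 𝓘.H 1 := by
      ext x
      have hz : ∀ x, (𝓘.H 0).symm x = x := fun x => (𝓘.H 0).symm_apply_eq.2 (𝓘.zero x).symm
      simp [hz]
    rw [this]; exact 𝓘.preserves

theorem symm_apply (𝓘 : LeafIsotopy ℋ) (t : I) (x : M) :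
    𝓘.symm.H t x = 𝓘.H (σ t) ((𝓘.H 1).symm x) := rfl

theorem symm_symm_apply (𝓘 : LeafIsotopy ℋ) (t : I) (x : M) :
    𝓘.symm.symm.H t x = 𝓘.H t x := by
  have : (𝓘.symm.H 1).symm x = 𝓘.H 1 x := by
    rw [← (𝓘.symm.H 1).injective.eq_iff]
    simp [symm_apply, 𝓘.zero]
  rw [symm_apply, this, symm_apply]; simp

end LeafIsotopy

/-- Lifts to the space of framed points of an isotopy, and of the reversed isotopy. -/
structure IsotopyLift (𝔄 : FrameAtlas p) (ℋ : HorizontalAtlas p Λ) (H : I → M → M) where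
  /-- the lift of the isotopy -/
  F₁ : I × Framed 𝔄 ℋ → Framed 𝔄 ℋ
  /-- the height of the isotopy above its lift -/
  a₁ : I × Framed 𝔄 ℋ → ℝ
  /-- the lift of the end of the isotopy -/
  top : Framed 𝔄 ℋ → Framed 𝔄 ℋ
  /-- the lift of the reversed isotopy -/
  F₂ : I × Framed 𝔄 ℋ → Framed 𝔄 ℋ
  /-- the height of the reversed isotopy above its lift -/
  a₂ : I × Framed 𝔄 ℋ → ℝ
  continuous_F₁ : Continuous F₁
  continuous_a₁ : Continuous a₁
  lift₁ : ∀ x, H x.1 (x.2 0) = F₁ x (a₁ x)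
  F₁_zero : ∀ f, F₁ (0, f) = f
  a₁_zero : ∀ f, a₁ (0, f) = 0
  continuous_top : Continuous top
  isShift_top : ∀ f, Framed.IsShift (F₁ (1, f)) (top f) (a₁ (1, f))
  continuous_F₂ : Continuous F₂
  continuous_a₂ : Continuous a₂
  lift₂ : ∀ x, H (σ x.1) (x.2 0) = F₂ x (a₂ x)
  F₂_zero : ∀ f, F₂ (0, f) = top f
  a₂_zero : ∀ f, a₂ (0, f) = 0

namespace IsotopyLift

open Framed

variable {𝔄 : FrameAtlas p} {ℋ : HorizontalAtlas p Λ} {H : I → M → M}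

/-- The return map of the framed points. -/
def ret (D : IsotopyLift 𝔄 ℋ H) (f : Framed 𝔄 ℋ) : Framed 𝔄 ℋ := D.F₂ (1, f)

/-- The displacement of the framed points. -/
def disp (D : IsotopyLift 𝔄 ℋ H) (f : Framed 𝔄 ℋ) : ℝ := -D.a₂ (1, f)

theorem continuous_ret (D : IsotopyLift 𝔄 ℋ H) : Continuous D.ret := D.continuous_F₂.comp (by fun_prop)

theorem continuous_disp (D : IsotopyLift 𝔄 ℋ H) : Continuous D.disp := (D.continuous_a₂.comp (by fun_prop)).neg

theorem top_zero (D : IsotopyLift 𝔄 ℋ H) (f : Framed 𝔄 ℋ) : D.top f 0 = H 1 (f 0) := by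
  rw [(D.isShift_top f).zero, ← D.lift₁]

variable [CompactSpace S] [T2Space S] [T2Space M] [LocallyConnectedSpace S]

/-- The track of the starting point is lifted from height zero; at the end the frame is rotated to
the image point, which lies on the lamination again. The rotated frame depends continuously on the
framed point because the end of the isotopy is a leafwise map. The reversed isotopy is then lifted
afresh from height zero. -/
theorem nonempty [SecondCountableTopology S] (𝓘 : LeafIsotopy ℋ) :
    Nonempty (IsotopyLift 𝔄 ℋ fun t x => 𝓘.H t x) := by
  have := 𝔄.compactSpace
  have hc : Continuous fun f : Framed 𝔄 ℋ => f 0 := continuous_apply continuous_id continuous_const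
  obtain ⟨F₁, a₁, h1, h2, h3, h4, h5⟩ := exists_lift (𝔄 := 𝔄) (ℋ := ℋ) (A := Framed 𝔄 ℋ)
    (Q := fun x => 𝓘.H x.1 (x.2 0))
    (𝓘.continuous.comp (continuous_fst.prodMk (hc.comp continuous_snd))) (F₀ := id) continuous_id
    (a₀ := fun _ => 0) continuous_const (fun x => by simp [𝓘.zero])
  have hmem : ∀ f, F₁ (1, f) (a₁ (1, f)) ∈ Λ := fun f => by
    rw [← h3]; exact 𝓘.preserves.1 _ f.mem
  let top : Framed 𝔄 ℋ → Framed 𝔄 ℋ := fun f => (F₁ (1, f)).shift (a₁ (1, f)) (hmem f)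
  have htop0 : ∀ f, top f 0 = 𝓘.H 1 (f 0) := fun f => by
    rw [(isShift_shift _ _ (hmem f)).zero, ← h3]
  have htop : Continuous top := by
    refine continuous_of_isShift (F := fun f => F₁ (1, f)) (by fun_prop)
      (θ := fun f => ((a₁ (1, f) : ℝ) : UnitAddCircle))
      ((AddCircle.continuous_mk' 1).comp (by fun_prop))
      (fun f => isShift_shift _ _ (hmem f)) fun f => ?_
    simp only [htop0]
    exact HorizontalAtlas.LeafwiseAt.map 𝔄.continuous_proj (𝓘.H 1).continuous 𝓘.preserves.1
      𝓘.preserves.2 (leafwiseAt (F := fun f : Framed 𝔄 ℋ => f) continuous_id f)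
  obtain ⟨F₂, a₂, k1, k2, k3, k4, k5⟩ := exists_lift (𝔄 := 𝔄) (ℋ := ℋ) (A := Framed 𝔄 ℋ)
    (Q := fun x => 𝓘.H (σ x.1) (x.2 0))
    (𝓘.continuous.comp ((unitInterval.continuous_symm.comp continuous_fst).prodMk
      (hc.comp continuous_snd))) htop
    (a₀ := fun _ => 0) continuous_const (fun x => by simp [htop0])
  exact ⟨⟨F₁, a₁, top, F₂, a₂, h1, h2, h3, h4, h5, htop, fun f => isShift_shift _ _ (hmem f),
    k1, k2, k3, k4, k5⟩⟩

variable (D : IsotopyLift 𝔄 ℋ H)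

/-- The forward lift read backwards and the reversed lift cover the same track, and at the start
they differ by the rotation that defines `top`. -/
theorem isShift_path (f : Framed 𝔄 ℋ) (t : I) :
    IsShift (D.F₁ (σ t, f)) (D.F₂ (t, f)) ((D.a₁ (σ t, f) - D.a₂ (t, f) : ℝ)) := by
  have c1 := D.continuous_F₁
  have c2 := D.continuous_F₂
  refine lift_isShift (F := fun t => D.F₁ (σ t, f)) (F' := fun t => D.F₂ (t, f))
    (a := fun t => D.a₁ (σ t, f)) (a' := fun t => D.a₂ (t, f)) (by fun_prop) (by fun_prop)
    (fun t => ?_) 0 ?_ t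
  · rw [← D.lift₁, ← D.lift₂]
  · refine ⟨(D.a₁ (1, f) : ℝ), ?_⟩
    rw [unitInterval.symm_zero, D.F₂_zero]
    exact D.isShift_top f

/-- At the end of the reversed lift the point `f 0` has height `a₂` in the returned frame, so that
frame starts at `-a₂` in `f`; hence the sign in `disp`. -/
theorem isShift_ret (f : Framed 𝔄 ℋ) : IsShift f (D.ret f) (D.disp f) := by
  have := D.isShift_path f 1
  rwa [unitInterval.symm_one, D.F₁_zero, D.a₁_zero, zero_sub] at this

/-- The link with `h`: during the reversed lift the starting point only slides along the leaf of the
image. -/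
theorem joined_ret (f : Framed 𝔄 ℋ) : ℋ.Joined (H 1 (f 0)) (D.ret f 0) := by
  have := 𝔄.compactSpace
  have c2 := D.continuous_F₂
  have h := HorizontalAtlas.joined_of_leafwise (A := I) (m := fun t => D.F₂ (t, f) 0)
    𝔄.continuous_proj (fun t => leafwiseAt (F := fun t => D.F₂ (t, f)) (by fun_prop) t) 0 1
  rwa [D.F₂_zero, D.top_zero] at h

/-- Reversing frames and negating heights turns lifts into lifts with the right initial values, so
uniqueness applies to both halves of the construction. -/
theorem ret_disp_rev (f : Framed 𝔄 ℋ) :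
    D.ret f.rev = (D.ret f).rev ∧ D.disp f.rev = -D.disp f := by
  have c1 := D.continuous_F₁
  have c2 := D.continuous_F₂
  have d1 := D.continuous_a₁
  have d2 := D.continuous_a₂
  have cr := continuous_rev (𝔄 := 𝔄) (ℋ := ℋ)
  have hrev0 : f.rev 0 = f 0 := by rw [rev_apply, neg_zero]
  have hneg : ∀ (k : Framed 𝔄 ℋ) (a : ℝ), k.rev ((-a : ℝ) : UnitAddCircle) = k a := fun k a => by
    rw [rev_apply, AddCircle.coe_neg, neg_neg]
  obtain ⟨h1, h2⟩ := lift_unique' (F := fun t => D.F₁ (t, f.rev))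
    (F' := fun t => (D.F₁ (t, f)).rev) (a := fun t => D.a₁ (t, f.rev))
    (a' := fun t => -D.a₁ (t, f)) (by fun_prop) (by fun_prop) (by fun_prop) (by fun_prop)
    (fun t => by rw [hneg, ← D.lift₁, ← D.lift₁, hrev0]) 0
    (by simp only [D.F₁_zero]) (by simp only [D.a₁_zero, neg_zero])
  have htop : D.top f.rev = (D.top f).rev := by
    refine ext_apply fun r => ?_
    have e1 := congrFun h1 1
    have e2 := congrFun h2 1
    rw [D.isShift_top f.rev, rev_apply, D.isShift_top f, e1, e2, rev_apply, AddCircle.coe_neg]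
    congr 1; abel
  obtain ⟨h3, h4⟩ := lift_unique' (F := fun t => D.F₂ (t, f.rev))
    (F' := fun t => (D.F₂ (t, f)).rev) (a := fun t => D.a₂ (t, f.rev))
    (a' := fun t => -D.a₂ (t, f)) (by fun_prop) (by fun_prop) (by fun_prop) (by fun_prop)
    (fun t => by rw [hneg, ← D.lift₂, ← D.lift₂, hrev0]) 0
    (by simp only [D.F₂_zero, htop]) (by simp only [D.a₂_zero, neg_zero])
  exact ⟨congrFun h3 1, congrArg Neg.neg (congrFun h4 1)⟩

end IsotopyLift

end

/-! ### Monotonicity and inverse of the return map -/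

section

open scoped unitInterval

variable {S : Type u} {M : Type v} [TopologicalSpace S] [TopologicalSpace M] {p : M → S}
  {Λ : Set M}

namespace IsotopyLift

open Framed

variable {𝔄 : FrameAtlas p} {ℋ : HorizontalAtlas p Λ}

variable [CompactSpace S] [T2Space S] [T2Space M] [LocallyConnectedSpace S]

/-- The displacement preserves the order of the points of the lamination on a fibre. -/
theorem disp_lt [SecondCountableTopology S] {𝓘 : LeafIsotopy ℋ}
    (D : IsotopyLift 𝔄 ℋ fun t x => 𝓘.H t x) {f f' : Framed 𝔄 ℋ} {s : ℝ} (hs : 0 < s)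
    (hf : IsShift f f' s) : D.disp f < s + D.disp f' := by
  have := 𝔄.compactSpace
  have c2 := D.continuous_F₂
  have d2 := D.continuous_a₂
  have cf : Continuous fun u : ℝ => f (u : UnitAddCircle) :=
    f.isFrame.continuous.comp (AddCircle.continuous_mk' 1)
  -- The image of the fibre under the end of the isotopy is lifted as a curve from `top f`, by
  -- scaling the parameter `u`; `K` and `κ` are its frame and height.
  obtain ⟨K', κ', hK', hκ', hQ, hK0, hκ0⟩ := exists_lift (𝔄 := 𝔄) (ℋ := ℋ) (A := ℝ)
    (Q := fun x => 𝓘.H 1 (f ((x.1 * x.2 : ℝ) : UnitAddCircle)))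
    ((𝓘.H 1).continuous.comp (cf.comp (by fun_prop))) (F₀ := fun _ => D.top f) continuous_const
    (a₀ := fun _ => 0) continuous_const (fun x => by
      simp only [Icc.coe_zero, zero_mul, AddCircle.coe_zero, D.top_zero])
  let K : ℝ → Framed 𝔄 ℋ := fun u => K' (1, u)
  let κ : ℝ → ℝ := fun u => κ' (1, u)
  have hK : Continuous K := hK'.comp (by fun_prop)
  have hκ : Continuous κ := hκ'.comp (by fun_prop)
  have hlift : ∀ u : ℝ, 𝓘.H 1 (f (u : UnitAddCircle)) = K u (κ u) := fun u => by
    have := hQ (1, u)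
    simpa using this
  have hconst := lift_unique' (F := fun t : I => K' (t, 0)) (F' := fun _ => D.top f)
    (a := fun t => κ' (t, 0)) (a' := fun _ => 0) (by fun_prop) continuous_const (by fun_prop)
    continuous_const (fun t => by
      rw [← hQ]; simp only [mul_zero, AddCircle.coe_zero, D.top_zero]) 0 (hK0 0) (hκ0 0)
  have hK00 : K 0 = D.top f := congrFun hconst.1 1
  have hκ00 : κ 0 = 0 := congrFun hconst.2 1
  -- the reversed isotopy moves the family of lifts to a constant family
  obtain ⟨E, e, hE, he, hEQ, hE0, he0⟩ := exists_lift (𝔄 := 𝔄) (ℋ := ℋ) (A := ℝ)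
    (Q := fun x => 𝓘.H (σ x.1) (f (x.2 : UnitAddCircle)))
    (𝓘.continuous.comp ((unitInterval.continuous_symm.comp continuous_fst).prodMk
      (cf.comp continuous_snd))) hK hκ (fun u => by
        rw [unitInterval.symm_zero]; exact hlift u)
  have hE1 : (fun t => E (t, 0)) = (fun t => D.F₂ (t, f)) ∧
      (fun t => e (t, 0)) = fun t => D.a₂ (t, f) :=
    lift_unique' (by fun_prop) (by fun_prop) (by fun_prop) (by fun_prop) (fun t => by
      rw [← hEQ, ← D.lift₂]; simp only [AddCircle.coe_zero]) 0
      (by rw [hE0, D.F₂_zero, hK00]) (by rw [he0, D.a₂_zero, hκ00])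
  have hret := D.isShift_ret f
  -- When the isotopy has been undone, the curve is the original fibre again, so its frame is
  -- constantly the returned frame and its height is `u - disp f`.
  have hE2 : (fun u => E (1, u)) = (fun _ => D.ret f) ∧
      (fun u => e (1, u)) = fun u => u - D.disp f := by
    refine lift_unique' (by fun_prop) (by fun_prop) (by fun_prop) (by fun_prop) (fun u => ?_) 0
      (congrFun hE1.1 1) ?_
    · rw [← hEQ, hret, AddCircle.coe_sub, add_sub_cancel]
      simp [𝓘.zero]
    · have := congrFun hE1.2 1
      simp only [disp] at this ⊢
      rw [this]; ring
  have hEu : ∀ u, E (1, u) = D.ret f := congrFun hE2.1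
  have heu : ∀ u, e (1, u) = u - D.disp f := congrFun hE2.2
  -- the height is one after a full turn
  have hκ1 : κ 1 = 1 := by
    -- The parameters `0` and `1` have the same track, so their heights differ by a constant
    -- integer, which is read at the end of the reversed isotopy.
    have h := lift_unique (F := fun t => E (t, 1)) (F' := fun t => E (t, 0))
      (a := fun t => e (t, 1)) (a' := fun t => e (t, 0)) (by fun_prop) (by fun_prop)
      (by fun_prop) (by fun_prop) (fun t => by
        rw [← hEQ, ← hEQ]; simp only [AddCircle.coe_period, AddCircle.coe_zero]) 1
      (by rw [hEu, hEu])
    obtain ⟨-, n, hn⟩ := h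
    have h1 := hn 1
    rw [heu, heu] at h1
    have h2 := hn 0
    rw [he0, he0, hκ00] at h2
    linarith
  -- the height does not vanish elsewhere
  have hκne : ∀ u, κ u = 0 → u = 0 := by
    intro u₀ hu₀
    -- Push the image curve down its fibres to height zero and pull back by the inverse
    -- homeomorphism. The result is leafwise, so its height over `f` is constantly zero; where `κ`
    -- vanishes nothing was pushed and that height is the parameter itself.
    obtain ⟨Φ, ρ, hΦ, hρ, hRQ, hΦ0, hρ0⟩ := exists_lift (𝔄 := 𝔄) (ℋ := ℋ) (A := ℝ)
      (Q := fun x => (𝓘.H 1).symm (K x.2 (((1 - x.1) * κ x.2 : ℝ) : UnitAddCircle)))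
      ((𝓘.H 1).symm.continuous.comp (continuous_apply (hK.comp continuous_snd)
        ((AddCircle.continuous_mk' 1).comp (by fun_prop)))) (F₀ := fun _ => f) continuous_const
      (a₀ := id) continuous_id (fun u => by
        simp only [Icc.coe_zero, sub_zero, one_mul, ← hlift]; simp)
    have hcon : ∀ u, κ u = 0 → ρ (1, u) = u := fun u hu => by
      have h := lift_unique' (F := fun t : I => Φ (t, u)) (F' := fun _ => f)
        (a := fun t => ρ (t, u)) (a' := fun _ => u) (by fun_prop) continuous_const (by fun_prop)
        continuous_const (fun t => by
          rw [← hRQ, hu, mul_zero]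
          have h1 := hlift u
          rw [hu] at h1
          rw [← h1]; simp) 0 (hΦ0 u) (hρ0 u)
      exact congrFun h.2 1
    have hz := lift_eq_zero (F := fun u => Φ (1, u)) (by fun_prop) (a := fun u => ρ (1, u))
      (by fun_prop) (m := fun u => (𝓘.H 1).symm (K u 0)) (fun u =>
        HorizontalAtlas.LeafwiseAt.map 𝔄.continuous_proj (𝓘.H 1).symm.continuous
          𝓘.preserves_symm.1 𝓘.preserves_symm.2 (leafwiseAt hK u))
      (fun u => by rw [← hRQ]; simp) 0 (hcon 0 hκ00) u₀
    rw [← hcon u₀ hu₀, hz]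
  have hκs : 0 < κ s := by
    by_contra! hle
    -- If the height were nonpositive at `s`, it would vanish somewhere between `s` and `1`, away
    -- from zero.
    have hmem : (0 : ℝ) ∈ κ '' uIcc s 1 :=
      intermediate_value_uIcc hκ.continuousOn (by
        rw [hκ1]; exact mem_uIcc.2 (Or.inl ⟨hle, zero_le_one⟩))
    obtain ⟨u, hu, hu0⟩ := hmem
    have := hκne u hu0
    subst this
    rcases mem_uIcc.1 hu with h | h <;> linarith [h.1, h.2]
  -- compare the two lifts of the track of the shifted point
  have hf0 : f' 0 = f s := hf.zero
  have heq : ∀ t, E (t, s) (e (t, s)) = D.F₂ (t, f') (D.a₂ (t, f')) := fun t => by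
    rw [← hEQ, ← D.lift₂]; simp only [hf0]
  have hsh := lift_isShift (F := fun t => E (t, s)) (F' := fun t => D.F₂ (t, f'))
    (a := fun t => e (t, s)) (a' := fun t => D.a₂ (t, f')) (by fun_prop) (by fun_prop) heq 1
    ⟨_, by
      rw [hEu]
      exact (hret.symm.trans hf).trans (D.isShift_ret f')⟩ 0
  -- Lifts of one track never cross, so positivity of `κ s` at the start gives the inequality of
  -- heights at the end of the reversed isotopy.
  have hlt := lift_lt (F := fun t => E (t, s)) (F' := fun t => D.F₂ (t, f'))
    (a := fun t => e (t, s)) (a' := fun t => D.a₂ (t, f')) (by fun_prop) (by fun_prop)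
    (by fun_prop) (by fun_prop) heq 0 ⟨_, hsh⟩ (by rw [he0, D.a₂_zero]; exact hκs) 1
  rw [heu] at hlt
  simp only [disp] at hlt ⊢
  linarith

/-- The return map of the inverse isotopy is the inverse of the return map. -/
theorem ret_ret_symm {H H' : I → M → M}
    (D : IsotopyLift 𝔄 ℋ H) (D' : IsotopyLift 𝔄 ℋ H')
    (hH : ∀ t x, H' t (H 1 x) = H (σ t) x) (f : Framed 𝔄 ℋ) :
    D'.ret (D.ret f) = f := by
  have c1 := D.continuous_F₁
  have c2 := D.continuous_F₂
  have d1 := D.continuous_a₁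
  have d2 := D.continuous_a₂
  have c1' := D'.continuous_F₁
  have c2' := D'.continuous_F₂
  have d1' := D'.continuous_a₁
  have d2' := D'.continuous_a₂
  -- The forward lift of the inverse isotopy from `top f` is the reversed lift of the original one.
  -- Consequently the second construction takes `top f` back to `f`.
  have e1 : (fun t => D'.F₁ (t, D.top f)) = (fun t => D.F₂ (t, f)) ∧
      (fun t => D'.a₁ (t, D.top f)) = fun t => D.a₂ (t, f) :=
    lift_unique' (by fun_prop) (by fun_prop) (by fun_prop) (by fun_prop) (fun t => by
      rw [← D'.lift₁, ← D.lift₂, D.top_zero]; exact hH _ _) 0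
      (by rw [D'.F₁_zero, D.F₂_zero]) (by rw [D'.a₁_zero, D.a₂_zero])
  have htop : D'.top (D.top f) = f := by
    refine IsShift.unique (D'.isShift_top _) ?_
    have h1 : D'.F₁ (1, D.top f) = D.ret f := congrFun e1.1 1
    have h2 : D'.a₁ (1, D.top f) = -D.disp f := by
      rw [disp, neg_neg]; exact congrFun e1.2 1
    rw [h1, h2, AddCircle.coe_neg]
    exact (D.isShift_ret f).symm
  have e2 : (fun t => D'.F₂ (t, D.top f)) = (fun t => D.F₁ (t, f)) ∧
      (fun t => D'.a₂ (t, D.top f)) = fun t => D.a₁ (t, f) :=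
    lift_unique' (by fun_prop) (by fun_prop) (by fun_prop) (by fun_prop) (fun t => by
      rw [← D'.lift₂, ← D.lift₁]
      simp only [D.top_zero, hH, unitInterval.symm_symm]) 0
      (by rw [D'.F₂_zero, D.F₁_zero, htop]) (by rw [D'.a₂_zero, D.a₁_zero])
  have cr := D'.continuous_ret
  have hsh : ∀ t, IsShift (D.F₂ (t, f)) (D.F₁ (σ t, f))
      ((D.a₂ (t, f) - D.a₁ (σ t, f) : ℝ)) := fun t => by
    have := (D.isShift_path f t).symm
    rwa [← AddCircle.coe_neg, neg_sub] at this
  -- Apply the second return map along the reversed lift: the resulting path covers the original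
  -- track read backwards and agrees with the forward lift at one end, hence also at the other.
  have e3 : (fun t => D'.ret (D.F₂ (t, f))) = fun t => D.F₁ (σ t, f) := by
    refine isCoveringMap_proj.eq_of_comp_eq (by fun_prop) (by fun_prop) (funext fun t => ?_) 0 ?_
    · show (D'.ret _).proj = (D.F₁ _).proj
      rw [(D'.isShift_ret _).proj_eq, (hsh t).proj_eq]
    · rw [D.F₂_zero, unitInterval.symm_zero]; exact congrFun e2.1 1
  have := congrFun e3 1
  simp only [unitInterval.symm_one, D.F₁_zero] at this
  exact this

end IsotopyLift

end

/-! ### Return maps as order automorphisms of closed sets of heights -/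

section

open scoped unitInterval

section OrderIso

variable {X : Set ℝ}

/-- An order automorphism of a closed set of reals with a bounded increasing orbit has a fixed
point. -/
theorem OrderIso.exists_fixed_of_bounded (hX : IsClosed X) (B : X ≃o X) {x y : X} (hx : x < B x)
    (hy : ∀ n : ℕ, B^[n] x ≤ y) : ∃ z, B z = z := by
  set Y : Set ℝ := range fun n : ℕ => ((B^[n] x : X) : ℝ)
  have hne : Y.Nonempty := range_nonempty _
  have hbd : BddAbove Y := ⟨y, by rintro _ ⟨n, rfl⟩; exact hy n⟩
  -- The supremum of the orbit lies in the closed set, and it is the fixed point.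
  have hs : sSup Y ∈ X := hX.closure_subset_iff.2
    (by rintro _ ⟨n, rfl⟩; exact (B^[n] x).2) (csSup_mem_closure hne hbd)
  have hle : ∀ n, B^[n] x ≤ ⟨sSup Y, hs⟩ := fun n => le_csSup hbd ⟨n, rfl⟩
  have hlub : ∀ w : X, (∀ n, B^[n] x ≤ w) → ⟨sSup Y, hs⟩ ≤ w := fun w hw =>
    csSup_le hne (by rintro _ ⟨n, rfl⟩; exact hw n)
  have hmono : ∀ n, B^[n] x ≤ B^[n + 1] x := fun n => by
    rw [Function.iterate_succ_apply]
    exact (B.monotone.iterate n) hx.le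
  refine ⟨⟨sSup Y, hs⟩, le_antisymm ?_ ?_⟩
  · rw [← B.le_symm_apply]
    refine hlub _ fun n => ?_
    rw [B.le_symm_apply, ← Function.iterate_succ_apply' B]
    exact hle _
  · refine hlub _ fun n => (hmono n).trans ?_
    rw [Function.iterate_succ_apply']
    exact B.monotone (hle n)

/-- A fixed point free order automorphism of a closed set of reals moves all points in the same
direction. -/
theorem OrderIso.lt_apply_of_lt_apply (hX : IsClosed X) (B : X ≃o X) (hB : ∀ z, B z ≠ z) {x : X}
    (hx : x < B x) (y : X) : y < B y := by
  by_contra! hle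
  have hy : B y < y := lt_of_le_of_ne hle (hB y)
  -- Points moving in opposite directions trap an orbit of the automorphism or of its inverse, which
  -- forces a fixed point.
  rcases le_total x y with hxy | hxy
  · obtain ⟨z, hz⟩ := B.exists_fixed_of_bounded hX hx (y := y) fun n => by
      induction n with
      | zero => exact hxy
      | succ n ih =>
        rw [Function.iterate_succ_apply']
        exact (B.monotone ih).trans hy.le
    exact hB z hz
  · have hx' : B.symm x < x := by rwa [B.symm_apply_lt]
    have hy' : y < B.symm y := by rwa [B.lt_symm_apply]
    obtain ⟨z, hz⟩ := B.symm.exists_fixed_of_bounded hX hy' (y := x) fun n => by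
      induction n with
      | zero => exact hxy
      | succ n ih =>
        rw [Function.iterate_succ_apply']
        exact (B.symm.monotone ih).trans hx'.le
    exact hB z (B.symm_apply_eq.1 hz).symm

/-- An order automorphism with a dense set of fixed points is the identity. -/
theorem OrderIso.apply_eq_of_dense (B : X ≃o X)
    (hd : ∀ z : X, ∀ a b : ℝ, a < z → z < b → ∃ w : X, a < w ∧ w < b ∧ B w = w) (z : X) :
    B z = z := by
  have key : ∀ C : X ≃o X, (∀ z : X, ∀ a b : ℝ, a < z → z < b → ∃ w : X, a < w ∧ w < b ∧ C w = w) →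
      ¬ z < C z := by
    intro C hC hz
    -- A fixed point between the preimage and the image of `z` would lie both above and below `z`.
    have hz' : C.symm z < z := by rwa [C.symm_apply_lt]
    obtain ⟨w, h1, h2, h3⟩ := hC z (C.symm z) (C z) hz' hz
    have h1' : C.symm z < w := h1
    have h2' : w < C z := h2
    rw [C.symm_apply_lt, h3] at h1'
    rw [← h3] at h2'
    exact lt_asymm h1' (C.lt_iff_lt.1 h2')
  rcases lt_trichotomy z (B z) with h | h | h
  · exact absurd h (key B hd)
  · exact h.symm
  · have h' : z < B.symm z := by rwa [B.lt_symm_apply]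
    refine absurd h' (key B.symm fun z a b ha hb => ?_)
    obtain ⟨w, h1, h2, h3⟩ := hd z a b ha hb
    exact ⟨w, h1, h2, by rw [B.symm_apply_eq, h3]⟩

end OrderIso

variable {S : Type u} {M : Type v} [TopologicalSpace S] [TopologicalSpace M] {p : M → S}
  {Λ : Set M}

/-- A map of the space of framed points which moves the points along the fibres, monotonically on
each fibre. -/
structure ReturnMap (𝔄 : FrameAtlas p) (ℋ : HorizontalAtlas p Λ) [CompactSpace S] [T2Space S]
    [T2Space M] [LocallyConnectedSpace S] where
  /-- the map -/
  ret : Framed 𝔄 ℋ → Framed 𝔄 ℋ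
  /-- the displacement along the fibres -/
  disp : Framed 𝔄 ℋ → ℝ
  continuous_ret : Continuous ret
  continuous_disp : Continuous disp
  isShift : ∀ f, Framed.IsShift f (ret f) (disp f)
  lt : ∀ (f f' : Framed 𝔄 ℋ) (s : ℝ), 0 < s → Framed.IsShift f f' s → disp f < s + disp f'
  rev : ∀ f, ret f.rev = (ret f).rev
  surj : ∀ f, ∃ f', ret f' = f

namespace Framed

variable {𝔄 : FrameAtlas p} {ℋ : HorizontalAtlas p Λ}

/-- The positions of the points of the lamination in the universal cover of a fibre. -/
def heights (f : Framed 𝔄 ℋ) : Set ℝ := {s | f s ∈ Λ}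

theorem isClosed_heights (f : Framed 𝔄 ℋ) : IsClosed f.heights :=
  ℋ.isClosed.preimage (f.isFrame.continuous.comp (AddCircle.continuous_mk' 1))

/-- The position of the starting point. -/
def zeroHeight (f : Framed 𝔄 ℋ) : f.heights := ⟨0, by
  show f ((0 : ℝ) : UnitAddCircle) ∈ Λ
  rw [AddCircle.coe_zero]; exact f.mem⟩

theorem shift_zeroHeight (f : Framed 𝔄 ℋ) : f.shift _ (zeroHeight f).2 = f := by
  refine (isShift_shift f _ (zeroHeight f).2).unique ?_
  show IsShift f f ((0 : ℝ) : UnitAddCircle)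
  rw [AddCircle.coe_zero]; exact isShift_refl f

theorem exists_zero_eq {x : M} (hx : x ∈ Λ) : ∃ f : Framed 𝔄 ℋ, f 0 = x := by
  obtain ⟨i, hi⟩ := 𝔄.exists_mem_U (p x)
  have h := 𝔄.Fr_ang hi
  exact ⟨⟨fun r => 𝔄.Fr i (p x) (𝔄.ang i x + r), ⟨i, p x, _, hi, Or.inl fun r => rfl⟩, by
    simp only [add_zero]; rwa [h]⟩, by simp only [add_zero]; exact h⟩

theorem eq_or_eq_rev {f f' : Framed 𝔄 ℋ} (h : f 0 = f' 0) : f' = f ∨ f' = f.rev := by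
  obtain ⟨s, hs, h1⟩ := f.isFrame.eq_or_eq f'.isFrame (by rw [h])
  have hs0 : s = 0 := f.isFrame.injective (hs.trans h.symm)
  subst hs0
  rcases h1 with h1 | h1
  · exact Or.inl (ext_apply fun r => by rw [h1, zero_add])
  · exact Or.inr (ext_apply fun r => by rw [h1, zero_sub, rev_apply])

theorem rev_zero (f : Framed 𝔄 ℋ) : f.rev 0 = f 0 := by rw [rev_apply, neg_zero]

theorem rev_proj (f : Framed 𝔄 ℋ) : f.rev.proj = f.proj := by rw [proj, proj, rev_zero]

variable [CompactSpace S] [T2Space S] [T2Space M] [LocallyConnectedSpace S]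

/-- A leaf section lifts locally to sections of framed points, along which membership in `E` is
locally constant. Invariance under reversal makes membership depend on the starting point alone. -/
theorem joined_of_isClopen {E : Set (Framed 𝔄 ℋ)} (hE : IsClopen E) (hrev : ∀ f ∈ E, f.rev ∈ E)
    {x y : M} (h : ℋ.Joined x y) : (∀ f : Framed 𝔄 ℋ, f 0 = x → f ∈ E) ↔
      ∀ f : Framed 𝔄 ℋ, f 0 = y → f ∈ E := by
  induction h with
  | rel x y h =>
    obtain ⟨W, l, hl, b, hb, c, hc, rfl, rfl⟩ := h
    have key : ∀ x ∈ W, ∃ i : Sec 𝔄 ℋ, x ∈ i.1.1 ∧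
        ∀ᶠ y in 𝓝 x, y ∈ W ∧ y ∈ i.1.1 ∧ i.1.2 y 0 = l y := by
      intro x hx
      obtain ⟨f, hf⟩ := exists_zero_eq (𝔄 := 𝔄) (ℋ := ℋ) (hl.leafwiseAt x hx).mem
      have hfx : f.proj = x := by rw [proj, hf, hl.proj x hx]
      obtain ⟨V, hVo, hxV, -, hV⟩ := exists_sections (𝔄 := 𝔄) (ℋ := ℋ) x
      obtain ⟨i, hi, hix⟩ := hV f (by rwa [hfx])
      rw [hfx] at hix
      refine ⟨i, hi hxV, ?_⟩
      have h1 := (i.2.2 x (hi hxV)).2.1.eventuallyEq (hl.leafwiseAt x hx) (by rw [hix, hf]) (by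
        filter_upwards [hl.isOpen.mem_nhds hx, i.2.1.mem_nhds (hi hxV)] with y h1 h2
        rw [hl.proj y h1]; exact (i.2.2 y h2).1)
      filter_upwards [hl.isOpen.mem_nhds hx, i.2.1.mem_nhds (hi hxV), h1] with y h1 h2 h3
        using ⟨h1, h2, h3⟩
    have hD : ∀ (i : Sec 𝔄 ℋ) (y : S), i.1.2 y 0 = l y →
        ((∀ f : Framed 𝔄 ℋ, f 0 = l y → f ∈ E) ↔ i.1.2 y ∈ E) := by
      intro i y hy
      refine ⟨fun h => h _ hy, fun h f hf => ?_⟩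
      rcases eq_or_eq_rev (hy.trans hf.symm) with h1 | h1
      · rwa [h1]
      · rw [h1]; exact hrev _ h
    have hci : ∀ (i : Sec 𝔄 ℋ) (x : S), x ∈ i.1.1 → ContinuousAt i.1.2 x := fun i x hx =>
      continuousAt_iff_goodAt.2 (i.2.2 x hx).2
    let D : Set S := {x | x ∈ W ∧ ∀ f : Framed 𝔄 ℋ, f 0 = l x → f ∈ E}
    let D' : Set S := {x | x ∈ W ∧ ¬ ∀ f : Framed 𝔄 ℋ, f 0 = l x → f ∈ E}
    have hDo : IsOpen D := isOpen_iff_mem_nhds.2 fun x hx => by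
      obtain ⟨i, hi, hev⟩ := key x hx.1
      have h1 := hev.self_of_nhds
      filter_upwards [hev, (hci i x hi).eventually_mem
        (hE.2.mem_nhds ((hD i x h1.2.2).1 hx.2))] with y h2 h3
      exact ⟨h2.1, (hD i y h2.2.2).2 h3⟩
    have hDo' : IsOpen D' := isOpen_iff_mem_nhds.2 fun x hx => by
      obtain ⟨i, hi, hev⟩ := key x hx.1
      have h1 := hev.self_of_nhds
      filter_upwards [hev, (hci i x hi).eventually_mem
        (hE.1.isOpen_compl.mem_nhds (fun h => hx.2 ((hD i x h1.2.2).2 h)))] with y h2 h3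
      exact ⟨h2.1, fun h => h3 ((hD i y h2.2.2).1 h)⟩
    have hcov : W ⊆ D ∪ D' := fun x hx => by
      by_cases e : ∀ f : Framed 𝔄 ℋ, f 0 = l x → f ∈ E
      · exact Or.inl ⟨hx, e⟩
      · exact Or.inr ⟨hx, e⟩
    constructor
    · intro hbE
      by_contra hcon
      obtain ⟨x, -, h1, h2⟩ := hl.isPreconnected _ _ hDo hDo' hcov ⟨b, hb, hb, hbE⟩
        ⟨c, hc, hc, hcon⟩
      exact h2.2 h1.2
    · intro hbE
      by_contra hcon
      obtain ⟨x, -, h1, h2⟩ := hl.isPreconnected _ _ hDo hDo' hcov ⟨c, hc, hc, hbE⟩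
        ⟨b, hb, hb, hcon⟩
      exact h2.2 h1.2
  | refl => rfl
  | symm _ _ _ ih => exact ih.symm
  | trans _ _ _ _ _ ih ih' => exact ih.trans ih'

end Framed

namespace ReturnMap

open Framed

variable {𝔄 : FrameAtlas p} {ℋ : HorizontalAtlas p Λ} [CompactSpace S] [T2Space S]
    [T2Space M] [LocallyConnectedSpace S]

/-- The composition of return maps. -/
def comp (R' R : ReturnMap 𝔄 ℋ) : ReturnMap 𝔄 ℋ where
  ret f := R'.ret (R.ret f)
  disp f := R.disp f + R'.disp (R.ret f)
  continuous_ret := R'.continuous_ret.comp R.continuous_ret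
  continuous_disp := R.continuous_disp.add (R'.continuous_disp.comp R.continuous_ret)
  isShift f := by
    rw [AddCircle.coe_add]
    exact (R.isShift f).trans (R'.isShift _)
  lt f f' s hs h := by
    have h1 := R.lt f f' s hs h
    have h2 := R'.lt (R.ret f) (R.ret f') (s + R.disp f' - R.disp f) (by linarith) (by
      have := ((R.isShift f).symm.trans h).trans (R.isShift f')
      convert this using 1
      simp only [AddCircle.coe_add, AddCircle.coe_sub]; abel)
    linarith
  rev f := by rw [R.rev, R'.rev]
  surj f := by
    obtain ⟨f', rfl⟩ := R'.surj f
    obtain ⟨f'', rfl⟩ := R.surj f'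
    exact ⟨f'', rfl⟩

/-- The same map, with displacement changed by an integer. -/
def addInt (R : ReturnMap 𝔄 ℋ) (m : ℤ) : ReturnMap 𝔄 ℋ where
  ret := R.ret
  disp f := R.disp f + m
  continuous_ret := R.continuous_ret
  continuous_disp := R.continuous_disp.add continuous_const
  isShift f := by rw [UnitAddCircle.coe_add_int]; exact R.isShift f
  lt f f' s hs h := by have := R.lt f f' s hs h; linarith
  rev := R.rev
  surj := R.surj

/-- The identity, with zero displacement. -/
def one : ReturnMap 𝔄 ℋ where
  ret := id
  disp _ := 0
  continuous_ret := continuous_id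
  continuous_disp := continuous_const
  isShift f := by rw [AddCircle.coe_zero]; exact isShift_refl f
  lt f f' s hs h := by linarith
  rev _ := rfl
  surj f := ⟨f, rfl⟩

/-- The iterates. -/
def iter (R : ReturnMap 𝔄 ℋ) : ℕ → ReturnMap 𝔄 ℋ
  | 0 => one
  | n + 1 => R.comp (R.iter n)

variable (R : ReturnMap 𝔄 ℋ)

theorem iter_ret (n : ℕ) (f : Framed 𝔄 ℋ) : (R.iter n).ret f = R.ret^[n] f := by
  induction n with
  | zero => rfl
  | succ n ih => rw [Function.iterate_succ_apply', ← ih]; rfl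

theorem iter_zero_disp (f : Framed 𝔄 ℋ) : (R.iter 0).disp f = 0 := rfl

theorem iter_one_disp (f : Framed 𝔄 ℋ) : (R.iter 1).disp f = R.disp f := zero_add _

theorem iter_succ_disp (n : ℕ) (f : Framed 𝔄 ℋ) :
    (R.iter (n + 1)).disp f = (R.iter n).disp f + R.disp ((R.iter n).ret f) := rfl

theorem iter_add_disp (m n : ℕ) (f : Framed 𝔄 ℋ) :
    (R.iter (m + n)).disp f = (R.iter m).disp f + (R.iter n).disp ((R.iter m).ret f) := by
  induction n with
  | zero => rw [add_zero, iter_zero_disp, add_zero]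
  | succ n ih =>
    rw [← add_assoc, iter_succ_disp, ih, iter_succ_disp, iter_ret, iter_ret, iter_ret,
      add_assoc, ← Function.iterate_add_apply, add_comm n m]

/-- A frame is injective on the circle, so returning to it means a rotation by zero modulo one. -/
theorem disp_eq_int_iff (f : Framed 𝔄 ℋ) : R.ret f = f ↔ ∃ m : ℤ, R.disp f = m := by
  constructor
  · intro h
    have h1 := (R.isShift f).zero
    rw [h] at h1
    have h2 := f.isFrame.injective h1.symm
    rw [show (0 : UnitAddCircle) = ((0 : ℝ) : UnitAddCircle) by rw [AddCircle.coe_zero],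
      UnitAddCircle.coe_eq_coe_iff] at h2
    simpa using h2
  · rintro ⟨m, hm⟩
    have h := R.isShift f
    have h0 : ((m : ℝ) : UnitAddCircle) = 0 := by
      have := UnitAddCircle.coe_add_int 0 m
      rwa [zero_add, AddCircle.coe_zero] at this
    rw [hm, h0] at h
    exact h.eq

/-- The action of a return map on the positions of the points of the lamination. -/
def act (f : Framed 𝔄 ℋ) (s : f.heights) : f.heights :=
  ⟨s + R.disp (f.shift _ s.2), by
    have h := ((isShift_shift f _ s.2).trans (R.isShift (f.shift _ s.2))).zero
    rw [← AddCircle.coe_add] at h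
    show f _ ∈ Λ
    rw [← h]; exact (R.ret _).mem⟩

theorem strictMono_act (f : Framed 𝔄 ℋ) : StrictMono (R.act f) := by
  intro s t hst
  have hst' : (s : ℝ) < t := hst
  have h := R.lt (f.shift _ s.2) (f.shift _ t.2) (t - s) (by linarith) (by
    have := (isShift_shift f _ s.2).symm.trans (isShift_shift f _ t.2)
    convert this using 1
    simp only [AddCircle.coe_sub]; abel)
  show (s : ℝ) + _ < t + _
  linarith

theorem surjective_act (f : Framed 𝔄 ℋ) : Function.Surjective (R.act f) := by
  rintro ⟨s, hs⟩
  obtain ⟨f', hf'⟩ := R.surj (f.shift _ hs)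
  have h1 : IsShift f f' ((s - R.disp f' : ℝ) : UnitAddCircle) := by
    have h2 := R.isShift f'
    rw [hf'] at h2
    have := (isShift_shift f _ hs).trans h2.symm
    convert this using 1
    simp only [AddCircle.coe_sub]; abel
  have hmem : f ((s - R.disp f' : ℝ) : UnitAddCircle) ∈ Λ := by rw [← h1.zero]; exact f'.mem
  refine ⟨⟨s - R.disp f', hmem⟩, Subtype.ext ?_⟩
  have h3 : f.shift _ hmem = f' := (isShift_shift f _ hmem).unique h1
  show s - R.disp f' + R.disp (f.shift _ hmem) = s
  rw [h3]; ring

/-- The action on positions as an order isomorphism. -/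
noncomputable def actIso (f : Framed 𝔄 ℋ) : f.heights ≃o f.heights :=
  (R.strictMono_act f).orderIsoOfSurjective _ (R.surjective_act f)

theorem coe_actIso (f : Framed 𝔄 ℋ) (s : f.heights) :
    (R.actIso f s : ℝ) = s + R.disp (f.shift _ s.2) := rfl

theorem actIso_eq_iff (f : Framed 𝔄 ℋ) (s : f.heights) :
    R.actIso f s = s ↔ R.disp (f.shift _ s.2) = 0 := by
  rw [Subtype.ext_iff, coe_actIso, add_eq_left]

/-- A displacement without zeros has constant sign on each fibre. -/
theorem disp_pos_of_isShift (hne : ∀ f, R.disp f ≠ 0) {f f' : Framed 𝔄 ℋ} {s : ℝ}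
    (hf : IsShift f f' s) (h : 0 < R.disp f) : 0 < R.disp f' := by
  have hs : f (s : UnitAddCircle) ∈ Λ := by rw [← hf.zero]; exact f'.mem
  have h1 := (R.actIso f).lt_apply_of_lt_apply f.isClosed_heights
    (fun z hz => hne _ ((R.actIso_eq_iff f z).1 hz)) (x := zeroHeight f) (by
      show (zeroHeight f : ℝ) < _ + R.disp (f.shift _ (zeroHeight f).2)
      rw [shift_zeroHeight]; linarith) ⟨s, hs⟩
  have h2 : s < s + R.disp (f.shift _ hs) := h1
  rw [(isShift_shift f _ hs).unique hf] at h2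
  linarith

theorem act_iterate_zero (f : Framed 𝔄 ℋ) (n : ℕ) (s : f.heights) :
    (((R.actIso f)^[n] s : f.heights) : ℝ) = s + (R.iter n).disp (f.shift _ s.2) := by
  induction n with
  | zero => rw [iter_zero_disp, add_zero]; rfl
  | succ n ih =>
    rw [Function.iterate_succ_apply', coe_actIso, iter_succ_disp]
    have : f.shift _ ((R.actIso f)^[n] s).2 = (R.iter n).ret (f.shift _ s.2) := by
      refine (isShift_shift f _ _).unique ?_
      rw [ih, AddCircle.coe_add]
      exact (isShift_shift f _ s.2).trans ((R.iter n).isShift _)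
    rw [this, ih, add_assoc]

/-- If the displacements of the iterates are bounded, the displacement has a zero. -/
theorem exists_disp_eq_zero (f : Framed 𝔄 ℋ) (h : ∀ n, |(R.iter n).disp f| ≤ 1) :
    ∃ f', R.disp f' = 0 := by
  by_contra! hne
  have hB : ∀ z, R.actIso f z ≠ z := fun z hz => hne _ ((R.actIso_eq_iff f z).1 hz)
  -- The starting point after a full turn; it serves as the bound for the orbit of the starting
  -- point under the automorphism or its inverse.
  have h1mem : (1 : ℝ) ∈ f.heights := by
    show f ((1 : ℝ) : UnitAddCircle) ∈ Λ
    rw [AddCircle.coe_period]; exact f.mem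
  have hsh1 : f.shift _ h1mem = f := by
    refine (isShift_shift f _ h1mem).unique ?_
    rw [AddCircle.coe_period]; exact isShift_refl f
  have h0 : ((zeroHeight f : f.heights) : ℝ) = 0 := rfl
  rcases lt_or_gt_of_ne (hne f) with hlt | hgt
  · have hlt' : zeroHeight f < (R.actIso f).symm (zeroHeight f) := by
      rw [OrderIso.lt_symm_apply]
      show _ + R.disp (f.shift _ (zeroHeight f).2) < (zeroHeight f : ℝ)
      rw [shift_zeroHeight]; linarith
    obtain ⟨z, hz⟩ := (R.actIso f).symm.exists_fixed_of_bounded f.isClosed_heights hlt'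
      (y := ⟨1, h1mem⟩) fun n => by
        have hmono : StrictMono ((R.actIso f)^[n]) := (R.actIso f).strictMono.iterate n
        rw [← hmono.le_iff_le]
        have hinv : (R.actIso f)^[n] ((R.actIso f).symm^[n] (zeroHeight f)) = zeroHeight f :=
          Function.LeftInverse.iterate (R.actIso f).apply_symm_apply n _
        rw [hinv]
        show (zeroHeight f : ℝ) ≤ _
        rw [act_iterate_zero, hsh1, h0]
        show 0 ≤ 1 + _
        have := (abs_le.1 (h n)).1
        linarith
    exact hB z ((R.actIso f).symm_apply_eq.1 hz).symm
  · obtain ⟨z, hz⟩ := (R.actIso f).exists_fixed_of_bounded f.isClosed_heights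
      (x := zeroHeight f) (y := ⟨1, h1mem⟩) (by
        show (zeroHeight f : ℝ) < _ + R.disp (f.shift _ (zeroHeight f).2)
        rw [shift_zeroHeight]; linarith) fun n => by
          show _ ≤ (1 : ℝ)
          rw [act_iterate_zero, shift_zeroHeight, h0, zero_add]
          exact (abs_le.1 (h n)).2
    exact hB z hz

end ReturnMap

end

/-! ### Periodic points and the rotation number -/

section

open scoped unitInterval

variable {S : Type u} {M : Type v} [TopologicalSpace S] [TopologicalSpace M] {p : M → S}
  {Λ : Set M} {𝔄 : FrameAtlas p} {ℋ : HorizontalAtlas p Λ} [CompactSpace S] [T2Space S]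
    [T2Space M] [LocallyConnectedSpace S]

/-- Density of a leaf in the lamination becomes density inside the fibre by sliding nearby points
along plaques. -/
theorem HorizontalAtlas.exists_joined_fibre (𝔄 : FrameAtlas p) {x₀ x : M}
    (hx : x ∈ Λ) (hd : x ∈ closure {y | ℋ.Joined x₀ y}) (hΛ : ∀ y, ℋ.Joined x₀ y → y ∈ Λ)
    {N : Set M} (hN : N ∈ 𝓝 x) : ∃ y ∈ N, ℋ.Joined x₀ y ∧ p y = p x := by
  have := 𝔄.compactSpace
  obtain ⟨ψ, hψ, hxψ⟩ := ℋ.exists_mem_source x hx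
  have hx1 : (p x, (ψ x).2) = ψ x := by rw [← ℋ.fst_eq ψ hψ x hxψ]
  have hσ : ContinuousAt (fun y => ψ.symm (p x, (ψ y).2)) x := by
    refine ContinuousAt.comp (g := ψ.symm) (f := fun y => (p x, (ψ y).2)) ?_ ?_
    · rw [hx1]; exact ψ.continuousAt_symm (ψ.map_source hxψ)
    · exact continuousAt_const.prodMk (continuous_snd.continuousAt.comp (ψ.continuousAt hxψ))
  have hσx : ψ.symm (p x, (ψ x).2) = x := by rw [hx1, ψ.left_inv hxψ]
  obtain ⟨y, ⟨h1, h2⟩, h3⟩ := mem_closure_iff_nhds.1 hd _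
    (Filter.inter_mem
    (hσ.preimage_mem_nhds (t := N) (by
      show N ∈ 𝓝 (ψ.symm (p x, (ψ x).2))
      rw [hσx]; exact hN)) (ψ.open_source.mem_nhds hxψ))
  obtain ⟨h4, h5⟩ := joined_slide 𝔄.continuous_proj hψ hxψ (hΛ y h3) h2
  refine ⟨_, h1, h3.trans h4, ?_⟩
  rw [← ℋ.fst_eq ψ hψ _ (ψ.map_target h5), ψ.right_inv h5]

namespace ReturnMap

open Framed

variable (R : ReturnMap 𝔄 ℋ)

/-- A return map of a minimal lamination with a fixed point is the identity. -/
theorem ret_eq_self (hd : ∀ x ∈ Λ, Λ ⊆ closure {y | ℋ.Joined x y})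
    (hΛ : ∀ x ∈ Λ, ∀ y, ℋ.Joined x y → y ∈ Λ) {f₀ : Framed 𝔄 ℋ} (h0 : R.ret f₀ = f₀)
    (f : Framed 𝔄 ℋ) : R.ret f = f := by
  have hcomp : (proj : Framed 𝔄 ℋ → S) ∘ R.ret = proj ∘ id := funext fun f =>
    (R.isShift f).proj_eq
  -- The return map and the identity are two lifts of the projection to a covering, so they agree on
  -- an open and closed set.
  have hE : IsClopen {f | R.ret f = f} :=
    ⟨isCoveringMap_proj.isSeparatedMap.isClosed_eqLocus R.continuous_ret continuous_id hcomp,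
      isCoveringMap_proj.isLocalHomeomorph.isLocallyInjective.isOpen_eqLocus R.continuous_ret
        continuous_id hcomp⟩
  have hErev : ∀ f ∈ {f | R.ret f = f}, f.rev ∈ {f | R.ret f = f} := fun f hf => by
    show R.ret f.rev = f.rev
    rw [R.rev, show R.ret f = f from hf]
  have hleaf : ∀ g : Framed 𝔄 ℋ, ℋ.Joined (f₀ 0) (g 0) → R.ret g = g := fun g hg => by
    refine (joined_of_isClopen hE hErev hg).1 (fun f hf => ?_) g rfl
    rcases eq_or_eq_rev hf.symm with h | h
    · rw [h]; exact h0
    · rw [h]; exact hErev _ h0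
  have hdense : ∀ (z : f.heights) (a b : ℝ), a < z → z < b →
      ∃ w : f.heights, a < w ∧ w < b ∧ R.ret (f.shift _ w.2) = f.shift _ w.2 := by
    intro z a b haz hzb
    have hO : IsOpen ((fun r : ℝ => (r : UnitAddCircle)) '' Ioo a b) :=
      QuotientAddGroup.isOpenMap_coe _ isOpen_Ioo
    have hcl : IsClosed (f '' ((fun r : ℝ => (r : UnitAddCircle)) '' Ioo a b)ᶜ) :=
      (hO.isClosed_compl.isCompact.image f.isFrame.continuous).isClosed
    obtain ⟨y, hyN, hyj, hyp⟩ := HorizontalAtlas.exists_joined_fibre 𝔄 z.2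
      (hd _ f₀.mem z.2) (hΛ _ f₀.mem) (hcl.isOpen_compl.mem_nhds (by
        rintro ⟨r, hr, hrz⟩
        exact hr ⟨z, ⟨haz, hzb⟩, (f.isFrame.injective hrz).symm⟩))
    obtain ⟨r, hr⟩ := f.isFrame.exists_eq (m := y) (by rw [hyp]; exact f.isFrame.proj_eq _)
    have hrO : r ∈ (fun r : ℝ => (r : UnitAddCircle)) '' Ioo a b := by
      by_contra hcon
      exact hyN ⟨r, hcon, hr⟩
    obtain ⟨w, hw, rfl⟩ := hrO
    have hwΛ : f (w : UnitAddCircle) ∈ Λ := by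
      rw [show f (w : UnitAddCircle) = y from hr]; exact hΛ _ f₀.mem _ hyj
    refine ⟨⟨w, hwΛ⟩, hw.1, hw.2, hleaf _ ?_⟩
    rw [(isShift_shift f _ hwΛ).zero, show f (w : UnitAddCircle) = y from hr]
    exact hyj
  obtain ⟨w, -, -, hw⟩ := hdense (zeroHeight f) (-1) 1 (by show (-1 : ℝ) < 0; norm_num)
    (by show (0 : ℝ) < 1; norm_num)
  obtain ⟨m, hm⟩ := (R.disp_eq_int_iff _).1 hw
  have hR'w : (R.addInt (-m)).disp (f.shift _ w.2) = 0 := by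
    show R.disp _ + ((-m : ℤ) : ℝ) = 0
    rw [hm]; push_cast; ring
  -- After subtracting the integer at one fixed point, every other fixed point of the fibre has
  -- displacement zero: monotonicity in both directions around the circle puts the integer strictly
  -- between `-1` and `1`.
  have key : ∀ w' : f.heights, R.ret (f.shift _ w'.2) = f.shift _ w'.2 →
      (R.addInt (-m)).disp (f.shift _ w'.2) = 0 := by
    intro w' hw'
    obtain ⟨k, hk⟩ := ((R.addInt (-m)).disp_eq_int_iff _).1 hw'
    have hsh : IsShift (f.shift _ w.2) (f.shift _ w'.2)
        ((Int.fract ((w' : ℝ) - w) : ℝ) : UnitAddCircle) := by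
      have h1 := (isShift_shift f _ w.2).symm.trans (isShift_shift f _ w'.2)
      convert h1 using 1
      rw [← AddCircle.coe_neg, ← AddCircle.coe_add, UnitAddCircle.coe_eq_coe_iff]
      refine ⟨-⌊(w' : ℝ) - w⌋, ?_⟩
      rw [Int.fract]; push_cast; ring
    rcases (Int.fract_nonneg ((w' : ℝ) - w)).eq_or_lt with h0 | h0
    · rw [← h0, AddCircle.coe_zero] at hsh
      rw [hsh.eq, hR'w]
    · have h1 := (R.addInt (-m)).lt _ _ _ h0 hsh
      have h2 := (R.addInt (-m)).lt _ _ (1 - Int.fract ((w' : ℝ) - w))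
        (by linarith [Int.fract_lt_one ((w' : ℝ) - w)]) (by
          have := hsh.symm
          rwa [AddCircle.coe_sub, AddCircle.coe_period, zero_sub])
      rw [hR'w] at h1 h2
      have h3 := Int.fract_lt_one ((w' : ℝ) - w)
      rw [hk] at h1 h2 ⊢
      have h4 : (-1 : ℝ) < k := by linarith
      have h5 : (k : ℝ) < 1 := by linarith
      have h6 : -1 < k := by exact_mod_cast h4
      have h7 : k < 1 := by exact_mod_cast h5
      have : k = 0 := by omega
      rw [this]; simp
  have hid := ((R.addInt (-m)).actIso f).apply_eq_of_dense (fun z a b ha hb => by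
    obtain ⟨w', h1, h2, h3⟩ := hdense z a b ha hb
    exact ⟨w', h1, h2, ((R.addInt (-m)).actIso_eq_iff f w').2 (key w' h3)⟩) (zeroHeight f)
  rw [actIso_eq_iff, shift_zeroHeight] at hid
  exact ((R.addInt (-m)).disp_eq_int_iff f).2 ⟨0, by rw [hid]; simp⟩

section Rotation

variable {R}

theorem iter_disp_add_ne (hno : ∀ n, 1 ≤ n → ∀ f, R.ret^[n] f ≠ f) {n : ℕ} (hn : 1 ≤ n) (m : ℤ)
    (f : Framed 𝔄 ℋ) : (R.iter n).disp f + m ≠ 0 := by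
  intro h
  refine hno n hn f ?_
  rw [← iter_ret, disp_eq_int_iff]
  exact ⟨-m, by push_cast; linarith⟩

theorem _root_.Framed.exists_path [PathConnectedSpace S] (f : Framed 𝔄 ℋ) (b : S) :
    ∃ Γ : I → Framed 𝔄 ℋ, Continuous Γ ∧ Γ 0 = f ∧ (Γ 1).proj = b := by
  obtain ⟨γ⟩ := PathConnectedSpace.joined f.proj b
  have cov := isCoveringMap_proj (𝔄 := 𝔄) (ℋ := ℋ)
  refine ⟨cov.liftPath γ.toContinuousMap f γ.source, ContinuousMap.continuous _,
    cov.liftPath_zero _ _ _, ?_⟩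
  have := congrFun (cov.liftPath_lifts γ.toContinuousMap f γ.source) 1
  exact this.trans γ.target

theorem pos_of_ne_zero {A : Type*} [TopologicalSpace A] [PreconnectedSpace A] {c : A → ℝ}
    (hc : Continuous c) (hne : ∀ x, c x ≠ 0) {x : A} (hx : 0 < c x) (y : A) : 0 < c y := by
  by_contra! hle
  obtain ⟨z, hz⟩ := mem_range_of_exists_le_of_exists_ge hc (c := 0) ⟨y, hle⟩ ⟨x, hx.le⟩
  exact hne z hz

theorem disp_ne_zero (hno : ∀ n, 1 ≤ n → ∀ f, R.ret^[n] f ≠ f) (f : Framed 𝔄 ℋ) :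
    R.disp f ≠ 0 := by
  have := iter_disp_add_ne hno le_rfl 0 f
  rwa [iter_one_disp, Int.cast_zero, add_zero] at this

/-- The quantity never vanishes, so its sign persists along a path from `f` to the fibre of `f'`,
and then along that fibre. The path cannot arrive with the reversed orientation, since the
displacement would have the wrong sign. -/
theorem iter_disp_pos [PathConnectedSpace S] (hno : ∀ n, 1 ≤ n → ∀ f, R.ret^[n] f ≠ f)
    (hrev : ∀ f, R.disp f.rev = -R.disp f) {f f' : Framed 𝔄 ℋ} (hf : 0 < R.disp f)
    (hf' : 0 < R.disp f') {n : ℕ} (hn : 1 ≤ n) {m : ℤ} (h : 0 < (R.iter n).disp f + m) :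
    0 < (R.iter n).disp f' + m := by
  obtain ⟨Γ, hΓ, hΓ0, hΓ1⟩ := f.exists_path f'.proj
  have hc := (R.iter n).continuous_disp
  have hc' := R.continuous_disp
  have h1 : 0 < (R.iter n).disp (Γ 1) + m := pos_of_ne_zero
    (c := fun t => (R.iter n).disp (Γ t) + m) (by fun_prop)
    (fun t => iter_disp_add_ne hno hn m _) (x := 0) (by rwa [hΓ0]) 1
  have h2 : 0 < R.disp (Γ 1) := pos_of_ne_zero (c := fun t => R.disp (Γ t)) (by fun_prop)
    (fun t => disp_ne_zero hno _) (x := 0) (by rwa [hΓ0]) 1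
  have hne : ∀ f, ((R.iter n).addInt m).disp f ≠ 0 := fun f => iter_disp_add_ne hno hn m f
  rcases isShift_or_rev (Γ 1) f' hΓ1.symm with ⟨s, hs⟩ | ⟨s, hs⟩
  · obtain ⟨s, rfl⟩ := UnitAddCircle.exists_coe s
    exact ((R.iter n).addInt m).disp_pos_of_isShift hne hs h1
  · obtain ⟨s, rfl⟩ := UnitAddCircle.exists_coe s
    have := R.disp_pos_of_isShift (disp_ne_zero hno) hs h2
    rw [hrev] at this
    linarith

theorem disp_ret_pos (hno : ∀ n, 1 ≤ n → ∀ f, R.ret^[n] f ≠ f) {f : Framed 𝔄 ℋ}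
    (hf : 0 < R.disp f) (n : ℕ) : 0 < R.disp ((R.iter n).ret f) :=
  R.disp_pos_of_isShift (disp_ne_zero hno) ((R.iter n).isShift f) hf

/-- The rotation number of a return map without periodic points. -/
theorem exists_rotation_number [PathConnectedSpace S]
    (hno : ∀ n, 1 ≤ n → ∀ f, R.ret^[n] f ≠ f) (hrev : ∀ f, R.disp f.rev = -R.disp f)
    {f₀ : Framed 𝔄 ℋ} (hf₀ : 0 < R.disp f₀) :
    ∃ α : ℝ, (∀ n : ℕ, 1 ≤ n → ∀ m : ℤ, n * α + m ≠ 0) ∧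
      ∀ f, 0 < R.disp f → ∀ (n : ℕ) (m : ℤ), 0 < (R.iter n).disp f + m ↔ 0 < n * α + m := by
  set d : ℕ → Framed 𝔄 ℋ → ℝ := fun n f => (R.iter n).disp f with hd
  set k : ℕ → ℤ := fun n => ⌊d n f₀⌋ with hk
  -- The integer part of the displacement of the `n`-th iterate is the same at all positively
  -- oriented framed points.
  have hkd : ∀ f, 0 < R.disp f → ∀ n, 1 ≤ n → k n < d n f ∧ d n f < k n + 1 := by
    intro f hf n hn
    have h1 : (k n : ℝ) < d n f₀ := lt_of_le_of_ne (Int.floor_le _) fun h =>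
      iter_disp_add_ne hno hn (-k n) f₀ (by
        show d n f₀ + _ = 0
        rw [← h]; push_cast; ring)
    constructor
    · have := iter_disp_pos hno hrev hf₀ hf hn (m := -k n) (by
        show 0 < d n f₀ + _
        push_cast; linarith)
      push_cast at this
      show (k n : ℝ) < (R.iter n).disp f
      linarith
    · by_contra! hle
      have hne := iter_disp_add_ne hno hn (-(k n + 1)) f
      have hlt : 0 < (R.iter n).disp f + ((-(k n + 1) : ℤ) : ℝ) := by
        refine lt_of_le_of_ne ?_ hne.symm
        push_cast
        have : (k n : ℝ) + 1 ≤ (R.iter n).disp f := hle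
        linarith
      have := iter_disp_pos hno hrev hf hf₀ hn hlt
      push_cast at this
      have h2 : d n f₀ < k n + 1 := Int.lt_floor_add_one _
      have h3 : d n f₀ = (R.iter n).disp f₀ := rfl
      linarith
  have hmul : ∀ n, 1 ≤ n → ∀ q : ℕ, q * (k n : ℝ) ≤ d (n * q) f₀ ∧
      (1 ≤ q → d (n * q) f₀ < q * ((k n : ℝ) + 1)) := by
    intro n hn q
    have hstep : ∀ q, d (n * (q + 1)) f₀ = d (n * q) f₀ + d n ((R.iter (n * q)).ret f₀) :=
      fun q => by rw [mul_add, mul_one]; exact R.iter_add_disp _ _ _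
    have hpos : ∀ q, 0 < R.disp ((R.iter (n * q)).ret f₀) := fun q => disp_ret_pos hno hf₀ _
    have h2 : ∀ q : ℕ, d (n * q) f₀ ≤ q * ((k n : ℝ) + 1) := fun q => by
      induction q with
      | zero => simp [hd, iter_zero_disp]
      | succ q ih =>
        rw [hstep]
        have := (hkd _ (hpos q) n hn).2
        push_cast
        linarith
    constructor
    · induction q with
      | zero => simp [hd, iter_zero_disp]
      | succ q ih =>
        rw [hstep]
        have := (hkd _ (hpos q) n hn).1
        push_cast
        linarith
    · intro hq
      obtain ⟨q, rfl⟩ := Nat.exists_eq_add_of_le' hq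
      rw [hstep]
      have := (hkd _ (hpos q) n hn).2
      have := h2 q
      push_cast
      linarith
  -- Estimate the displacement at time `n * n'` in two ways, from below by repeating time `n` and
  -- from above by repeating time `n'`.
  have hcross : ∀ n, 1 ≤ n → ∀ n', 1 ≤ n' → (k n : ℝ) / n < (k n' + 1) / n' := by
    intro n hn n' hn'
    have h1 := (hmul n hn n').1
    have h2 := (hmul n' hn' n).2 hn
    rw [mul_comm n' n] at h2
    rw [div_lt_div_iff₀ (by positivity) (by positivity)]
    linarith
  set α : ℝ := sSup {x | ∃ n : ℕ, 1 ≤ n ∧ x = k n / n} with hα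
  have hbdd : BddAbove {x : ℝ | ∃ n : ℕ, 1 ≤ n ∧ x = k n / n} := by
    refine ⟨(k 1 + 1) / (1 : ℕ), ?_⟩
    rintro _ ⟨n, hn, rfl⟩
    exact (hcross n hn 1 le_rfl).le
  have hα1 : ∀ n : ℕ, 1 ≤ n → (k n : ℝ) ≤ n * α ∧ n * α ≤ k n + 1 := by
    intro n hn
    have hn0 : (0 : ℝ) < n := by positivity
    constructor
    · have : (k n : ℝ) / n ≤ α := le_csSup hbdd ⟨n, hn, rfl⟩
      rw [div_le_iff₀ hn0] at this
      linarith
    · have : α ≤ (k n + 1) / n := csSup_le ⟨_, 1, le_rfl, rfl⟩ (by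
        rintro _ ⟨n', hn', rfl⟩
        exact (hcross n' hn' n hn).le)
      rw [le_div_iff₀ hn0] at this
      linarith
  -- If the rotation number were rational, a suitable iterate corrected by an integer would have all
  -- its iterated displacements bounded by one, hence a zero.
  have hirr : ∀ n : ℕ, 1 ≤ n → ∀ m : ℤ, n * α + m ≠ 0 := by
    intro n hn m hm
    obtain ⟨f', hf'⟩ := ((R.iter n).addInt m).exists_disp_eq_zero f₀ fun q => by
      have hiter : (((R.iter n).addInt m).iter q).ret f₀ = (R.iter (n * q)).ret f₀ ∧
          (((R.iter n).addInt m).iter q).disp f₀ = d (n * q) f₀ + q * m := by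
        induction q with
        | zero => exact ⟨rfl, by simp [hd, iter_zero_disp]⟩
        | succ q ih =>
          have e1 : (((R.iter n).addInt m).iter (q + 1)).ret f₀ =
              (R.iter n).ret ((((R.iter n).addInt m).iter q).ret f₀) := rfl
          have e2 : (((R.iter n).addInt m).iter (q + 1)).disp f₀ =
              (((R.iter n).addInt m).iter q).disp f₀ +
                ((R.iter n).disp ((((R.iter n).addInt m).iter q).ret f₀) + m) := rfl
          have e3 : d (n * (q + 1)) f₀ = d (n * q) f₀ + d n ((R.iter (n * q)).ret f₀) := by
            rw [mul_add, mul_one]; exact R.iter_add_disp _ _ _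
          constructor
          · rw [e1, ih.1, iter_ret, iter_ret, iter_ret, ← Function.iterate_add_apply,
              mul_add, mul_one, add_comm]
          · rw [e2, ih.2, ih.1, e3]
            push_cast
            simp only [hd]
            ring
      rw [hiter.2]
      rcases Nat.eq_zero_or_pos q with rfl | hq
      · simp [hd, iter_zero_disp]
      · have hnq : 1 ≤ n * q := Nat.mul_pos hn hq
        have h1 := hα1 _ hnq
        have h2 := hkd _ hf₀ _ hnq
        have h3 : ((n * q : ℕ) : ℝ) * α = -(q * m) := by
          push_cast
          have : (n : ℝ) * α = -m := by linarith
          calc (n : ℝ) * q * α = q * (n * α) := by ring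
            _ = -(q * m) := by rw [this]; ring
        rw [h3] at h1
        rw [abs_le]
        constructor <;> linarith
    exact iter_disp_add_ne hno hn m f' hf'
  refine ⟨α, hirr, fun f hf n m => ?_⟩
  rcases Nat.eq_zero_or_pos n with rfl | hn
  · simp [iter_zero_disp]
  · have h1 := hα1 n hn
    have h2 := hkd f hf n hn
    have h3 : (k n : ℝ) < n * α := lt_of_le_of_ne h1.1 fun h =>
      hirr n hn (-k n) (by rw [← h]; push_cast; ring)
    have h4 : n * α < k n + 1 := lt_of_le_of_ne h1.2 fun h =>
      hirr n hn (-(k n + 1)) (by rw [h]; push_cast; ring)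
    have h5 : d n f = (R.iter n).disp f := rfl
    rw [← h5]
    constructor
    · intro h
      have : (-m : ℝ) < k n + 1 := by linarith
      have : -m < k n + 1 := by exact_mod_cast this
      have : (-m : ℝ) ≤ k n := by exact_mod_cast Int.lt_add_one_iff.1 this
      linarith
    · intro h
      have : (-m : ℝ) < k n + 1 := by linarith
      have : -m < k n + 1 := by exact_mod_cast this
      have : (-m : ℝ) ≤ k n := by exact_mod_cast Int.lt_add_one_iff.1 this
      linarith

end Rotation

end ReturnMap

end

/-! ### The semiconjugacy to a rotation and its mean -/

section

open scoped unitInterval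

/-- Dirichlet approximation gives a nonzero step `β`, shorter than the interval, of the form `k * α
- j`; repeated steps from one side of the interval must enter it. The bound `N` allows finitely many
indices to be discarded. -/
theorem exists_nat_mul_add_int_mem_Ioo {α : ℝ} (hα : ∀ n : ℕ, 1 ≤ n → ∀ m : ℤ, n * α + m ≠ 0)
    (N : ℕ) {a b : ℝ} (hab : a < b) :
    ∃ (n : ℕ) (m : ℤ), N ≤ n ∧ a < n * α + m ∧ n * α + m < b := by
  obtain ⟨K, hK⟩ := exists_nat_one_div_lt (sub_pos.2 hab)
  obtain ⟨k, hk, -, hkK⟩ := Real.exists_nat_abs_mul_sub_round_le α (Nat.succ_pos K)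
  set j := round ((k : ℝ) * α)
  set β : ℝ := k * α - j with hβ
  have hβ0 : β ≠ 0 := by
    have := hα k hk (-j)
    push_cast at this
    rw [hβ]; intro h; exact this (by linarith)
  have hβlt : |β| < b - a := by
    refine lt_of_le_of_lt hkK (lt_of_le_of_lt ?_ hK)
    push_cast
    apply one_div_le_one_div_of_le <;> [positivity; linarith]
  rcases lt_or_gt_of_ne hβ0 with hneg | hpos
  · rw [abs_of_neg hneg] at hβlt
    set m : ℤ := ⌈b - N * α⌉ with hm
    have hmb : b ≤ N * α + m := by have := Int.le_ceil (b - N * α); linarith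
    set x := N * α + m - b with hx
    have hx0 : 0 ≤ x / (-β) := div_nonneg (by linarith) (by linarith)
    refine ⟨N + (⌊x / (-β)⌋₊ + 1) * k, m - (⌊x / (-β)⌋₊ + 1) * j, Nat.le_add_right _ _, ?_, ?_⟩
    all_goals
      have h1 := Nat.floor_le hx0
      have h2 := Nat.lt_floor_add_one (x / (-β))
      rw [le_div_iff₀ (by linarith)] at h1
      rw [div_lt_iff₀ (by linarith)] at h2
      push_cast
      have e : ((N : ℝ) + (⌊x / (-β)⌋₊ + 1) * k) * α + (m - (⌊x / (-β)⌋₊ + 1) * j) =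
          x + b + (⌊x / (-β)⌋₊ + 1) * β := by rw [hβ, hx]; ring
      rw [e]
      linarith
  · rw [abs_of_pos hpos] at hβlt
    set m : ℤ := ⌊a - N * α⌋ with hm
    have hmb : N * α + m ≤ a := by have := Int.floor_le (a - N * α); linarith
    set x := a - (N * α + m) with hx
    have hx0 : 0 ≤ x / β := div_nonneg (by linarith) (by linarith)
    refine ⟨N + (⌊x / β⌋₊ + 1) * k, m - (⌊x / β⌋₊ + 1) * j, Nat.le_add_right _ _, ?_, ?_⟩
    all_goals
      have h1 := Nat.floor_le hx0
      have h2 := Nat.lt_floor_add_one (x / β)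
      rw [le_div_iff₀ hpos] at h1
      rw [div_lt_iff₀ hpos] at h2
      push_cast
      have e : ((N : ℝ) + (⌊x / β⌋₊ + 1) * k) * α + (m - (⌊x / β⌋₊ + 1) * j) =
          a - x + (⌊x / β⌋₊ + 1) * β := by rw [hβ, hx]; ring
      rw [e]
      linarith

variable {S : Type u} {M : Type v} [TopologicalSpace S] [TopologicalSpace M] {p : M → S}
  {Λ : Set M} {𝔄 : FrameAtlas p} {ℋ : HorizontalAtlas p Λ} [CompactSpace S] [T2Space S]
    [T2Space M] [LocallyConnectedSpace S]

namespace ReturnMap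

open Framed

/-- The rotation number of a return map without periodic points. -/
structure IsRotation (R : ReturnMap 𝔄 ℋ) (α : ℝ) : Prop where
  ret_ne : ∀ n, 1 ≤ n → ∀ f, R.ret^[n] f ≠ f
  irr : ∀ n : ℕ, 1 ≤ n → ∀ m : ℤ, n * α + m ≠ 0
  pos_iff : ∀ f, 0 < R.disp f → ∀ (n : ℕ) (m : ℤ), 0 < (R.iter n).disp f + m ↔ 0 < n * α + m

/-- The semiconjugacy to the rotation. -/
noncomputable def conj (R : ReturnMap 𝔄 ℋ) (α : ℝ) (f : Framed 𝔄 ℋ) (s : ℝ) : ℝ :=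
  sSup {x | ∃ (n : ℕ) (m : ℤ), (R.iter n).disp f + m ≤ s ∧ x = n * α + m}

/-- The average height of the semiconjugacy. -/
noncomputable def mean (R : ReturnMap 𝔄 ℋ) (α : ℝ) (f : Framed 𝔄 ℋ) : ℝ :=
  ∫ u in (0 : ℝ)..1, R.conj α f u

namespace IsRotation

variable {R : ReturnMap 𝔄 ℋ} {α : ℝ} {f f' : Framed 𝔄 ℋ}

theorem disp_iter_pos (hR : R.IsRotation α) (hf : 0 < R.disp f) (n : ℕ) : 0 < R.disp ((R.iter n).ret f) :=
  disp_ret_pos hR.ret_ne hf n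

theorem neg_iff (hR : R.IsRotation α) (hf : 0 < R.disp f) (n : ℕ) (m : ℤ) :
    (R.iter n).disp f + m < 0 ↔ n * α + m < 0 := by
  rcases Nat.eq_zero_or_pos n with rfl | hn
  · simp [iter_zero_disp]
  · have h1 := iter_disp_add_ne hR.ret_ne hn m f
    have h2 := hR.irr n hn m
    have h3 := hR.pos_iff f hf n m
    constructor
    · intro h
      refine lt_of_le_of_ne (not_lt.1 fun h' => ?_) h2
      exact absurd (h3.2 h') (not_lt.2 h.le)
    · intro h
      refine lt_of_le_of_ne (not_lt.1 fun h' => ?_) h1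
      exact absurd (h3.1 h') (not_lt.2 h.le)

/-- The cocycle rule for iterates reduces the comparison to the sign of one displacement at a later
point of the orbit. Orbit heights are thus ordered exactly like their images under the rotation. -/
theorem lt_iff (hR : R.IsRotation α) (hf : 0 < R.disp f) (n n' : ℕ) (m m' : ℤ) :
    (R.iter n).disp f + m < (R.iter n').disp f + m' ↔ n * α + m < n' * α + m' := by
  rcases le_total n n' with h | h
  · obtain ⟨j, rfl⟩ := Nat.exists_eq_add_of_le h
    have h1 := hR.pos_iff _ (hR.disp_iter_pos hf n) j (m' - m)
    rw [iter_add_disp]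
    push_cast at h1 ⊢
    constructor
    · intro h; have := h1.1 (by linarith); linarith
    · intro h; have := h1.2 (by linarith); linarith
  · obtain ⟨j, rfl⟩ := Nat.exists_eq_add_of_le h
    have h1 := hR.neg_iff (hR.disp_iter_pos hf n') j (m - m')
    rw [iter_add_disp]
    push_cast at h1 ⊢
    constructor
    · intro h; have := h1.1 (by linarith); linarith
    · intro h; have := h1.2 (by linarith); linarith

theorem bddAbove (hR : R.IsRotation α) (hf : 0 < R.disp f) (s : ℝ) :
    BddAbove {x | ∃ (n : ℕ) (m : ℤ), (R.iter n).disp f + m ≤ s ∧ x = n * α + m} := by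
  refine ⟨(0 : ℕ) * α + ((⌊s⌋ + 1 : ℤ) : ℝ), ?_⟩
  rintro _ ⟨n, m, h, rfl⟩
  refine ((hR.lt_iff hf n 0 m (⌊s⌋ + 1)).1 ?_).le
  rw [iter_zero_disp]
  push_cast
  linarith [Int.lt_floor_add_one s]

theorem le_conj (hR : R.IsRotation α) (hf : 0 < R.disp f) {s : ℝ} {n : ℕ} {m : ℤ} (h : (R.iter n).disp f + m ≤ s) :
    n * α + m ≤ R.conj α f s := le_csSup (hR.bddAbove hf s) ⟨n, m, h, rfl⟩

theorem lt_of_lt_conj (hR : R.IsRotation α) (hf : 0 < R.disp f) {s : ℝ} {n : ℕ} {m : ℤ} (h : n * α + m < R.conj α f s) :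
    (R.iter n).disp f + m < s := by
  have hne : {x | ∃ (n : ℕ) (m : ℤ), (R.iter n).disp f + m ≤ s ∧ x = n * α + m}.Nonempty :=
    ⟨_, 0, ⌊s⌋, by rw [iter_zero_disp, zero_add]; exact Int.floor_le s, rfl⟩
  obtain ⟨_, ⟨n', m', h1, rfl⟩, h2⟩ := exists_lt_of_lt_csSup hne h
  exact ((hR.lt_iff hf n n' m m').2 h2).trans_le h1

/-- The numbers `n * α + m` with `n ≥ N` are dense, so a value is determined by its comparison with
them. Large `n` suffices, which permits the index shift in `conj_add_disp`. -/
theorem conj_eq (hR : R.IsRotation α) (hf : 0 < R.disp f) {s x : ℝ} (N : ℕ)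
    (h1 : ∀ (n : ℕ) (m : ℤ), N ≤ n → n * α + m < x → (R.iter n).disp f + m ≤ s)
    (h2 : ∀ (n : ℕ) (m : ℤ), N ≤ n → (R.iter n).disp f + m ≤ s → n * α + m ≤ x) :
    R.conj α f s = x := by
  refine le_antisymm (not_lt.1 fun h => ?_) (not_lt.1 fun h => ?_)
  · obtain ⟨n, m, hn, h3, h4⟩ := exists_nat_mul_add_int_mem_Ioo hR.irr N h
    exact absurd (h2 n m hn (hR.lt_of_lt_conj hf h4).le) (not_le.2 h3)
  · obtain ⟨n, m, hn, h3, h4⟩ := exists_nat_mul_add_int_mem_Ioo hR.irr N h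
    exact absurd (hR.le_conj hf (h1 n m hn h4)) (not_le.2 h3)

theorem conj_mono (hR : R.IsRotation α) (hf : 0 < R.disp f) : Monotone (R.conj α f) := by
  intro s t hst
  by_contra! h
  obtain ⟨n, m, -, h3, h4⟩ := exists_nat_mul_add_int_mem_Ioo hR.irr 0 h
  exact absurd (hR.le_conj hf ((hR.lt_of_lt_conj hf h4).le.trans hst)) (not_le.2 h3)

theorem conj_add_int (hR : R.IsRotation α) (hf : 0 < R.disp f) (s : ℝ) (k : ℤ) :
    R.conj α f (s + k) = R.conj α f s + k := by
  refine hR.conj_eq hf 0 (fun n m _ h => ?_) fun n m _ h => ?_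
  · have := hR.lt_of_lt_conj hf (s := s) (n := n) (m := m - k) (by push_cast; linarith)
    push_cast at this
    linarith
  · have := hR.le_conj hf (s := s) (n := n) (m := m - k) (by push_cast; linarith)
    push_cast at this
    linarith

/-- The iterates preserve the order between the orbit of `f` and the point at height `s`, so moving
that point by the `n`-th iterate shifts all comparisons by `n` indices. -/
theorem conj_add_disp (hR : R.IsRotation α) (hf : 0 < R.disp f) {s : ℝ} (hs : IsShift f f' s) (n : ℕ) :
    R.conj α f (s + (R.iter n).disp f') = R.conj α f s + n * α := by
  have hsh : ∀ (j : ℕ) (l : ℤ), IsShift ((R.iter j).ret f) f'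
      ((s - ((R.iter j).disp f + l) : ℝ) : UnitAddCircle) := fun j l => by
    have h := ((R.iter j).isShift f).symm.trans hs
    convert h using 1
    rw [← AddCircle.coe_neg, ← AddCircle.coe_add, UnitAddCircle.coe_eq_coe_iff]
    exact ⟨-l, by push_cast; ring⟩
  have key : ∀ (j : ℕ) (l : ℤ), (R.iter j).disp f + l ≤ s ↔
      (R.iter (n + j)).disp f + l ≤ s + (R.iter n).disp f' := by
    intro j l
    have hadd := R.iter_add_disp j n f
    rw [add_comm n j, hadd]
    rcases lt_trichotomy ((R.iter j).disp f + l) s with h | h | h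
    · have := (R.iter n).lt _ _ _ (sub_pos.2 h) (hsh j l)
      constructor <;> intro <;> linarith
    · have h1 := hsh j l
      rw [h, sub_self, AddCircle.coe_zero] at h1
      rw [h1.eq]
      constructor <;> intro <;> linarith
    · have h1 := (hsh j l).symm
      rw [← AddCircle.coe_neg, neg_sub] at h1
      have := (R.iter n).lt _ _ _ (sub_pos.2 h) h1
      constructor <;> intro <;> linarith
  refine hR.conj_eq hf n (fun j l hj h => ?_) fun j l hj h => ?_
  · obtain ⟨i, rfl⟩ := Nat.exists_eq_add_of_le hj
    refine (key i l).1 (hR.lt_of_lt_conj hf ?_).le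
    push_cast at h
    linarith
  · obtain ⟨i, rfl⟩ := Nat.exists_eq_add_of_le hj
    have := hR.le_conj hf ((key i l).2 h)
    push_cast
    linarith

theorem conj_shift (hR : R.IsRotation α) (hf : 0 < R.disp f) (hf' : 0 < R.disp f') {s : ℝ} (hs : IsShift f f' s)
    (t : ℝ) : R.conj α f' t = R.conj α f (s + t) - R.conj α f s := by
  have key : ∀ (n : ℕ) (m : ℤ), R.conj α f (s + ((R.iter n).disp f' + m)) =
      R.conj α f s + (n * α + m) := fun n m => by
    rw [← add_assoc, hR.conj_add_int hf, hR.conj_add_disp hf hs, add_assoc]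
  refine hR.conj_eq hf' 0 (fun n m _ h => ?_) fun n m _ h => ?_
  · by_contra! hlt
    have := hR.conj_mono hf (add_le_add_right hlt.le s)
    rw [key] at this
    linarith
  · have := hR.conj_mono hf (add_le_add_right h s)
    rw [key] at this
    linarith

variable {A : Type*} [TopologicalSpace A]

/-- Bounds on the semiconjugacy are strict inequalities between `θ` and continuous displacements, by
density of the numbers `n * α + m`; these are open conditions. -/
theorem continuous_conj (hR : R.IsRotation α) {F : A → Framed 𝔄 ℋ} (hF : Continuous F) (hpos : ∀ x, 0 < R.disp (F x))
    {θ : A → ℝ} (hθ : Continuous θ) : Continuous fun x => R.conj α (F x) (θ x) := by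
  have hd : ∀ n, Continuous fun x => (R.iter n).disp (F x) := fun n =>
    (R.iter n).continuous_disp.comp hF
  refine continuous_iff_continuousAt.2 fun x => tendsto_order.2 ⟨fun c hc => ?_, fun c hc => ?_⟩
  · obtain ⟨n, m, -, h1, h2⟩ := exists_nat_mul_add_int_mem_Ioo hR.irr 0 hc
    filter_upwards [((hd n).add continuous_const).continuousAt.eventually_lt hθ.continuousAt
      (hR.lt_of_lt_conj (hpos x) h2)] with y hy
    exact h1.trans_le (hR.le_conj (hpos y) (le_of_lt hy))
  · obtain ⟨n, m, -, h1, h2⟩ := exists_nat_mul_add_int_mem_Ioo hR.irr 0 hc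
    have h3 : θ x < (R.iter n).disp (F x) + m := by
      by_contra! h
      exact absurd (hR.le_conj (hpos x) h) (not_le.2 h1)
    filter_upwards [hθ.continuousAt.eventually_lt
      ((hd n).add continuous_const).continuousAt h3] with y hy
    refine lt_of_le_of_lt (not_lt.1 fun h => ?_) h2
    exact lt_asymm (hR.lt_of_lt_conj (hpos y) h) hy

theorem continuous_mean (hR : R.IsRotation α) {F : A → Framed 𝔄 ℋ} (hF : Continuous F)
    (hpos : ∀ x, 0 < R.disp (F x)) : Continuous fun x => R.mean α (F x) :=
  intervalIntegral.continuous_parametric_intervalIntegral_of_continuous'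
    (hR.continuous_conj (F := fun q : A × ℝ => F q.1) (hF.comp continuous_fst)
      (fun q => hpos q.1) continuous_snd) 0 1

/-- The difference between the semiconjugacy and the identity has period one, so its mean does not
depend on the starting point. This makes `s - conj s` the coboundary of the mean. -/
theorem mean_shift (hR : R.IsRotation α) (hf : 0 < R.disp f) (hf' : 0 < R.disp f') {s : ℝ} (hs : IsShift f f' s) :
    R.mean α f' = R.mean α f + s - R.conj α f s := by
  have hc : Continuous (R.conj α f) := hR.continuous_conj (A := ℝ) (F := fun _ => f)
    continuous_const (fun _ => hf) continuous_id
  have hper : Function.Periodic (fun u => R.conj α f u - u) 1 := fun u => by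
    have := hR.conj_add_int hf u 1
    push_cast at this
    show R.conj α f (u + 1) - (u + 1) = R.conj α f u - u
    rw [this]; ring
  have h1 := hper.intervalIntegral_add_eq s 0
  rw [intervalIntegral.integral_sub (hc.intervalIntegrable _ _)
      (continuous_id'.intervalIntegrable _ _),
    intervalIntegral.integral_sub (hc.intervalIntegrable _ _)
      (continuous_id'.intervalIntegrable _ _), integral_id, integral_id, zero_add] at h1
  have h2 : R.mean α f' = (∫ u in s..s + 1, R.conj α f u) - R.conj α f s := by
    have h3 : R.mean α f' = ∫ u in (0 : ℝ)..1, (R.conj α f (s + u) - R.conj α f s) :=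
      intervalIntegral.integral_congr fun u _ => hR.conj_shift hf hf' hs u
    have h5 : Continuous fun u => R.conj α f (s + u) := by fun_prop
    rw [h3, intervalIntegral.integral_sub (h5.intervalIntegrable _ _) (by simp),
      intervalIntegral.integral_comp_add_left (fun u => R.conj α f u)]
    simp
  have h4 : R.mean α f = ∫ u in (0 : ℝ)..1, R.conj α f u := rfl
  rw [h2, h4]
  linarith

/-- The height of a leafwise family of points is locally constant. -/
theorem _root_.ReturnMap.conj_eq_of_isShift [PreconnectedSpace A] {F F' : A → Framed 𝔄 ℋ} (hF : Continuous F)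
    (hF' : Continuous F') {a : A → ℝ} (ha : Continuous a)
    (h : ∀ x, IsShift (F x) (F' x) (a x)) (x y : A) :
    R.conj α (F x) (a x) = R.conj α (F y) (a y) := by
  have key : ∀ x y (n : ℕ) (m : ℤ), (R.iter n).disp (F x) + m ≤ a x →
      (R.iter n).disp (F y) + m ≤ a y := by
    intro x y n m hx
    have hd : Continuous fun x => (R.iter n).disp (F x) := (R.iter n).continuous_disp.comp hF
    by_contra! hy
    -- Where the height meets that of an iterate, the two framed points coincide; by uniqueness of
    -- lifts they coincide everywhere and the heights differ by a constant integer, so no crossing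
    -- takes place.
    obtain ⟨z, hz⟩ := mem_range_of_exists_le_of_exists_ge
      (c := 0) (ha.sub (hd.add (continuous_const (y := (m : ℝ)))))
      ⟨y, by simpa using hy.le⟩ ⟨x, by simpa using hx⟩
    have hz' : a z = (R.iter n).disp (F z) + m := by
      simp only [Pi.sub_apply, Pi.add_apply] at hz
      linarith
    have h1 : F' = fun x => (R.iter n).ret (F x) := by
      refine isCoveringMap_proj.eq_of_comp_eq hF' ((R.iter n).continuous_ret.comp hF)
        (funext fun x => ?_) z ?_
      · show (F' x).proj = ((R.iter n).ret (F x)).proj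
        rw [(h x).proj_eq, ((R.iter n).isShift _).proj_eq]
      · refine (h z).unique ?_
        rw [hz', UnitAddCircle.coe_add_int]
        exact (R.iter n).isShift _
    obtain ⟨k, hk⟩ := UnitAddCircle.exists_int_of_coe_eq ha hd fun x => by
      apply (F x).isFrame.injective
      rw [← (h x).zero, ← ((R.iter n).isShift _).zero, h1]
    have h2 := hk z
    have h3 := hk y
    linarith
  have hset : ∀ x y, {r | ∃ (n : ℕ) (m : ℤ), (R.iter n).disp (F x) + m ≤ a x ∧ r = n * α + m} ⊆
      {r | ∃ (n : ℕ) (m : ℤ), (R.iter n).disp (F y) + m ≤ a y ∧ r = n * α + m} := by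
    rintro x y _ ⟨n, m, h1, rfl⟩
    exact ⟨n, m, key x y n m h1, rfl⟩
  exact congrArg sSup (Subset.antisymm (hset x y) (hset y x))

end IsRotation

end ReturnMap

end

/-! ### Trivializing the bundle, and the dichotomy -/

section

open scoped unitInterval

variable {S : Type u} {M : Type v} [TopologicalSpace S] [TopologicalSpace M] {p : M → S}
  {Λ : Set M} {𝔄 : FrameAtlas p} {ℋ : HorizontalAtlas p Λ} [CompactSpace S] [T2Space S]
    [T2Space M] [LocallyConnectedSpace S]

/-- Locally constant cocycles with values in the circle are coboundaries of continuous cochains. -/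
def FlatCocyclesSplit (S : Type u) [TopologicalSpace S] : Prop :=
  ∀ (ι : Type u) (U : ι → Set S) (c : ι → ι → S → UnitAddCircle), (∀ i, IsOpen (U i)) →
    (∀ b, ∃ i, b ∈ U i) →
    (∀ i j, ∀ b ∈ U i ∩ U j, ∀ᶠ b' in 𝓝 b, c i j b' = c i j b) →
    (∀ i j k, ∀ b ∈ U i ∩ U j ∩ U k, c i j b + c j k b = c i k b) →
    ∃ u : ι → S → UnitAddCircle, (∀ i, ContinuousOn (u i) (U i)) ∧
      ∀ i j, ∀ b ∈ U i ∩ U j, u i b - u j b = c i j b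

namespace ReturnMap

open Framed

theorem IsRotation.isShift {R : ReturnMap 𝔄 ℋ} {α : ℝ} (hR : R.IsRotation α)
    (hrev : ∀ f, R.disp f.rev = -R.disp f) {f g : Framed 𝔄 ℋ} (hf : 0 < R.disp f)
    (hg : 0 < R.disp g) (h : g.proj = f.proj) : ∃ s : ℝ, IsShift f g s := by
  rcases isShift_or_rev f g h with ⟨s, hs⟩ | ⟨s, hs⟩
  · obtain ⟨s, rfl⟩ := UnitAddCircle.exists_coe s
    exact ⟨s, hs⟩
  · obtain ⟨s, rfl⟩ := UnitAddCircle.exists_coe s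
    have := R.disp_pos_of_isShift (disp_ne_zero hR.ret_ne) hs hf
    rw [hrev] at this
    linarith

theorem IsRotation.coe_conj_congr {R : ReturnMap 𝔄 ℋ} {α : ℝ} (hR : R.IsRotation α)
    {f g : Framed 𝔄 ℋ} (hf : 0 < R.disp f) {s t : ℝ} (hs : IsShift f g s) (ht : IsShift f g t) :
    (R.conj α f s : UnitAddCircle) = R.conj α f t := by
  have h1 : (s : UnitAddCircle) = t := f.isFrame.injective (hs.zero.symm.trans ht.zero)
  obtain ⟨n, rfl⟩ := UnitAddCircle.coe_eq_coe_iff.1 h1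
  rw [hR.conj_add_int hf, UnitAddCircle.coe_add_int]

/-- The class of the semiconjugacy is locally constant along pairs of sections. -/
theorem IsRotation.eventually_coe_conj_eq {R : ReturnMap 𝔄 ℋ} {α : ℝ} (hR : R.IsRotation α)
    {F G : S → Framed 𝔄 ℋ} {V : Set S} (hV : IsOpen V) (hF : ContinuousOn F V)
    (hG : ContinuousOn G V) (hpos : ∀ b ∈ V, 0 < R.disp (F b)) {s : S → ℝ}
    (hs : ∀ b ∈ V, IsShift (F b) (G b) (s b)) {b₀ : S} (hb₀ : b₀ ∈ V) :
    ∀ᶠ b in 𝓝 b₀, (R.conj α (F b) (s b) : UnitAddCircle) = R.conj α (F b₀) (s b₀) := by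
  have hFV : Continuous fun b : V => F b := continuousOn_iff_continuous_domRestrict.1 hF
  have hGV : Continuous fun b : V => G b := continuousOn_iff_continuous_domRestrict.1 hG
  obtain ⟨θ, hθ, hθ'⟩ := exists_angle hFV (continuous_apply hGV continuous_const)
    (m := fun b : V => G b 0) fun b => (hs b b.2).proj_eq
  have hθs : ∀ b : V, θ b = (s b : UnitAddCircle) := fun b =>
    (F b).isFrame.injective ((hθ' b).trans (hs b b.2).zero)
  -- A local inverse of the projection from the line to the circle replaces the arbitrary heights
  -- `s` by continuous ones.
  obtain ⟨e, he, hes⟩ :=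
    (AddCircle.isCoveringMap_coe (1 : ℝ)).isLocalHomeomorph (s b₀)
  have htar : θ ⟨b₀, hb₀⟩ ∈ e.target := by
    rw [hθs]
    have := e.map_source he
    rwa [← hes] at this
  have hO : IsOpen (Subtype.val '' (θ ⁻¹' e.target)) :=
    hV.isOpenMap_subtype_val _ (e.open_target.preimage hθ)
  obtain ⟨W, hW, hWo, hbW, hWc⟩ := locallyConnectedSpace_iff_subsets_isOpen_isConnected.1
      inferInstance b₀ _ (hO.mem_nhds ⟨⟨b₀, hb₀⟩, htar, rfl⟩)
  have hWV : ∀ b ∈ W, ∃ hb : b ∈ V, θ ⟨b, hb⟩ ∈ e.target := fun b hb => by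
    obtain ⟨⟨c, hc⟩, h1, rfl⟩ := hW hb
    exact ⟨hc, h1⟩
  have hconn := isPreconnected_iff_preconnectedSpace.1 hWc.isPreconnected
  have hsh : ∀ b : W, IsShift (F b) (G b) (e.symm (θ ⟨b, (hWV b b.2).1⟩) : ℝ) := fun b => by
    obtain ⟨hb, hbt⟩ := hWV b b.2
    have h1 : ((e.symm (θ ⟨b, hb⟩) : ℝ) : UnitAddCircle) = θ ⟨b, hb⟩ := by
      have := e.right_inv hbt
      rwa [← hes] at this
    rw [h1, hθs]
    exact hs b hb
  have hθW : Continuous fun b : W => θ ⟨b, (hWV b b.2).1⟩ := hθ.comp (by fun_prop)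
  have hconst := conj_eq_of_isShift (R := R) (α := α) (A := W) (F := fun b => F b)
    (F' := fun b => G b) (a := fun b => e.symm (θ ⟨b, (hWV b b.2).1⟩))
    (continuousOn_iff_continuous_domRestrict.1 (hF.mono fun b hb => (hWV b hb).1))
    (continuousOn_iff_continuous_domRestrict.1 (hG.mono fun b hb => (hWV b hb).1))
    (e.continuousOn_symm.comp_continuous hθW fun b => (hWV b b.2).2) hsh
  filter_upwards [hWo.mem_nhds hbW] with b hb
  rw [hR.coe_conj_congr (hpos b (hWV b hb).1) (hs b (hWV b hb).1) (hsh ⟨b, hb⟩),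
    hR.coe_conj_congr (hpos b₀ hb₀) (hs b₀ hb₀) (hsh ⟨b₀, hbW⟩)]
  exact congrArg _ (hconst ⟨b, hb⟩ ⟨b₀, hbW⟩)

/-- The displacement never vanishes, so some framed point over `b`, reversed if necessary, is
positive; a section through it remains positive nearby. -/
theorem IsRotation.exists_local_section {R : ReturnMap 𝔄 ℋ} {α : ℝ} (hR : R.IsRotation α)
    (hrev : ∀ f, R.disp f.rev = -R.disp f) [PathConnectedSpace S] [Nonempty (Framed 𝔄 ℋ)]
    (b : S) : ∃ (V : Set S) (F : S → Framed 𝔄 ℋ), IsOpen V ∧ b ∈ V ∧ ContinuousOn F V ∧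
      ∀ x ∈ V, (F x).proj = x ∧ 0 < R.disp (F x) := by
  obtain ⟨f⟩ := ‹Nonempty (Framed 𝔄 ℋ)›
  obtain ⟨Γ, -, -, hΓ⟩ := f.exists_path b
  obtain ⟨g, hgb, hg⟩ : ∃ g : Framed 𝔄 ℋ, g.proj = b ∧ 0 < R.disp g := by
    rcases lt_or_gt_of_ne (disp_ne_zero hR.ret_ne (Γ 1)) with h | h
    · exact ⟨(Γ 1).rev, by rw [rev_proj, hΓ], by rw [hrev]; linarith⟩
    · exact ⟨Γ 1, hΓ, h⟩
  obtain ⟨W, hWo, hbW, -, hW⟩ := exists_sections (𝔄 := 𝔄) (ℋ := ℋ) b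
  obtain ⟨i, hi, hib⟩ := hW g (by rwa [hgb])
  rw [hgb] at hib
  have hc : ∀ x ∈ i.1.1, ContinuousAt i.1.2 x := fun x hx =>
    continuousAt_iff_goodAt.2 (i.2.2 x hx).2
  have hd : ∀ x ∈ i.1.1, ContinuousAt (fun x => R.disp (i.1.2 x)) x := fun x hx =>
    ContinuousAt.comp (f := i.1.2) R.continuous_disp.continuousAt (hc x hx)
  refine ⟨{x | x ∈ i.1.1 ∧ 0 < R.disp (i.1.2 x)}, i.1.2, ?_, ⟨hi hbW, by rwa [hib]⟩,
    fun x hx => (hc x hx.1).continuousWithinAt, fun x hx => ⟨(i.2.2 x hx.1).1, hx.2⟩⟩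
  refine isOpen_iff_mem_nhds.2 fun x hx => ?_
  filter_upwards [i.2.1.mem_nhds hx.1, (hd x hx.1).eventually_const_lt hx.2] with y h1 h2
    using ⟨h1, h2⟩

/-- A return map without periodic points trivializes the bundle. -/
theorem IsRotation.isTrivial {R : ReturnMap 𝔄 ℋ} {α : ℝ} (hR : R.IsRotation α)
    (hrev : ∀ f, R.disp f.rev = -R.disp f) [PathConnectedSpace S] [Nonempty (Framed 𝔄 ℋ)]
    (hB : FlatCocyclesSplit S) : IsHomeomorphicTrivialFiberBundle Circle p := by
  have := 𝔄.compactSpace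
  choose V F hVo hbV hF hFp using hR.exists_local_section hrev
  have hsh : ∀ i j b, ∃ s : ℝ, b ∈ V i → b ∈ V j → IsShift (F i b) (F j b) s := by
    intro i j b
    by_cases h : b ∈ V i ∧ b ∈ V j
    · obtain ⟨s, hs⟩ := hR.isShift hrev (hFp i b h.1).2 (hFp j b h.2).2
        (by rw [(hFp i b h.1).1, (hFp j b h.2).1])
      exact ⟨s, fun _ _ => hs⟩
    · exact ⟨0, fun h1 h2 => absurd ⟨h1, h2⟩ h⟩
  choose s hs using hsh
  -- The shifts between local sections are not locally constant, but their images under the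
  -- semiconjugacy are, and `conj_shift` makes them a cocycle.
  obtain ⟨u, hu, huc⟩ := hB S V (fun i j b => (R.conj α (F i b) (s i j b) : UnitAddCircle)) hVo
    (fun b => ⟨b, hbV b⟩)
    (fun i j b hb => hR.eventually_coe_conj_eq ((hVo i).inter (hVo j))
      ((hF i).mono inter_subset_left) ((hF j).mono inter_subset_right)
      (fun x hx => (hFp i x hx.1).2) (s := s i j) (fun x hx => hs i j x hx.1 hx.2) hb)
    (fun i j k b hb => by
      have hij := hs i j b hb.1.1 hb.1.2
      have hjk := hs j k b hb.1.2 hb.2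
      have hik : IsShift (F i b) (F k b) ((s i j b + s j k b : ℝ) : UnitAddCircle) := by
        rw [AddCircle.coe_add]; exact hij.trans hjk
      rw [← hR.coe_conj_congr (hFp i b hb.1.1).2 hik (hs i k b hb.1.1 hb.2),
        hR.conj_shift (hFp i b hb.1.1).2 (hFp j b hb.1.2).2 hij, ← AddCircle.coe_add]
      congr 1; ring)
  -- Adding the mean back to the splitting of the flat part splits the full cocycle of shifts; `z`
  -- picks continuous origins on the fibres that agree on overlaps.
  let z : S → S → UnitAddCircle := fun i b => u i b - (R.mean α (F i b) : ℝ)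
  have hz : ∀ i, ContinuousOn (z i) (V i) := fun i => by
    refine (hu i).sub ?_
    have h1 : Continuous fun b : V i => R.mean α (F i b) :=
      hR.continuous_mean (continuousOn_iff_continuous_domRestrict.1 (hF i)) fun b => (hFp i b b.2).2
    exact continuousOn_iff_continuous_domRestrict.2 ((AddCircle.continuous_mk' 1).comp h1)
  have hglue : ∀ i j b, b ∈ V i → b ∈ V j → ∀ r, F i b (z i b + r) = F j b (z j b + r) := by
    intro i j b hi hj r
    have h1 := hs i j b hi hj
    have h2 := huc i j b ⟨hi, hj⟩
    have h3 := hR.mean_shift (hFp i b hi).2 (hFp j b hj).2 h1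
    rw [h1]
    congr 1
    simp only [z]
    rw [h3, ← sub_eq_zero]
    rw [AddCircle.coe_sub, AddCircle.coe_add, ← h2]
    abel
  let G : S × UnitAddCircle → M := fun q => F q.1 q.1 (z q.1 q.1 + q.2)
  have hG : Continuous G := by
    refine continuous_iff_continuousAt.2 fun q => ?_
    obtain ⟨b, r⟩ := q
    have hV1 : V b ∈ 𝓝 b := (hVo b).mem_nhds (hbV b)
    have hg : GoodAt (F b) b := continuousAt_iff_goodAt.1 ((hF b).continuousAt hV1)
    have hzb := (hz b).continuousAt hV1
    have h1 : ContinuousAt (fun q : S × UnitAddCircle => (q.1, z b q.1 + q.2)) (b, r) :=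
      continuousAt_fst.prodMk (ContinuousAt.add (ContinuousAt.comp (x := (b, r))
        (f := Prod.fst) (g := z b) hzb continuousAt_fst) continuousAt_snd)
    have h2 := ContinuousAt.comp (x := (b, r))
      (g := fun q : S × UnitAddCircle => F b q.1 q.2) (hg.2 _) h1
    refine h2.congr ?_
    have h3 : ∀ᶠ q : S × UnitAddCircle in 𝓝 (b, r), q.1 ∈ V b :=
      continuousAt_fst.eventually_mem hV1
    filter_upwards [h3] with q hq
    exact hglue b q.1 q.1 hq (hbV _) _
  have hGp : ∀ q, p (G q) = q.1 := fun q => by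
    show p (F q.1 q.1 _) = q.1
    rw [proj_apply (p := p)]; exact (hFp q.1 q.1 (hbV _)).1
  have hGb : Function.Bijective G := by
    constructor
    · rintro ⟨b, r⟩ ⟨b', r'⟩ h
      have h1 : b = b' := (hGp (b, r)).symm.trans ((congrArg p h).trans (hGp (b', r')))
      subst h1
      have h2 := (F b b).isFrame.injective h
      exact Prod.ext rfl (add_left_cancel h2)
    · intro m
      obtain ⟨r, hr⟩ := (F (p m) (p m)).isFrame.exists_eq (m := m)
        ((hFp (p m) (p m) (hbV _)).1).symm
      exact ⟨(p m, r - z (p m) (p m)), by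
        show F (p m) (p m) (z (p m) (p m) + (r - z (p m) (p m))) = m
        rw [add_sub_cancel]; exact hr⟩
  let e : S × UnitAddCircle ≃ₜ M :=
    hG.homeoOfEquivCompactToT2 (f := Equiv.ofBijective G hGb)
  refine ⟨e.symm.trans ((Homeomorph.refl S).prodCongr
    (AddCircle.homeomorphCircle (one_ne_zero))), fun m => ?_⟩
  obtain ⟨q, rfl⟩ := e.surjective m
  simp only [Homeomorph.trans_apply, Homeomorph.symm_apply_apply]
  exact (hGp q).symm

end ReturnMap

/-- A periodic framed point makes an iterate of the return map the identity; without one, the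
rotation number trivializes the bundle. -/
theorem exists_pos_iterate_fixed [SecondCountableTopology S] [PathConnectedSpace S]
    (𝔄 : FrameAtlas p) {ℋ : HorizontalAtlas p Λ} (𝓘 : LeafIsotopy ℋ)
    (hB : FlatCocyclesSplit S) (hnt : ¬ IsHomeomorphicTrivialFiberBundle Circle p)
    (hd : ∀ x ∈ Λ, Λ ⊆ closure {y | ℋ.Joined x y}) (hΛ : ∀ x ∈ Λ, ∀ y, ℋ.Joined x y → y ∈ Λ) :
    ∃ k : ℕ, 1 ≤ k ∧ ∀ x ∈ Λ, ℋ.Joined ((𝓘.H 1)^[k] x) x := by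
  rcases Λ.eq_empty_or_nonempty with hne | hne
  · exact ⟨1, le_rfl, fun x hx => absurd hx (hne ▸ notMem_empty x)⟩
  obtain ⟨D⟩ := IsotopyLift.nonempty (𝔄 := 𝔄) 𝓘
  obtain ⟨D'⟩ := IsotopyLift.nonempty (𝔄 := 𝔄) 𝓘.symm
  let R : ReturnMap 𝔄 ℋ :=
    { ret := D.ret
      disp := D.disp
      continuous_ret := D.continuous_ret
      continuous_disp := D.continuous_disp
      isShift := D.isShift_ret
      lt := fun f f' s h0 h1 => D.disp_lt h0 h1
      rev := fun f => (D.ret_disp_rev f).1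
      -- Surjectivity comes from the inverse isotopy, whose own inverse is the original one.
      surj := fun f => ⟨D'.ret f, IsotopyLift.ret_ret_symm D' D (fun t x => by
        rw [← 𝓘.symm_symm_apply]
        rw [LeafIsotopy.symm_apply]; simp) f⟩ }
  by_cases hfix : ∃ n, 1 ≤ n ∧ ∃ f, R.ret^[n] f = f
  · obtain ⟨n, hn, f₀, hf₀⟩ := hfix
    refine ⟨n, hn, fun x hx => ?_⟩
    obtain ⟨f, rfl⟩ := Framed.exists_zero_eq (𝔄 := 𝔄) (ℋ := ℋ) hx
    have hid := (R.iter n).ret_eq_self hd hΛ (f₀ := f₀) (by rw [R.iter_ret, hf₀]) f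
    -- Iterates of the return map follow the iterates of `h` from leaf to leaf.
    have key : ∀ k, ℋ.Joined ((𝓘.H 1)^[k] (f 0)) ((R.iter k).ret f 0) := by
      intro k
      induction k with
      | zero => exact HorizontalAtlas.Joined.refl _
      | succ k ih =>
        rw [Function.iterate_succ_apply']
        have h1 : ℋ.Joined (𝓘.H 1 ((𝓘.H 1)^[k] (f 0))) (𝓘.H 1 ((R.iter k).ret f 0)) :=
          (𝓘.preserves.2 _ ((R.iter k).ret f).mem _ ih.symm).symm
        exact h1.trans (D.joined_ret _)
    have := key n
    rwa [hid] at this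
  · push Not at hfix
    exfalso
    have hrev : ∀ f, R.disp f.rev = -R.disp f := fun f => (D.ret_disp_rev f).2
    obtain ⟨x, hx⟩ := hne
    obtain ⟨f, -⟩ := Framed.exists_zero_eq (𝔄 := 𝔄) (ℋ := ℋ) hx
    have : Nonempty (Framed 𝔄 ℋ) := ⟨f⟩
    obtain ⟨f₁, hf₁⟩ : ∃ f₁, 0 < R.disp f₁ := by
      rcases lt_or_gt_of_ne (ReturnMap.disp_ne_zero hfix f) with h | h
      · exact ⟨f.rev, by rw [hrev]; linarith⟩
      · exact ⟨f, h⟩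
    obtain ⟨α, h1, h2⟩ := ReturnMap.exists_rotation_number hfix hrev hf₁
    exact hnt (ReturnMap.IsRotation.isTrivial (R := R) (α := α) ⟨hfix, h1, h2⟩ hrev hB)

end

/-! ### Application to a minimal horizontal lamination -/

section

open scoped unitInterval

theorem exists_pos_iterate_image_leaf_eq
    {S : Type u} [TopologicalSpace S] [T2Space S] [CompactSpace S] [ConnectedSpace S]
    [ChartedSpace (EuclideanSpace ℝ (Fin 2)) S] (hB : FlatCocyclesSplit S)
    {M : Type v} [TopologicalSpace M] [T2Space M] (p : M → S) (hpc : Continuous p)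
    (hp : ∀ x : S, ∃ e : Bundle.Trivialization Circle p, x ∈ e.baseSet)
    (hnontrivial : ¬ IsHomeomorphicTrivialFiberBundle Circle p)
    (h : M ≃ₜ M) (hh : IsotopicToId h)
    (Λ : SurfaceLamination M) (hΛ : Λ.IsHorizontal p) (hmin : Λ.IsMinimal)
    (hinv : Λ.IsInvariant h) :
    ∃ k : ℕ, 1 ≤ k ∧ ∀ L ∈ Λ.leaves, h^[k] '' L = L := by
  have := ChartedSpace.locallyConnectedSpace (EuclideanSpace ℝ (Fin 2)) S
  have := ChartedSpace.locallyPathConnectedSpace (EuclideanSpace ℝ (Fin 2)) S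
  have := ChartedSpace.secondCountable_of_sigmaCompact (EuclideanSpace ℝ (Fin 2)) S
  have : PathConnectedSpace S := pathConnectedSpace_iff_connectedSpace.2 inferInstance
  obtain ⟨ι, U, Fr, h1, h2, h3, h4, h5, h6, h7⟩ := exists_isometric_frames hp
  let 𝔄 : FrameAtlas p := ⟨ι, U, Fr, hpc, h1, h2, h3, h4, h5, h6, h7⟩
  have := 𝔄.compactSpace
  set ℋ := Λ.horizontalAtlas hΛ
  have hj : ∀ x y, ℋ.Joined x y ↔ Relation.EqvGen Λ.SamePlaque x y := fun x y =>
    Λ.joined_iff hpc hΛ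
  obtain ⟨H, hHc, hH0, hH1⟩ := hh
  let 𝓘 : LeafIsotopy ℋ :=
    { H := H
      continuous := hHc
      zero := fun x => by rw [hH0]; rfl
      preserves := by
        rw [hH1]
        exact ⟨fun x hx => (hinv.map hx).1, fun x hx y hxy => by
          rw [hj] at hxy ⊢; exact (hinv.map hx).2 y hxy⟩
      preserves_symm := by
        rw [hH1]
        exact ⟨fun x hx => (hinv.symm_map hx).1, fun x hx y hxy => by
          rw [hj] at hxy ⊢; exact (hinv.symm_map hx).2 y hxy⟩ }
  obtain ⟨k, hk, hfix⟩ := exists_pos_iterate_fixed 𝔄 𝓘 hB hnontrivial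
    (fun x hx => by
      have := hmin _ ⟨x, hx, rfl⟩
      simp only [hj]
      exact this.ge)
    (fun x hx y hxy => (SurfaceLamination.mem_support_iff ((hj x y).1 hxy)).1 hx)
  have hfix' : ∀ x ∈ Λ.support, Relation.EqvGen Λ.SamePlaque (h^[k] x) x := fun x hx => by
    have := hfix x hx
    rw [hj] at this
    rwa [show 𝓘.H 1 = h from hH1] at this
  refine ⟨k, hk, ?_⟩
  rintro _ ⟨x, hx, rfl⟩
  have hmem : ∀ y, Relation.EqvGen Λ.SamePlaque x y → y ∈ Λ.support := fun y hy =>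
    (SurfaceLamination.mem_support_iff hy).1 hx
  ext y
  constructor
  · rintro ⟨z, hz, rfl⟩
    exact hz.trans _ _ _ (hfix' z (hmem z hz)).symm
  · intro hy
    have hsymm : ∀ n, ∀ y ∈ Λ.support, h.symm^[n] y ∈ Λ.support := by
      intro n
      induction n with
      | zero => exact fun y hy => hy
      | succ n ih => exact fun y hy => ih _ (hinv.symm_map hy).1
    have hinv' : h^[k] (h.symm^[k] y) = y :=
      Function.LeftInverse.iterate h.apply_symm_apply k y
    refine ⟨h.symm^[k] y, ?_, hinv'⟩
    -- Applied to the inverse image of `y`, the fixed-leaf property shows that it lies on the leaf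
    -- of `y`; this gives surjectivity onto the leaf.
    have h8 := hfix' _ (hsymm k y (hmem y hy))
    rw [hinv'] at h8
    exact Relation.EqvGen.trans _ _ _ hy h8

end

/-! ### Nonvanishing complex functions on the circle -/

section

/-- The direction of a complex number, as a point of `ℝ / ℤ`. -/
noncomputable def Complex.direction (z : ℂ) : UnitAddCircle :=
  AddCircle.equivAddCircle (2 * Real.pi) 1 (by positivity) one_ne_zero (z.arg : Real.Angle)

namespace Complex

theorem toCircle_direction (z : ℂ) : AddCircle.toCircle z.direction = Circle.exp z.arg := by
  unfold direction
  erw [AddCircle.equivAddCircle_apply_mk]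
  rw [AddCircle.toCircle_apply_mk]
  congr 1
  field_simp

theorem norm_mul_toCircle_direction (z : ℂ) :
    (‖z‖ : ℂ) * (AddCircle.toCircle z.direction : ℂ) = z := by
  rw [toCircle_direction, Circle.coe_exp, norm_mul_exp_arg_mul_I]

theorem continuousAt_direction {z : ℂ} (hz : z ≠ 0) : ContinuousAt direction z :=
  ((AddCircle.homeomorphAddCircle (2 * Real.pi) 1 (by positivity)
    one_ne_zero).continuous.continuousAt).comp (continuousAt_arg_coe_angle hz)

theorem direction_toCircle_mul (x : UnitAddCircle) {z : ℂ} (hz : z ≠ 0) :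
    direction ((AddCircle.toCircle x : ℂ) * z) = x + z.direction := by
  apply AddCircle.injective_toCircle one_ne_zero
  rw [AddCircle.toCircle_add]
  apply Circle.ext
  have h1 := norm_mul_toCircle_direction ((AddCircle.toCircle x : ℂ) * z)
  have h2 := norm_mul_toCircle_direction z
  have hz' : (‖z‖ : ℂ) ≠ 0 := by simpa using hz
  rw [norm_mul, Circle.norm_coe, one_mul] at h1
  apply mul_left_cancel₀ hz'
  rw [h1]
  push_cast
  rw [mul_left_comm, h2]

/-- A nonvanishing continuous function on the unit circle is, up to the exponential of a continuous
function, an integral power of the identity. -/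
theorem exists_eq_zpow_mul_exp {f : ℂ → ℂ} (hf : ContinuousOn f (Metric.sphere 0 1))
    (h0 : ∀ z ∈ Metric.sphere (0 : ℂ) 1, f z ≠ 0) :
    ∃ (n : ℤ) (k : ℂ → ℂ), ContinuousOn k (Metric.sphere 0 1) ∧
      ∀ z ∈ Metric.sphere (0 : ℂ) 1, f z = z ^ n * exp (k z) := by
  let e : ℝ → ℂ := fun r => (AddCircle.toCircle (r : UnitAddCircle) : ℂ)
  have hec : Continuous e := continuous_subtype_val.comp
    (AddCircle.continuous_toCircle.comp (AddCircle.continuous_mk' 1))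
  have hes : ∀ r, e r ∈ Metric.sphere (0 : ℂ) 1 := fun r =>
    mem_sphere_zero_iff_norm.2 (Circle.norm_coe _)
  have hep : ∀ r, e (r + 1) = e r := fun r => by simp only [e, UnitAddCircle.coe_add_one]
  have hexp : ∀ r : ℝ, e r = exp (2 * Real.pi * r * I) := fun r => by
    simp only [e, AddCircle.toCircle_apply_mk, Circle.coe_exp]; push_cast; ring_nf
  let g : ℝ → UnitAddCircle := fun r => (f (e r)).direction
  have hfe : Continuous fun r => f (e r) := hf.comp_continuous hec hes
  have hg : Continuous g := continuous_iff_continuousAt.2 fun r =>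
    ContinuousAt.comp (f := fun r => f (e r)) (continuousAt_direction (h0 _ (hes r)))
      hfe.continuousAt
  obtain ⟨w, hw⟩ := circleLift_add_one hg fun r => by simp only [g, hep]
  obtain ⟨a, ha⟩ := UnitAddCircle.exists_coe (g 0)
  -- A logarithm of `f` along the circle with the winding term `w * r` subtracted, which makes it
  -- periodic.
  let K : ℝ → ℂ := fun r =>
    (Real.log ‖f (e r)‖ : ℂ) + 2 * Real.pi * (a + circleLift g r - w * r : ℝ) * I
  have hKc : Continuous K := by
    have h1 : Continuous fun r => Real.log ‖f (e r)‖ :=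
      hfe.norm.log fun r => norm_ne_zero_iff.2 (h0 _ (hes r))
    have h2 := continuous_circleLift g
    fun_prop
  have hKp : Function.Periodic K 1 := fun r => by
    simp only [K, hep, hw]; push_cast; ring
  have hfK : ∀ r, f (e r) = e r ^ w * exp (K r) := by
    intro r
    have h1 := norm_mul_toCircle_direction (f (e r))
    have h2 : (f (e r)).direction = ((a + circleLift g r : ℝ) : UnitAddCircle) := by
      rw [AddCircle.coe_add, ha]; exact eq_add_circleLift hg r
    rw [← h1, h2]
    have h3 : (AddCircle.toCircle ((a + circleLift g r : ℝ) : UnitAddCircle) : ℂ) =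
        exp (2 * Real.pi * (a + circleLift g r : ℝ) * I) := hexp _
    have h4 : ((‖f (e r)‖ : ℝ) : ℂ) = exp (Real.log ‖f (e r)‖ : ℝ) := by
      rw [← ofReal_exp, Real.exp_log (norm_pos_iff.2 (h0 _ (hes r)))]
    have h5 : K r = Real.log ‖f (e r)‖ +
        2 * Real.pi * (a + circleLift g r - w * r : ℝ) * I := rfl
    rw [h3, h4, h5]
    generalize Real.log ‖f (e r)‖ = l
    rw [hexp r, ← exp_int_mul, ← exp_add, ← exp_add]
    congr 1
    push_cast
    ring
  refine ⟨w, fun z => hKp.lift z.direction, ?_, ?_⟩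
  · have hl : Continuous hKp.lift := continuous_coinduced_dom.2 hKc
    intro z hz
    have hz0 : z ≠ 0 := by rintro rfl; simp at hz
    exact (hl.continuousAt.comp (continuousAt_direction hz0)).continuousWithinAt
  · intro z hz
    obtain ⟨r, hr⟩ := UnitAddCircle.exists_coe z.direction
    have hzr : z = e r := by
      have := norm_mul_toCircle_direction z
      rw [mem_sphere_zero_iff_norm.1 hz, ← hr] at this
      simpa using this.symm
    simp only [← hr]
    rw [hzr]
    exact hfK r

/-- A nonvanishing continuous function on a closed subset of the unit circle extends to a continuous
function on the plane which vanishes only at the centre. -/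
theorem exists_extension_ne_zero {K : Set ℂ} (hK : IsClosed K) (hKs : K ⊆ Metric.sphere 0 1)
    {f : ℂ → ℂ} (hf : ContinuousOn f K) (h0 : ∀ z ∈ K, f z ≠ 0) :
    ∃ F : ℂ → ℂ, Continuous F ∧ (∀ z, ‖z‖ ≤ 1 → F z = 0 → z = 0) ∧ ∀ z ∈ K, F z = f z := by
  have hKc : IsCompact K := (isCompact_sphere 0 1).of_isClosed_subset hK hKs
  have tietze : ∀ {f : ℂ → ℂ}, ContinuousOn f K → ∃ F : ℂ → ℂ, Continuous F ∧ EqOn F f K := by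
    intro f hf
    obtain ⟨F, hF⟩ := ContinuousMap.exists_restrict_eq hK ⟨K.domRestrict f, hf.domRestrict⟩
    exact ⟨F, F.continuous, fun z hz => congr($hF ⟨z, hz⟩)⟩
  obtain ⟨c, hc, hcK⟩ : ∃ c > 0, ∀ z ∈ K, c ≤ ‖f z‖ := by
    rcases K.eq_empty_or_nonempty with rfl | hne
    · exact ⟨1, one_pos, fun z hz => hz.elim⟩
    · obtain ⟨z, hz, hm⟩ := hKc.exists_isMinOn hne hf.norm
      exact ⟨_, norm_pos_iff.2 (h0 z hz), fun w hw => hm hw⟩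
  -- The Tietze extension may vanish off `K`, so it is approximated by a continuously differentiable
  -- function. The image of the circle under that function has dense complement in the plane, and a
  -- small translation `t` removes the zeros on the circle.
  obtain ⟨F, hF, hFK⟩ := tietze hf
  obtain ⟨g, hg, hgF, -⟩ := hF.exists_contDiff_approx 1 (ε := fun _ => c / 4) continuous_const
    fun _ => by positivity
  let e : ℝ → ℂ := fun θ => exp (θ * I)
  have he : ContDiff ℝ 1 fun θ : ℝ => g (e θ) := by
    refine hg.comp ?_
    exact ((ofRealCLM.contDiff).mul contDiff_const).cexp
  obtain ⟨t, htr, ht⟩ := (he.dense_compl_range_of_finrank_lt_finrank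
    (by simp)).exists_dist_lt 0 (show 0 < c / 4 by positivity)
  have hP0 : ∀ z ∈ Metric.sphere (0 : ℂ) 1, g z - t ≠ 0 := by
    intro z hz hzt
    refine htr ⟨z.arg, ?_⟩
    have : e z.arg = z := by
      have := norm_mul_exp_arg_mul_I z
      rwa [mem_sphere_zero_iff_norm.1 hz, ofReal_one, one_mul] at this
    simp only [this]
    exact sub_eq_zero.1 hzt
  -- Both errors are below `c / 4` while `f` is at least `c` on `K`, so the ratio is close enough to
  -- one to have a logarithm, which again extends by Tietze.
  have hPK : ∀ z ∈ K, f z / (g z - t) ∈ slitPlane := by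
    intro z hz
    have hp := hP0 z (hKs hz)
    have h1 : ‖f z - (g z - t)‖ < c / 2 := by
      have h2 := hgF z
      rw [hFK hz, dist_comm, dist_eq_norm] at h2
      rw [dist_zero_left] at ht
      calc ‖f z - (g z - t)‖ = ‖(f z - g z) + t‖ := by ring_nf
        _ ≤ _ := norm_add_le _ _
        _ < _ := by linarith
    have h3 : c / 2 < ‖g z - t‖ := by
      have := norm_sub_norm_le (f z) (f z - (g z - t))
      rw [sub_sub_cancel] at this
      linarith [hcK z hz]
    have h4 : ‖(f z - (g z - t)) / (g z - t)‖ < 1 := by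
      rw [norm_div, div_lt_one (by linarith)]; linarith
    have := mem_slitPlane_of_norm_lt_one h4
    rwa [sub_div, div_self hp, add_sub_cancel] at this
  obtain ⟨G, hG, hGK⟩ := tietze (f := fun z => log (f z / (g z - t)))
    ((hf.div (hg.continuous.sub continuous_const).continuousOn
      fun z hz => hP0 z (hKs hz)).clog hPK)
  let f₁ : ℂ → ℂ := fun z => (g z - t) * exp (G z)
  have hf₁ : Continuous f₁ := (hg.continuous.sub continuous_const).mul hG.cexp
  obtain ⟨M, hM⟩ := (isCompact_closedBall (0 : ℂ) 1).exists_bound_of_continuousOn hf₁.continuousOn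
  have hn : ∀ z : ℂ, ‖(‖z‖ : ℂ)⁻¹ * z‖ ≤ 1 := fun z => by
    rw [norm_mul, norm_inv, norm_real, norm_norm]; exact inv_mul_le_one
  -- Radial extension from the circle, damped by the norm to be continuous at the centre.
  refine ⟨fun z => ‖z‖ * f₁ ((‖z‖ : ℂ)⁻¹ * z), ?_, ?_, ?_⟩
  · rw [continuous_iff_continuousAt]
    intro z
    by_cases hz : z = 0
    · subst hz
      rw [ContinuousAt, norm_zero, ofReal_zero, zero_mul]
      refine squeeze_zero_norm (a := fun z : ℂ => ‖z‖ * M) (fun z => ?_) ?_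
      · rw [norm_mul, norm_real, norm_norm]
        exact mul_le_mul_of_nonneg_left (hM _ (by simpa using hn z)) (norm_nonneg _)
      · have : Continuous fun z : ℂ => ‖z‖ * M := by fun_prop
        simpa using this.tendsto 0
    · have h1 : ContinuousAt (fun z : ℂ => (‖z‖ : ℂ)) z := by fun_prop
      exact h1.mul (hf₁.continuousAt.comp ((h1.inv₀ (by simpa using hz)).mul continuousAt_id))
  · intro z _ hz
    by_contra hz0
    have hz0' : (‖z‖ : ℂ) ≠ 0 := by simpa using hz0
    rcases mul_eq_zero.1 hz with h | h
    · exact hz0' h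
    · rcases mul_eq_zero.1 h with h | h
      · refine hP0 _ ?_ h
        rw [mem_sphere_zero_iff_norm, norm_mul, norm_inv, norm_real, norm_norm,
          inv_mul_cancel₀ (by simpa using hz0)]
      · exact exp_ne_zero _ h
  · intro z hz
    have h1 : ‖z‖ = 1 := mem_sphere_zero_iff_norm.1 (hKs hz)
    have h2 := hP0 z (hKs hz)
    simp only [h1, ofReal_one, inv_one, one_mul, f₁, hGK hz]
    rw [exp_log (div_ne_zero (h0 z hz) h2), mul_div_cancel₀ _ h2]

end Complex

end

/-! ### Sections of flat line bundles and their zeros -/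

section

/-- A locally constant cocycle with values in the complex numbers of modulus one, that is, the
transition functions of a flat hermitian line bundle. -/
structure FlatLineCocycle (S : Type u) [TopologicalSpace S] (ι : Type v) where
  /-- the sets of the cover -/
  U : ι → Set S
  isOpen_U : ∀ i, IsOpen (U i)
  exists_mem : ∀ b, ∃ i, b ∈ U i
  /-- the transition functions -/
  C : ι → ι → S → ℂ
  norm_C : ∀ i j b, ‖C i j b‖ = 1
  eventually_eq : ∀ i j, ∀ b ∈ U i ∩ U j, ∀ᶠ b' in 𝓝 b, C i j b' = C i j b
  mul_C : ∀ i j k, ∀ b ∈ U i ∩ U j ∩ U k, C i j b * C j k b = C i k b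

namespace FlatLineCocycle

variable {S : Type u} [TopologicalSpace S] {ι : Type v} (Z : FlatLineCocycle S ι)

theorem C_ne_zero (i j : ι) (b : S) : Z.C i j b ≠ 0 :=
  norm_ne_zero_iff.1 (by rw [Z.norm_C]; exact one_ne_zero)

theorem continuousAt_C {i j : ι} {b : S} (hi : b ∈ Z.U i) (hj : b ∈ Z.U j) :
    ContinuousAt (Z.C i j) b :=
  continuousAt_const.congr ((Z.eventually_eq i j b ⟨hi, hj⟩).mono fun _ h => h.symm)

theorem C_self {i : ι} {b : S} (hi : b ∈ Z.U i) : Z.C i i b = 1 := by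
  have := Z.mul_C i i i b ⟨⟨hi, hi⟩, hi⟩
  exact mul_left_cancel₀ (Z.C_ne_zero i i b) (this.trans (mul_one _).symm)

/-- The complex conjugate cocycle. -/
noncomputable def conj : FlatLineCocycle S ι where
  U := Z.U
  isOpen_U := Z.isOpen_U
  exists_mem := Z.exists_mem
  C i j b := starRingEnd ℂ (Z.C i j b)
  norm_C i j b := by rw [RCLike.norm_conj, Z.norm_C]
  eventually_eq i j b hb := (Z.eventually_eq i j b hb).mono fun b' h => by rw [h]
  mul_C i j k b hb := by rw [← map_mul, Z.mul_C i j k b hb]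

/-- A continuous section over `A` of the line bundle defined by the cocycle. -/
structure IsSection (s : ι → S → ℂ) (A : Set S) : Prop where
  continuousOn : ∀ i, ContinuousOn (s i) (A ∩ Z.U i)
  eq_mul : ∀ i j, ∀ b ∈ A, b ∈ Z.U i → b ∈ Z.U j → s i b = Z.C i j b * s j b

/-- The zeros of a section. -/
def zeros (s : ι → S → ℂ) (A : Set S) : Set S := {b | b ∈ A ∧ ∃ i, b ∈ Z.U i ∧ s i b = 0}

variable {Z} {s : ι → S → ℂ} {A : Set S}

theorem IsSection.mem_zeros_iff (hs : Z.IsSection s A) {b : S} (hb : b ∈ A) {i : ι}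
    (hi : b ∈ Z.U i) : b ∈ Z.zeros s A ↔ s i b = 0 := by
  constructor
  · rintro ⟨-, j, hj, h⟩
    rw [hs.eq_mul i j b hb hi hj, h, mul_zero]
  · exact fun h => ⟨hb, i, hi, h⟩

theorem IsSection.conj (hs : Z.IsSection s A) :
    Z.conj.IsSection (fun i b => starRingEnd ℂ (s i b)) A where
  continuousOn i := RCLike.continuous_conj.comp_continuousOn (hs.continuousOn i)
  eq_mul i j b hb hi hj := by
    rw [hs.eq_mul i j b hb hi hj, map_mul]; rfl

open Classical in
/-- The section that is `f` in the frame `i` over `D`, and `s` elsewhere. -/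
noncomputable def patch (Z : FlatLineCocycle S ι) (s : ι → S → ℂ) (D : Set S) (i : ι) (f : S → ℂ) :
    ι → S → ℂ :=
  fun j b => if b ∈ D then Z.C j i b * f b else s j b

theorem patch_of_mem {D : Set S} {i : ι} {f : S → ℂ} {j : ι} {b : S} (hb : b ∈ D) :
    Z.patch s D i f j b = Z.C j i b * f b := if_pos hb

theorem patch_of_notMem {D : Set S} {i : ι} {f : S → ℂ} {j : ι} {b : S} (hb : b ∉ D) :
    Z.patch s D i f j b = s j b := if_neg hb

/-- Off the open set `B` the new values agree with the old ones, so `A \ B` and `D` are closed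
pieces with compatible continuous data. -/
theorem IsSection.patch (hA : IsClosed A) (hs : Z.IsSection s A) {D B : Set S} (hD : IsClosed D)
    (hB : IsOpen B) {i : ι} (hDi : D ⊆ Z.U i) {f : S → ℂ} (hf : ContinuousOn f D)
    (hfs : ∀ b ∈ A, b ∈ D → b ∉ B → f b = s i b) (hBD : B ⊆ D) :
    Z.IsSection (Z.patch s D i f) (A ∪ D) where
  continuousOn j := by
    intro b hb
    have hsub : (A ∪ D) ∩ Z.U j ⊆ (A \ B) ∩ Z.U j ∪ D ∩ Z.U j := by
      rintro x ⟨h1 | h1, h2⟩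
      · by_cases h3 : x ∈ B
        · exact Or.inr ⟨hBD h3, h2⟩
        · exact Or.inl ⟨⟨h1, h3⟩, h2⟩
      · exact Or.inr ⟨h1, h2⟩
    refine ContinuousWithinAt.mono (ContinuousWithinAt.union ?_ ?_) hsub
    · have heq : ∀ x ∈ (A \ B) ∩ Z.U j, Z.patch s D i f j x = s j x := by
        rintro x ⟨⟨h1, h2⟩, h3⟩
        by_cases h4 : x ∈ D
        · rw [patch_of_mem h4, hfs x h1 h4 h2, ← hs.eq_mul j i x h1 h3 (hDi h4)]
        · exact patch_of_notMem h4
      by_cases h : b ∈ A \ B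
      · exact ((hs.continuousOn j b ⟨h.1, hb.2⟩).mono
          (inter_subset_inter_left _ sdiff_subset)).congr heq (heq b ⟨h, hb.2⟩)
      · exact continuousWithinAt_of_notMem_closure fun h' =>
          h ((hA.sdiff hB).closure_subset_iff.2 inter_subset_left h')
    · by_cases h : b ∈ D
      · refine ((Z.continuousAt_C hb.2 (hDi h)).continuousWithinAt.mul
          ((hf b h).mono inter_subset_left)).congr (fun x hx => ?_) ?_
        · exact patch_of_mem hx.1
        · exact patch_of_mem h
      · exact continuousWithinAt_of_notMem_closure fun h' =>
          h (hD.closure_subset_iff.2 inter_subset_left h')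
  eq_mul j k b hb hj hk := by
    by_cases h : b ∈ D
    · rw [patch_of_mem h, patch_of_mem h, ← mul_assoc, Z.mul_C j k i b ⟨⟨hj, hk⟩, hDi h⟩]
    · rw [patch_of_notMem h, patch_of_notMem h]
      exact hs.eq_mul j k b (hb.resolve_right h) hj hk

/-- A section extends over a disc on whose boundary circle it has no zeros, with a single zero
in the disc, at its centre. -/
theorem IsSection.exists_extension [T2Space S] (hA : IsClosed A) (hs : Z.IsSection s A) {i : ι}
    {κ : OpenPartialHomeomorph S ℂ} {c : ℂ} {r : ℝ} (hr : 0 < r)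
    (hκ : Metric.closedBall c r ⊆ κ.target) (hκi : κ.symm '' Metric.closedBall c r ⊆ Z.U i)
    (h0 : ∀ y ∈ Metric.sphere c r, κ.symm y ∉ Z.zeros s A) :
    ∃ s', Z.IsSection s' (A ∪ κ.symm '' Metric.closedBall c r) ∧
      Z.zeros s' (A ∪ κ.symm '' Metric.closedBall c r) ⊆
        Z.zeros s A \ κ.symm '' Metric.closedBall c r ∪ {κ.symm c} := by
  set D := κ.symm '' Metric.closedBall c r
  have hDκ : ∀ b ∈ D, b ∈ κ.source ∧ κ b ∈ Metric.closedBall c r := by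
    rintro _ ⟨y, hy, rfl⟩
    exact ⟨κ.map_target (hκ hy), by rwa [κ.right_inv (hκ hy)]⟩
  have hD : IsClosed D := ((isCompact_closedBall c r).image_of_continuousOn
    (κ.continuousOn_symm.mono hκ)).isClosed
  have hB : IsOpen (κ.symm '' Metric.ball c r) :=
    κ.symm.isOpen_image_of_subset_source Metric.isOpen_ball
      (Metric.ball_subset_closedBall.trans hκ)
  let q : ℂ → ℂ := fun z => c + r * z
  have hq : Continuous q := by fun_prop
  have hqs : ∀ z, q z ∈ Metric.sphere c r ↔ z ∈ Metric.sphere (0 : ℂ) 1 := fun z => by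
    simp only [q, Metric.mem_sphere, dist_self_add_left, dist_zero_right, norm_mul,
      Complex.norm_real, Real.norm_of_nonneg hr.le]
    constructor
    · exact fun h => mul_left_cancel₀ hr.ne' (h.trans (mul_one r).symm)
    · exact fun h => by rw [h, mul_one]
  let T : Set ℂ := Metric.closedBall c r ∩ κ.symm ⁻¹' A
  have hT : IsClosed T := (κ.continuousOn_symm.mono hκ).preimage_isClosed_of_isClosed
    Metric.isClosed_closedBall hA
  -- Only the part of the boundary circle where the section is already defined prescribes values.
  let K : Set ℂ := Metric.sphere 0 1 ∩ q ⁻¹' T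
  have hK : IsClosed K := Metric.isClosed_sphere.inter (hT.preimage hq)
  have hKA : ∀ z ∈ K, κ.symm (q z) ∈ A ∩ Z.U i := fun z hz => ⟨hz.2.2, hκi ⟨_, hz.2.1, rfl⟩⟩
  have hf : ContinuousOn (fun z => s i (κ.symm (q z))) K := by
    refine (hs.continuousOn i).comp ?_ hKA
    exact (κ.continuousOn_symm.mono hκ).comp hq.continuousOn fun z hz => hz.2.1
  obtain ⟨F, hF, hF0, hFK⟩ := Complex.exists_extension_ne_zero hK inter_subset_left hf
    (fun z hz h => h0 (q z) ((hqs z).2 hz.1)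
      ((hs.mem_zeros_iff (hKA z hz).1 (hKA z hz).2).2 h))
  let f : S → ℂ := fun b => F ((r : ℂ)⁻¹ * (κ b - c))
  have hr' : (r : ℂ) ≠ 0 := by exact_mod_cast hr.ne'
  have hqinv : ∀ y, q ((r : ℂ)⁻¹ * (y - c)) = y := fun y => by
    simp only [q]; rw [mul_inv_cancel_left₀ hr']; ring
  have hfc : ContinuousOn f D := by
    refine hF.comp_continuousOn ?_
    exact continuousOn_const.mul ((κ.continuousOn.mono fun b hb => (hDκ b hb).1).sub
      continuousOn_const)
  have hs' := IsSection.patch hA hs hD hB hκi hfc (fun b hbA hbD hbB => by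
    have h1 := hDκ b hbD
    have h2 : κ.symm (κ b) = b := κ.left_inv h1.1
    have h3 : κ b ∈ Metric.sphere c r := by
      refine le_antisymm h1.2 (not_lt.1 fun h => hbB ⟨κ b, h, h2⟩)
    have h4 : (r : ℂ)⁻¹ * (κ b - c) ∈ K := by
      refine ⟨(hqs _).1 (by rwa [hqinv]), ?_⟩
      rw [mem_preimage, hqinv]
      exact ⟨h1.2, by rwa [mem_preimage, h2]⟩
    have h5 := hFK _ h4
    simp only [hqinv, h2] at h5
    exact h5) (image_mono Metric.ball_subset_closedBall)
  refine ⟨_, hs', ?_⟩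
  rintro b ⟨hb, j, hj, hz⟩
  by_cases h : b ∈ D
  · right
    rw [patch_of_mem h] at hz
    have h1 := hF0 _ ?_ ((mul_eq_zero.1 hz).resolve_left (Z.C_ne_zero _ _ _))
    · have h2 := (mul_eq_zero.1 h1).resolve_left (inv_ne_zero hr')
      rw [mem_singleton_iff, ← sub_eq_zero.1 h2, κ.left_inv (hDκ b h).1]
    · have := (hDκ b h).2
      rw [mem_closedBall_iff_norm] at this
      rw [norm_mul, norm_inv, Complex.norm_real, Real.norm_of_nonneg hr.le]
      exact (mul_le_mul_of_nonneg_left this (by positivity)).trans_eq (inv_mul_cancel₀ hr.ne')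
  · left
    rw [patch_of_notMem h] at hz
    exact ⟨⟨hb.resolve_right h, j, hj, hz⟩, h⟩

end FlatLineCocycle

/-- A family of charts that contains arbitrarily small discs around every point. -/
def HasSmallDiscs {S : Type u} [TopologicalSpace S] (𝒦 : Set (OpenPartialHomeomorph S ℂ)) : Prop :=
  ∀ x : S, ∀ N ∈ 𝓝 x, ∃ κ ∈ 𝒦, x ∈ κ.source ∧ κ x = 0 ∧ Metric.closedBall 0 1 ⊆ κ.target ∧
    κ.symm '' Metric.closedBall 0 1 ⊆ N

/-- Each point excludes at most one radius. -/
theorem exists_mem_Ioo_sphere_avoids {S : Type u} [TopologicalSpace S]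
    (κ : OpenPartialHomeomorph S ℂ) {c : ℂ} {a b : ℝ} (hab : a < b)
    (hb : Metric.closedBall c b ⊆ κ.target) {F : Set S} (hF : F.Finite) :
    ∃ r ∈ Ioo a b, ∀ y ∈ Metric.sphere c r, κ.symm y ∉ F := by
  obtain ⟨r, hr, hrF⟩ := (Ioo_infinite hab).exists_notMem_finite
    (hF.image fun x => dist (κ x) c)
  refine ⟨r, hr, fun y hy hyF => hrF ⟨_, hyF, ?_⟩⟩
  beta_reduce
  rw [κ.right_inv (hb (Metric.sphere_subset_closedBall.trans
    (Metric.closedBall_subset_closedBall hr.2.le) hy))]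
  exact hy

namespace FlatLineCocycle

variable {S : Type u} [TopologicalSpace S] [T2Space S] {ι : Type v}
  (Z : FlatLineCocycle S ι) {𝒦 : Set (OpenPartialHomeomorph S ℂ)}

/-- Cover by finitely many half discs and extend over one after another, enlarging each to a radius
whose circle misses the previous zeros; every extension creates at most the zero at its centre. -/
theorem exists_isSection_finite_zeros [CompactSpace S] (h𝒦 : HasSmallDiscs 𝒦) :
    ∃ s, Z.IsSection s univ ∧ (Z.zeros s univ).Finite := by
  choose idx hidx using Z.exists_mem
  choose κ _ hκs hκ0 hκt hκi using fun x => h𝒦 x _ ((Z.isOpen_U (idx x)).mem_nhds (hidx x))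
  have hnhd : ∀ x, (κ x).symm '' Metric.ball 0 (1 / 2) ∈ 𝓝 x := fun x => by
    refine IsOpen.mem_nhds ((κ x).symm.isOpen_image_of_subset_source Metric.isOpen_ball
      ((Metric.ball_subset_ball (by norm_num)).trans
        (Metric.ball_subset_closedBall.trans (hκt x)))) ⟨0, by simp, ?_⟩
    rw [← hκ0 x, (κ x).left_inv (hκs x)]
  obtain ⟨t, ht⟩ := CompactSpace.elim_nhds_subcover _ hnhd
  have key : ∀ t : Finset S, ∃ A : Set S, IsClosed A ∧
      (⋃ x ∈ t, (κ x).symm '' Metric.ball 0 (1 / 2)) ⊆ A ∧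
      ∃ s, Z.IsSection s A ∧ (Z.zeros s A).Finite := by
    classical
    intro t
    induction t using Finset.induction_on with
    | empty =>
      exact ⟨∅, isClosed_empty, by simp, 0, ⟨fun i => by simp, fun i j b hb => hb.elim⟩,
        Set.finite_empty.subset fun b hb => hb.1⟩
    | insert x t _ ih =>
      obtain ⟨A, hA, htA, s, hs, hF⟩ := ih
      obtain ⟨r, hr, hrF⟩ := exists_mem_Ioo_sphere_avoids (κ x) (show (1 / 2 : ℝ) < 1 by norm_num)
        (hκt x) hF
      have hsub := Metric.closedBall_subset_closedBall (x := (0 : ℂ)) hr.2.le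
      obtain ⟨s', hs', hz⟩ := hs.exists_extension hA (i := idx x) (by linarith [hr.1])
        (hsub.trans (hκt x)) ((image_mono hsub).trans (hκi x)) hrF
      refine ⟨_, hA.union (((isCompact_closedBall (0 : ℂ) r).image_of_continuousOn
        ((κ x).continuousOn_symm.mono (hsub.trans (hκt x)))).isClosed), ?_, s', hs',
        ((hF.sdiff).union (finite_singleton _)).subset hz⟩
      rw [Finset.set_biUnion_insert, union_comm]
      exact union_subset_union htA (image_mono ((Metric.ball_subset_ball hr.1.le).trans
        Metric.ball_subset_closedBall))
  obtain ⟨A, -, htA, s, hs, hF⟩ := key t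
  have : A = univ := univ_subset_iff.1 (ht.symm.subset.trans htA)
  subst this
  exact ⟨s, hs, hF⟩

variable [ConnectedSpace S]

/-- Extending afresh over a disc centred at `w'` that contains `w` replaces the zero at `w` by one
at `w'`. Connectedness turns this local move into a global one. -/
theorem exists_isSection_move_zero (h𝒦 : HasSmallDiscs 𝒦) {F : Set S} (hF : F.Finite) (w w' : S)
    (h : ∃ s, Z.IsSection s univ ∧ Z.zeros s univ ⊆ insert w F) :
    ∃ s, Z.IsSection s univ ∧ Z.zeros s univ ⊆ insert w' F := by
  have key : ∀ x : S, ∃ N ∈ 𝓝 x, ∀ w ∈ N, ∀ w' ∈ N,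
      (∃ s, Z.IsSection s univ ∧ Z.zeros s univ ⊆ insert w F) →
      ∃ s, Z.IsSection s univ ∧ Z.zeros s univ ⊆ insert w' F := by
    intro x
    obtain ⟨i, hi⟩ := Z.exists_mem x
    obtain ⟨κ, -, hκs, hκ0, hκt, hκi⟩ := h𝒦 x _ ((Z.isOpen_U i).mem_nhds hi)
    -- Two points of the quarter disc are less than `1 / 2` apart, and a disc of radius at most `3 /
    -- 4` about either stays in the unit disc.
    refine ⟨κ.source ∩ κ ⁻¹' Metric.ball 0 (1 / 4),
      κ.isOpen_inter_preimage Metric.isOpen_ball |>.mem_nhds ⟨hκs, by simp [hκ0]⟩, ?_⟩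
    rintro w ⟨hw, hw4⟩ w' ⟨hw', hw4'⟩ ⟨s, hs, hz⟩
    rw [mem_preimage, mem_ball_zero_iff] at hw4 hw4'
    have hsub : ∀ {r}, r ≤ 3 / 4 → Metric.closedBall (κ w') r ⊆ Metric.closedBall 0 1 :=
      fun hr => Metric.closedBall_subset_closedBall' (by rw [dist_zero_right]; linarith)
    obtain ⟨r, hr, hrF⟩ := exists_mem_Ioo_sphere_avoids κ (c := κ w')
      (show (1 / 2 : ℝ) < 3 / 4 by norm_num) ((hsub le_rfl).trans hκt)
      ((hF.insert w).subset hz)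
    obtain ⟨s', hs', hz'⟩ := hs.exists_extension isClosed_univ (i := i)
      (by linarith [hr.1]) ((hsub hr.2.le).trans hκt) ((image_mono (hsub hr.2.le)).trans hκi) hrF
    rw [univ_union] at hs' hz'
    refine ⟨s', hs', hz'.trans ?_⟩
    rw [κ.left_inv hw']
    rintro b (⟨hb, hbD⟩ | hb)
    · refine (hz hb).elim (fun h => (hbD ⟨κ w, ?_, ?_⟩).elim) Or.inr
      · rw [mem_closedBall_iff_norm]
        have := norm_sub_le (κ w) (κ w')
        linarith [hr.1]
      · rw [κ.left_inv hw, h]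
    · exact Or.inl hb
  refine PreconnectedSpace.induction₂' (fun w w' =>
    (∃ s, Z.IsSection s univ ∧ Z.zeros s univ ⊆ insert w F) →
      ∃ s, Z.IsSection s univ ∧ Z.zeros s univ ⊆ insert w' F) (fun x => ?_)
      ⟨fun _ _ _ h1 h2 h => h2 (h1 h)⟩ w w' h
  obtain ⟨N, hN, h⟩ := key x
  filter_upwards [hN] with y hy
  exact ⟨h x (mem_of_mem_nhds hN) y hy, h y hy x (mem_of_mem_nhds hN)⟩

theorem exists_isSection_zeros_subset_singleton [CompactSpace S] (h𝒦 : HasSmallDiscs 𝒦) :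
    ∃ s x, Z.IsSection s univ ∧ Z.zeros s univ ⊆ {x} := by
  obtain ⟨s, hs, hF⟩ := Z.exists_isSection_finite_zeros h𝒦
  have key : ∀ F : Set S, F.Finite → ∀ x, (∃ s, Z.IsSection s univ ∧ Z.zeros s univ ⊆ insert x F) →
      ∃ s, Z.IsSection s univ ∧ Z.zeros s univ ⊆ {x} := by
    intro F hF
    induction F, hF using Set.Finite.induction_on with
    | empty => simp
    | @insert a F _ hF ih =>
      intro x h
      rw [Set.insert_comm] at h
      obtain ⟨s, hs, hz⟩ := Z.exists_isSection_move_zero h𝒦 (hF.insert x) a x h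
      exact ih x ⟨s, hs, by simpa using hz⟩
  obtain ⟨x⟩ : Nonempty S := inferInstance
  obtain ⟨s, hs, h⟩ := key _ hF x ⟨s, hs, subset_insert _ _⟩
  exact ⟨s, x, hs, h⟩

/-- There is a section which either vanishes nowhere, or vanishes at a single point, where it is a
power of a complex coordinate or of its conjugate. -/
theorem exists_isSection_eq_zpow [CompactSpace S] (h𝒦 : HasSmallDiscs 𝒦) :
    ∃ s, Z.IsSection s univ ∧ (Z.zeros s univ = ∅ ∨
      ∃ κ ∈ 𝒦, Metric.closedBall 0 1 ⊆ κ.target ∧ Z.zeros s univ ⊆ {κ.symm 0} ∧ ∃ i,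
        κ.symm '' Metric.closedBall 0 1 ⊆ Z.U i ∧ ∃ n : ℕ, n ≠ 0 ∧
        ((∀ y ∈ Metric.ball (0 : ℂ) (1 / 2), s i (κ.symm y) = y ^ n) ∨
          ∀ y ∈ Metric.ball (0 : ℂ) (1 / 2), s i (κ.symm y) = starRingEnd ℂ y ^ n)) := by
  obtain ⟨s, x, hs, hz⟩ := Z.exists_isSection_zeros_subset_singleton h𝒦
  obtain ⟨i, hi⟩ := Z.exists_mem x
  obtain ⟨κ, hκ, hκs, hκ0, hκt, hκi⟩ := h𝒦 x _ ((Z.isOpen_U i).mem_nhds hi)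
  have hx : κ.symm 0 = x := by rw [← hκ0, κ.left_inv hκs]
  have hfc : ContinuousOn (fun y => s i (κ.symm y)) (Metric.sphere 0 1) := by
    refine (hs.continuousOn i).comp (κ.continuousOn_symm.mono
      (Metric.sphere_subset_closedBall.trans hκt)) fun y hy => ⟨trivial, hκi ⟨y, ?_, rfl⟩⟩
    exact Metric.sphere_subset_closedBall hy
  obtain ⟨w, k, hk, hfk⟩ := Complex.exists_eq_zpow_mul_exp hfc (fun y hy h => by
    have h1 := hz ((hs.mem_zeros_iff trivial
      (hκi ⟨y, Metric.sphere_subset_closedBall hy, rfl⟩)).2 h)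
    have h2 : κ.symm y = κ.symm 0 := h1.trans hx.symm
    have h3 := κ.symm.injOn (hκt (Metric.sphere_subset_closedBall hy)) (hκt (by simp)) h2
    rw [h3] at hy; simp at hy)
  -- On the unit circle negative powers are powers of the conjugate, which extend continuously over
  -- the centre.
  obtain ⟨n, P, hP, hPw, hPn, hP0⟩ : ∃ (n : ℕ) (P : ℂ → ℂ), Continuous P ∧
      (∀ z ∈ Metric.sphere (0 : ℂ) 1, P z = z ^ w) ∧
      ((∀ y, P y = y ^ n) ∨ ∀ y, P y = starRingEnd ℂ y ^ n) ∧
      ∀ y, P y = 0 → n ≠ 0 ∧ y = 0 := by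
    obtain ⟨n, rfl | rfl⟩ := w.eq_nat_or_neg
    · refine ⟨n, fun z => z ^ n, by fun_prop, by simp, Or.inl fun _ => rfl, fun y hy => ?_⟩
      exact (pow_eq_zero_iff'.1 hy).symm
    · refine ⟨n, fun z => starRingEnd ℂ z ^ n, by fun_prop, fun z hz => ?_, Or.inr fun _ => rfl,
        fun y hy => ?_⟩
      · rw [zpow_neg, zpow_natCast, ← inv_pow, Complex.inv_def, Complex.normSq_eq_norm_sq,
          mem_sphere_zero_iff_norm.1 hz]
        simp
      · obtain ⟨h1, h2⟩ := pow_eq_zero_iff'.1 hy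
        exact ⟨h2, by simpa using h1⟩
  -- The exponential factor is fully present on the unit circle, where `g` matches the section, and
  -- is switched off on the half disc, where `g` is the pure power.
  let g : ℂ → ℂ := fun y => P y *
    Complex.exp ((max 0 (2 * ‖y‖ - 1) : ℝ) * k ((‖y‖ : ℂ)⁻¹ * y))
  have hg_near : ∀ y ∈ Metric.ball (0 : ℂ) (1 / 2), g y = P y := by
    intro y hy
    rw [mem_ball_zero_iff] at hy
    simp only [g]
    rw [max_eq_left (by linarith)]
    simp
  have hg_sphere : ∀ y ∈ Metric.sphere (0 : ℂ) 1, g y = s i (κ.symm y) := by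
    intro y hy
    have h1 := hfk y hy
    rw [mem_sphere_zero_iff_norm] at hy
    rw [h1, ← hPw y (by simpa using hy)]
    simp only [g, hy]
    norm_num
  have hg : Continuous g := by
    rw [continuous_iff_continuousAt]
    intro y
    by_cases hy : y = 0
    · subst hy
      refine hP.continuousAt.congr ?_
      filter_upwards [Metric.ball_mem_nhds (0 : ℂ) (show (0 : ℝ) < 1 / 2 by norm_num)] with y hy
      exact (hg_near y hy).symm
    · have h0 : (‖y‖ : ℂ) ≠ 0 := by simpa using hy
      have h1 : ContinuousOn (fun z : ℂ => (‖z‖ : ℂ)⁻¹ * z) {0}ᶜ := by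
        refine ContinuousOn.mul (ContinuousOn.inv₀ (by fun_prop) ?_) continuousOn_id
        intro z hz
        simpa using hz
      have h2 : ContinuousOn (fun z : ℂ => k ((‖z‖ : ℂ)⁻¹ * z)) {0}ᶜ := by
        refine hk.comp h1 fun z hz => ?_
        rw [mem_sphere_zero_iff_norm, norm_mul, norm_inv, Complex.norm_real, norm_norm,
          inv_mul_cancel₀ (by simpa using hz)]
      have h3 := h2.continuousAt (isOpen_compl_singleton.mem_nhds hy)
      refine hP.continuousAt.mul (ContinuousAt.cexp (ContinuousAt.mul ?_ h3))
      fun_prop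
  have hg0 : ∀ y, g y = 0 → n ≠ 0 ∧ y = 0 := fun y hy =>
    hP0 y ((mul_eq_zero.1 hy).resolve_right (Complex.exp_ne_zero _))
  set D := κ.symm '' Metric.closedBall 0 1
  have hDκ : ∀ b ∈ D, b ∈ κ.source ∧ κ b ∈ Metric.closedBall 0 1 := by
    rintro _ ⟨y, hy, rfl⟩
    exact ⟨κ.map_target (hκt hy), by rwa [κ.right_inv (hκt hy)]⟩
  have hs' := hs.patch isClosed_univ (D := D) (B := κ.symm '' Metric.ball 0 1) (i := i)
    (f := fun b => g (κ b))
    ((isCompact_closedBall (0 : ℂ) 1).image_of_continuousOn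
      (κ.continuousOn_symm.mono hκt)).isClosed
    (κ.symm.isOpen_image_of_subset_source Metric.isOpen_ball
      (Metric.ball_subset_closedBall.trans hκt)) hκi
    (hg.comp_continuousOn (κ.continuousOn.mono fun b hb => (hDκ b hb).1))
    (fun b _ hbD hbB => by
      have h1 := hDκ b hbD
      have h2 : κ.symm (κ b) = b := κ.left_inv h1.1
      have h3 : κ b ∈ Metric.sphere 0 1 :=
        le_antisymm h1.2 (not_lt.1 fun h => hbB ⟨κ b, h, h2⟩)
      rw [hg_sphere _ h3, h2]) (image_mono Metric.ball_subset_closedBall)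
  rw [univ_union] at hs'
  have hz' : ∀ b ∈ Z.zeros (Z.patch s D i fun b => g (κ b)) univ, n ≠ 0 ∧ b = x := by
    rintro b ⟨-, j, hj, h⟩
    by_cases hb : b ∈ D
    · rw [patch_of_mem hb] at h
      obtain ⟨h1, h2⟩ := hg0 _ ((mul_eq_zero.1 h).resolve_left (Z.C_ne_zero _ _ _))
      exact ⟨h1, by rw [← hx, ← h2, κ.left_inv (hDκ b hb).1]⟩
    · rw [patch_of_notMem hb] at h
      have : b = x := hz ⟨trivial, j, hj, h⟩
      exact (hb ⟨0, by simp, hx.trans this.symm⟩).elim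
  refine ⟨_, hs', ?_⟩
  by_cases hn : n = 0
  · exact Or.inl (eq_empty_of_forall_notMem fun b hb => (hz' b hb).1 hn)
  · refine Or.inr ⟨κ, hκ, hκt, fun b hb => ?_, i, hκi, n, hn, ?_⟩
    · rw [hx]; exact (hz' b hb).2
    · have hval : ∀ y ∈ Metric.ball (0 : ℂ) (1 / 2),
          Z.patch s D i (fun b => g (κ b)) i (κ.symm y) = P y := by
        intro y hy
        have hy1 : y ∈ Metric.closedBall (0 : ℂ) 1 :=
          Metric.ball_subset_closedBall (Metric.ball_subset_ball (by norm_num) hy)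
        have hyD : κ.symm y ∈ D := ⟨y, hy1, rfl⟩
        rw [patch_of_mem hyD, Z.C_self (hκi ⟨y, hy1, rfl⟩), one_mul,
          κ.right_inv (hκt hy1), hg_near y hy]
      exact hPn.imp (fun h y hy => (hval y hy).trans (h y))
        (fun h y hy => (hval y hy).trans (h y))

end FlatLineCocycle

end

/-! ### Oriented complex charts with small discs -/

section

/-- A family of charts of a smooth surface with values in `ℂ`, compatible with the smooth structure
and with each other, whose coordinate changes preserve the orientation. -/
structure IsOrientedAtlas {S : Type u} [TopologicalSpace S]
    [ChartedSpace (EuclideanSpace ℝ (Fin 2)) S] (𝒦 : Set (OpenPartialHomeomorph S ℂ)) : Prop where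
  contDiffOn_trans : ∀ κ ∈ 𝒦, ∀ κ' ∈ 𝒦,
    ContDiffOn ℝ ∞ (κ.symm.trans κ') (κ.symm.trans κ').source
  det_pos : ∀ κ ∈ 𝒦, ∀ κ' ∈ 𝒦, ∀ y ∈ (κ.symm.trans κ').source,
    0 < (fderiv ℝ (κ.symm.trans κ') y).det
  contDiffOn_comp : ∀ κ ∈ 𝒦, ∀ f : S → ℝ, ContMDiff (𝓡 2) 𝓘(ℝ, ℝ) ∞ f →
    ContDiffOn ℝ ∞ (f ∘ κ.symm) κ.target

/-- The similarity of the Euclidean plane with the complex plane that takes `y` to zero and divides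
lengths by `r`. -/
noncomputable def planeSimilarity (y : EuclideanSpace ℝ (Fin 2)) (r : ℝ) (hr : 0 < r) :
    EuclideanSpace ℝ (Fin 2) ≃ₜ ℂ :=
  (Homeomorph.subRight y).trans
    (Complex.orthonormalBasisOneI.repr.symm.toHomeomorph.trans
      (Homeomorph.smulOfNeZero r⁻¹ (inv_ne_zero hr.ne')))

theorem planeSimilarity_apply (y : EuclideanSpace ℝ (Fin 2)) (r : ℝ) (hr : 0 < r)
    (z : EuclideanSpace ℝ (Fin 2)) :
    planeSimilarity y r hr z = r⁻¹ • Complex.orthonormalBasisOneI.repr.symm (z - y) := rfl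

theorem planeSimilarity_symm_apply (y : EuclideanSpace ℝ (Fin 2)) (r : ℝ) (hr : 0 < r) (z : ℂ) :
    (planeSimilarity y r hr).symm z = Complex.orthonormalBasisOneI.repr (r • z) + y := by
  rw [Homeomorph.symm_apply_eq, planeSimilarity_apply]
  simp [hr.ne']

theorem hasFDerivAt_planeSimilarity (y : EuclideanSpace ℝ (Fin 2)) (r : ℝ) (hr : 0 < r)
    (z : EuclideanSpace ℝ (Fin 2)) :
    HasFDerivAt (planeSimilarity y r hr)
      (r⁻¹ • (Complex.orthonormalBasisOneI.repr.symm.toContinuousLinearEquiv :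
        EuclideanSpace ℝ (Fin 2) →L[ℝ] ℂ)) z := by
  have h := (Complex.orthonormalBasisOneI.repr.symm.toContinuousLinearEquiv :
        EuclideanSpace ℝ (Fin 2) →L[ℝ] ℂ).hasFDerivAt.comp z ((hasFDerivAt_id z).sub_const y)
  exact h.const_smul r⁻¹

theorem hasFDerivAt_planeSimilarity_symm (y : EuclideanSpace ℝ (Fin 2)) (r : ℝ) (hr : 0 < r)
    (z : ℂ) :
    HasFDerivAt (planeSimilarity y r hr).symm
      (r • (Complex.orthonormalBasisOneI.repr.toContinuousLinearEquiv :
        ℂ →L[ℝ] EuclideanSpace ℝ (Fin 2))) z := by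
  have h := ((Complex.orthonormalBasisOneI.repr.toContinuousLinearEquiv :
        ℂ →L[ℝ] EuclideanSpace ℝ (Fin 2)).hasFDerivAt (x := z)).const_smul r |>.add_const y
  refine h.congr_of_eventuallyEq (Filter.Eventually.of_forall fun z => ?_)
  rw [planeSimilarity_symm_apply, map_smul]
  rfl

theorem contDiff_planeSimilarity (y : EuclideanSpace ℝ (Fin 2)) (r : ℝ) (hr : 0 < r) :
    ContDiff ℝ ∞ (planeSimilarity y r hr) :=
  ((Complex.orthonormalBasisOneI.repr.symm.toContinuousLinearEquiv.contDiff).comp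
    (contDiff_id.sub contDiff_const)).const_smul r⁻¹

theorem contDiff_planeSimilarity_symm (y : EuclideanSpace ℝ (Fin 2)) (r : ℝ) (hr : 0 < r) :
    ContDiff ℝ ∞ (planeSimilarity y r hr).symm := by
  have h : ContDiff ℝ ∞ fun z : ℂ => Complex.orthonormalBasisOneI.repr (r • z) + y :=
    (Complex.orthonormalBasisOneI.repr.toContinuousLinearEquiv.contDiff.comp
      (contDiff_id.const_smul r)).add contDiff_const
  convert h using 1
  ext1 z
  exact planeSimilarity_symm_apply y r hr z

/-- Oriented charts are followed by similarities onto the complex plane. All of them use the same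
isometry, so a coordinate change is conjugated and scaled by a positive factor and its determinant
stays positive. -/
theorem exists_isOrientedAtlas {S : Type u} [TopologicalSpace S]
    [ChartedSpace (EuclideanSpace ℝ (Fin 2)) S] [IsManifold (𝓡 2) ∞ S]
    (hS : IsOrientableSurface S) :
    ∃ 𝒦 : Set (OpenPartialHomeomorph S ℂ), IsOrientedAtlas 𝒦 ∧
      HasSmallDiscs 𝒦 := by
  obtain ⟨A, hA, hcov, hdet⟩ := hS
  have hsmooth : ∀ e ∈ A, ∀ e' ∈ A, ContDiffOn ℝ ∞ (e.symm.trans e') (e.symm.trans e').source :=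
    fun e he e' he' => contMDiffOn_iff_contDiffOn.1 (contMDiffOn_of_mem_contDiffGroupoid
      (StructureGroupoid.compatible_of_mem_maximalAtlas (hA he) (hA he')))
  let 𝒦 : Set (OpenPartialHomeomorph S ℂ) := {κ | ∃ e ∈ A, ∃ y r, ∃ hr : 0 < r,
    κ = e.transHomeomorph (planeSimilarity y r hr)}
  have hmaps : ∀ (e e' : OpenPartialHomeomorph S (EuclideanSpace ℝ (Fin 2))) (y y' r r')
      (hr : 0 < r) (hr' : 0 < r'), ∀ z ∈ ((e.transHomeomorph (planeSimilarity y r hr)).symm.trans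
        (e'.transHomeomorph (planeSimilarity y' r' hr'))).source,
        (planeSimilarity y r hr).symm z ∈ (e.symm.trans e').source := by
    intro e e' y y' r r' hr hr' z hz
    exact hz
  refine ⟨𝒦, ⟨?_, ?_, ?_⟩, ?_⟩
  · rintro _ ⟨e, he, y, r, hr, rfl⟩ _ ⟨e', he', y', r', hr', rfl⟩
    exact (contDiff_planeSimilarity y' r' hr').comp_contDiffOn
      ((hsmooth e he e' he').comp (contDiff_planeSimilarity_symm y r hr).contDiffOn
        (hmaps e e' y y' r r' hr hr'))
  · rintro _ ⟨e, he, y, r, hr, rfl⟩ _ ⟨e', he', y', r', hr', rfl⟩ z hz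
    have hz' := hmaps e e' y y' r r' hr hr' z hz
    have h1 := ((hsmooth e he e' he').contDiffAt
      ((e.symm.trans e').open_source.mem_nhds hz')).differentiableAt (by simp)
    have h2 := (hasFDerivAt_planeSimilarity y' r' hr' _).comp z
      (h1.hasFDerivAt.comp z (hasFDerivAt_planeSimilarity_symm y r hr z))
    have h3 := hdet e he e' he' _ hz'
    have h4 : fderiv ℝ ((e.transHomeomorph (planeSimilarity y r hr)).symm.trans
        (e'.transHomeomorph (planeSimilarity y' r' hr'))) z = _ := h2.fderiv
    rw [h4]
    generalize fderiv ℝ (e.symm.trans e') ((planeSimilarity y r hr).symm z) = D at h3 ⊢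
    have h5 : (((r'⁻¹ • (Complex.orthonormalBasisOneI.repr.symm.toContinuousLinearEquiv :
        EuclideanSpace ℝ (Fin 2) →L[ℝ] ℂ)).comp (D.comp
        (r • (Complex.orthonormalBasisOneI.repr.toContinuousLinearEquiv :
        ℂ →L[ℝ] EuclideanSpace ℝ (Fin 2)))) : ℂ →L[ℝ] ℂ) : ℂ →ₗ[ℝ] ℂ) =
        (r * r'⁻¹) • ((Complex.orthonormalBasisOneI.repr.symm.toLinearEquiv :
        EuclideanSpace ℝ (Fin 2) →ₗ[ℝ] ℂ) ∘ₗ (D : _ →ₗ[ℝ] _) ∘ₗ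
        (Complex.orthonormalBasisOneI.repr.symm.toLinearEquiv.symm :
        ℂ →ₗ[ℝ] EuclideanSpace ℝ (Fin 2))) := by
      ext1 w
      simp only [ContinuousLinearMap.coe_coe, ContinuousLinearMap.comp_apply,
        smul_apply, map_smul]
      rw [LinearMap.smul_apply, mul_smul]
      rfl
    rw [ContinuousLinearMap.det, h5, LinearMap.det_smul, LinearMap.det_conj]
    exact mul_pos (by positivity) h3
  · rintro _ ⟨e, he, y, r, hr, rfl⟩ f hf
    have h1 : ContDiffOn ℝ ∞ (f ∘ e.symm) e.target := contMDiffOn_iff_contDiffOn.1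
      (hf.comp_contMDiffOn (contMDiffOn_symm_of_mem_maximalAtlas (hA he)))
    exact h1.comp (contDiff_planeSimilarity_symm y r hr).contDiffOn fun z hz => hz
  · intro x N hN
    obtain ⟨e, he, hx⟩ := hcov x
    have h1 : e.target ∩ e.symm ⁻¹' N ∈ 𝓝 (e x) := Filter.inter_mem
      (e.open_target.mem_nhds (e.map_source hx))
      ((e.continuousAt_symm (e.map_source hx)).preimage_mem_nhds (by rwa [e.left_inv hx]))
    obtain ⟨r, hr, hball⟩ := Metric.nhds_basis_closedBall.mem_iff.1 h1
    have h2 : ∀ z ∈ Metric.closedBall (0 : ℂ) 1,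
        (planeSimilarity (e x) r hr).symm z ∈ Metric.closedBall (e x) r := by
      intro z hz
      rw [planeSimilarity_symm_apply, mem_closedBall_iff_norm, add_sub_cancel_right,
        LinearIsometryEquiv.norm_map, norm_smul, Real.norm_of_nonneg hr.le]
      exact mul_le_of_le_one_right hr.le (by simpa using hz)
    refine ⟨_, ⟨e, he, e x, r, hr, rfl⟩, hx, ?_, fun z hz => (hball (h2 z hz)).1, ?_⟩
    · change planeSimilarity (e x) r hr (e x) = 0
      simp [planeSimilarity_apply]
    · rintro _ ⟨z, hz, rfl⟩
      exact (hball (h2 z hz)).2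

end

/-! ### Exterior derivatives and integrals in the plane -/

section

open MeasureTheory

/-- The exterior derivative of a differential form of degree one on the plane. -/
noncomputable def planeCurl (η : ℂ → ℂ →L[ℝ] ℝ) (y : ℂ) : ℝ :=
  fderiv ℝ η y 1 Complex.I - fderiv ℝ η y Complex.I 1

theorem planeCurl_congr {η η' : ℂ → ℂ →L[ℝ] ℝ} {y : ℂ} (h : η =ᶠ[𝓝 y] η') :
    planeCurl η y = planeCurl η' y := by
  rw [planeCurl, planeCurl, h.fderiv_eq]

theorem planeCurl_eq_zero {η : ℂ → ℂ →L[ℝ] ℝ} {y : ℂ} (h : ∀ᶠ z in 𝓝 y, η z = 0) :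
    planeCurl η y = 0 := by
  rw [planeCurl_congr (η' := fun _ => 0) h]
  simp [planeCurl]

theorem planeCurl_sum {ι : Type*} (t : Finset ι) {η : ι → ℂ → ℂ →L[ℝ] ℝ} {y : ℂ}
    (h : ∀ i ∈ t, DifferentiableAt ℝ (η i) y) :
    planeCurl (fun z => ∑ i ∈ t, η i z) y = ∑ i ∈ t, planeCurl (η i) y := by
  simp only [planeCurl]
  rw [fderiv_fun_sum h, Finset.sum_sub_distrib]
  simp

theorem det_eq_re_mul_im (M : ℂ →L[ℝ] ℂ) :
    M.det = (M 1).re * (M Complex.I).im - (M Complex.I).re * (M 1).im := by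
  rw [ContinuousLinearMap.det, ← LinearMap.det_toMatrix Complex.basisOneI, Matrix.det_fin_two]
  simp [LinearMap.toMatrix_apply]

/-- Naturality of the exterior derivative: the second derivatives of `τ` cancel by symmetry, and
antisymmetrizing a bilinear form on the plane produces the determinant. -/
theorem planeCurl_pullback {η θ : ℂ → ℂ →L[ℝ] ℝ} {τ : ℂ → ℂ} {y : ℂ} (hτ : ContDiffAt ℝ 2 τ y)
    (hη : DifferentiableAt ℝ η (τ y))
    (h : ∀ᶠ z in 𝓝 y, θ z = (η (τ z)).comp (fderiv ℝ τ z)) :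
    planeCurl θ y = (fderiv ℝ τ y).det * planeCurl η (τ y) := by
  have h1 : DifferentiableAt ℝ τ y := hτ.differentiableAt (by simp)
  have h2 : DifferentiableAt ℝ (fderiv ℝ τ) y :=
    (hτ.fderiv_right (m := 1) (by norm_num)).differentiableAt (by simp)
  have hsymm : IsSymmSndFDerivAt ℝ τ y := hτ.isSymmSndFDerivAt (by simp)
  have h3 := (hη.hasFDerivAt.comp y h1.hasFDerivAt).clm_comp h2.hasFDerivAt
  have h4 := (h3.congr_of_eventuallyEq (f₁ := θ) h).fderiv
  rw [planeCurl, h4, det_eq_re_mul_im, planeCurl]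
  have h5 := hsymm.eq 1 Complex.I
  generalize fderiv ℝ τ y = M at *
  generalize fderiv ℝ η (τ y) = B at *
  have expand : ∀ z : ℂ, z = z.re • (1 : ℂ) + z.im • Complex.I := fun z => by
    simp
  simp only [add_apply, ContinuousLinearMap.comp_apply,
    ContinuousLinearMap.compL_apply, ContinuousLinearMap.flip_apply, Function.comp]
  rw [h5]
  have h6 : B (M 1) (M Complex.I) - B (M Complex.I) (M 1) =
      ((M 1).re * (M Complex.I).im - (M Complex.I).re * (M 1).im) *
        (B 1 Complex.I - B Complex.I 1) := by
    conv_lhs => rw [expand (M 1), expand (M Complex.I)]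
    simp only [map_add, map_smul, add_apply, smul_apply,
      smul_eq_mul]
    ring
  rw [← h6]
  ring

/-- Integration by parts against the constant one. -/
theorem integral_fderiv_apply_eq_zero {g : ℂ → ℝ} (hg : ContDiff ℝ 1 g) (hc : HasCompactSupport g)
    (v : ℂ) : ∫ y, fderiv ℝ g y v = 0 := by
  have hd : Continuous fun y => fderiv ℝ g y v :=
    (hg.continuous_fderiv (by simp)).clm_apply continuous_const
  have h := integral_mul_fderiv_eq_neg_fderiv_mul_of_integrable (μ := (volume : Measure ℂ))
    (f := fun _ => (1 : ℝ)) (g := g) (v := v) (by simp)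
    (by simpa using hd.integrable_of_hasCompactSupport (hc.fderiv_apply (𝕜 := ℝ) v))
    (by simpa using hg.continuous.integrable_of_hasCompactSupport hc)
    (by simp) (fun x _ => hg.differentiable (by simp) x)
  simpa using h

/-- Stokes in the plane: each term is a directional derivative of a function of compact support. -/
theorem integral_planeCurl {η : ℂ → ℂ →L[ℝ] ℝ} (hη : ContDiff ℝ 1 η) (hc : HasCompactSupport η) :
    ∫ y, planeCurl η y = 0 := by
  have key : ∀ v, ContDiff ℝ 1 (fun y => η y v) ∧ HasCompactSupport (fun y => η y v) ∧
      ∀ y w, fderiv ℝ (fun y => η y v) y w = fderiv ℝ η y w v := fun v => by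
    refine ⟨hη.clm_apply contDiff_const, hc.comp_left (g := fun L : ℂ →L[ℝ] ℝ => L v) (by simp),
      fun y w => ?_⟩
    rw [((hη.differentiable (by simp) y).hasFDerivAt.clm_apply (hasFDerivAt_const v y)).fderiv]
    simp
  have hint : ∀ v w, Integrable (fun y => fderiv ℝ η y w v) := fun v w => by
    obtain ⟨h1, h2, h3⟩ := key v
    simp only [← h3]
    exact ((h1.continuous_fderiv (by simp)).clm_apply
      continuous_const).integrable_of_hasCompactSupport (h2.fderiv_apply (𝕜 := ℝ) w)
  have hzero : ∀ v w, ∫ y, fderiv ℝ η y w v = 0 := fun v w => by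
    obtain ⟨h1, h2, h3⟩ := key v
    simp only [← h3]
    exact integral_fderiv_apply_eq_zero h1 h2 w
  simp only [planeCurl]
  rw [integral_sub (hint _ _) (hint _ _), hzero, hzero, sub_zero]

theorem continuousOn_planeCurl {η : ℂ → ℂ →L[ℝ] ℝ} {V : Set ℂ} (hV : IsOpen V)
    (hη : ContDiffOn ℝ 1 η V) : ContinuousOn (planeCurl η) V := by
  have h := hη.continuousOn_fderiv_of_isOpen hV le_rfl
  exact ((h.clm_apply continuousOn_const).clm_apply continuousOn_const).sub
    ((h.clm_apply continuousOn_const).clm_apply continuousOn_const)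

/-- Change of variables for densities in two charts, under an orientation preserving
coordinate change. -/
theorem setIntegral_target_eq {S : Type u} [TopologicalSpace S]
    {κ κ' : OpenPartialHomeomorph S ℂ} {F F' : ℂ → ℝ}
    (hsm : ∀ y ∈ (κ.symm.trans κ').source, DifferentiableAt ℝ (κ.symm.trans κ') y)
    (hdet : ∀ y ∈ (κ.symm.trans κ').source, 0 < (fderiv ℝ (κ.symm.trans κ') y).det)
    (hF : ∀ y ∈ κ.target, κ.symm y ∉ κ'.source → F y = 0)
    (hF' : ∀ y ∈ κ'.target, κ'.symm y ∉ κ.source → F' y = 0)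
    (h : ∀ y ∈ (κ.symm.trans κ').source,
      F y = (fderiv ℝ (κ.symm.trans κ') y).det * F' (κ.symm.trans κ' y)) :
    ∫ y in κ.target, F y = ∫ y in κ'.target, F' y := by
  have h1 : (κ.symm.trans κ').source = κ.target ∩ κ.symm ⁻¹' κ'.source := by
    simp
  have h2 : (κ.symm.trans κ').target = κ'.target ∩ κ'.symm ⁻¹' κ.source := by
    simp
  rw [setIntegral_eq_of_subset_of_forall_sdiff_eq_zero κ.open_target.measurableSet
      (show (κ.symm.trans κ').source ⊆ κ.target from h1 ▸ inter_subset_left)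
      (fun y hy => hF y hy.1 fun h' => hy.2 (h1 ▸ ⟨hy.1, h'⟩)),
    setIntegral_eq_of_subset_of_forall_sdiff_eq_zero κ'.open_target.measurableSet
      (show (κ.symm.trans κ').target ⊆ κ'.target from h2 ▸ inter_subset_left)
      (fun y hy => hF' y hy.1 fun h' => hy.2 (h2 ▸ ⟨hy.1, h'⟩)),
    integral_target_eq_integral_abs_det_fderiv_smul volume
      (fun y hy => (hsm y hy).hasFDerivAt)]
  refine setIntegral_congr_fun (κ.symm.trans κ').open_source.measurableSet fun y hy => ?_
  rw [h y hy, abs_of_pos (hdet y hy), smul_eq_mul]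

theorem integrableOn_target {S : Type u} [TopologicalSpace S] {κ : OpenPartialHomeomorph S ℂ}
    {K : Set S} (hK : IsCompact K) (hKκ : K ⊆ κ.source) {F : ℂ → ℝ}
    (hF : ContinuousOn F κ.target) (h0 : ∀ y ∈ κ.target, κ.symm y ∉ K → F y = 0) :
    IntegrableOn F κ.target := by
  have hK' : IsCompact (κ '' K) := hK.image_of_continuousOn (κ.continuousOn.mono hKκ)
  have hsub : κ '' K ⊆ κ.target := by
    rintro _ ⟨b, hb, rfl⟩
    exact κ.map_source (hKκ hb)
  refine IntegrableOn.of_forall_sdiff_eq_zero ((hF.mono hsub).integrableOn_compact hK')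
    κ.open_target.measurableSet fun y hy => h0 y hy.1 fun h => hy.2 ⟨_, h, κ.right_inv hy.1⟩

end

/-! ### One-forms on a surface and Stokes' theorem -/

section

open MeasureTheory

/-- A differential form of degree one on a surface, given by its expressions in charts. -/
structure IsOneForm {S : Type u} [TopologicalSpace S] (𝒦 : Set (OpenPartialHomeomorph S ℂ))
    (θ : OpenPartialHomeomorph S ℂ → ℂ → ℂ →L[ℝ] ℝ) : Prop where
  contDiffOn : ∀ κ ∈ 𝒦, ContDiffOn ℝ 1 (θ κ) κ.target
  pullback : ∀ κ ∈ 𝒦, ∀ κ' ∈ 𝒦, ∀ y ∈ (κ.symm.trans κ').source,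
    θ κ y = (θ κ' (κ.symm.trans κ' y)).comp (fderiv ℝ (κ.symm.trans κ') y)

theorem planeCurl_smul_eq_zero {S : Type u} [TopologicalSpace S] {κ : OpenPartialHomeomorph S ℂ} {f : S → ℝ} {y : ℂ}
    (hy : y ∈ κ.target) (hf : κ.symm y ∉ tsupport f) (η : ℂ → ℂ →L[ℝ] ℝ) :
    planeCurl (fun y => f (κ.symm y) • η y) y = 0 := by
  refine planeCurl_eq_zero ?_
  have h1 : {b | f b = 0} ∈ 𝓝 (κ.symm y) := by
    filter_upwards [(isClosed_tsupport f).isOpen_compl.mem_nhds hf] with b hb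
    exact image_eq_zero_of_notMem_tsupport hb
  filter_upwards [(κ.continuousAt_symm hy).preimage_mem_nhds h1] with z hz
  rw [show f (κ.symm z) = 0 from hz, zero_smul]

theorem exists_finite_smoothPartitionOfUnity {S : Type u} [TopologicalSpace S]
    [ChartedSpace (EuclideanSpace ℝ (Fin 2)) S] [IsManifold (𝓡 2) ∞ S] [CompactSpace S] [T2Space S]
    (W : S → Set S) (hW : ∀ x, IsOpen (W x)) (hxW : ∀ x, x ∈ W x) :
    ∃ (t : Finset S) (χ : SmoothPartitionOfUnity t (𝓡 2) S),
      χ.IsSubordinate (fun x => W x) ∧ ∀ b, ∑ k, χ k b = 1 := by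
  obtain ⟨t, ht⟩ := CompactSpace.elim_nhds_subcover W fun x => (hW x).mem_nhds (hxW x)
  obtain ⟨χ, hχ⟩ := SmoothPartitionOfUnity.exists_isSubordinate (𝓡 2) (s := (univ : Set S))
    isClosed_univ (fun x : t => W x) (fun x => hW x) (by
      intro b _
      have : b ∈ ⋃ x ∈ t, W x := ht ▸ mem_univ b
      simpa using this)
  refine ⟨t, χ, hχ, fun b => ?_⟩
  rw [← finsum_eq_sum_of_fintype]
  exact χ.sum_eq_one (mem_univ b)

section

variable {S : Type u} [TopologicalSpace S] [ChartedSpace (EuclideanSpace ℝ (Fin 2)) S]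
  {𝒦 : Set (OpenPartialHomeomorph S ℂ)} {θ : OpenPartialHomeomorph S ℂ → ℂ → ℂ →L[ℝ] ℝ}

theorem IsOneForm.planeCurl_eq (h𝒦 : IsOrientedAtlas 𝒦) (hθ : IsOneForm 𝒦 θ)
    {κ κ' : OpenPartialHomeomorph S ℂ} (hκ : κ ∈ 𝒦) (hκ' : κ' ∈ 𝒦) {y : ℂ}
    (hy : y ∈ (κ.symm.trans κ').source) :
    planeCurl (θ κ) y =
      (fderiv ℝ (κ.symm.trans κ') y).det * planeCurl (θ κ') (κ.symm.trans κ' y) := by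
  have hn := (κ.symm.trans κ').open_source.mem_nhds hy
  have ht : κ.symm.trans κ' y ∈ κ'.target := ((κ.symm.trans κ').map_source hy).1
  refine planeCurl_pullback
    (((h𝒦.contDiffOn_trans κ hκ κ' hκ').contDiffAt hn).of_le (by norm_cast))
    (((hθ.contDiffOn κ' hκ').contDiffAt (κ'.open_target.mem_nhds ht)).differentiableAt (by simp)) ?_
  filter_upwards [hn] with z hz
  exact hθ.pullback κ hκ κ' hκ' z hz

theorem IsOneForm.smul (h𝒦 : IsOrientedAtlas 𝒦) (hθ : IsOneForm 𝒦 θ) {f : S → ℝ}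
    (hf : ContMDiff (𝓡 2) 𝓘(ℝ, ℝ) ∞ f) :
    IsOneForm 𝒦 (fun κ y => f (κ.symm y) • θ κ y) where
  contDiffOn κ hκ := ((h𝒦.contDiffOn_comp κ hκ f hf).of_le
    (by norm_cast)).smul (hθ.contDiffOn κ hκ)
  pullback κ hκ κ' hκ' y hy := by
    have h1 : κ'.symm (κ.symm.trans κ' y) = κ.symm y := κ'.left_inv (by simpa using hy.2)
    rw [hθ.pullback κ hκ κ' hκ' y hy, h1, ContinuousLinearMap.smul_comp]

/-- The cut-off form has compact support in the chart, so it extends by zero to the plane. -/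
theorem setIntegral_planeCurl_smul [CompactSpace S] [T2Space S] (h𝒦 : IsOrientedAtlas 𝒦)
    (hθ : IsOneForm 𝒦 θ) {f : S → ℝ} (hf : ContMDiff (𝓡 2) 𝓘(ℝ, ℝ) ∞ f)
    {κ : OpenPartialHomeomorph S ℂ} (hκ : κ ∈ 𝒦) (hfκ : tsupport f ⊆ κ.source) :
    ∫ y in κ.target, planeCurl (fun y => f (κ.symm y) • θ κ y) y = 0 := by
  classical
  have hK : IsCompact (κ '' tsupport f) :=
    (isClosed_tsupport f).isCompact.image_of_continuousOn (κ.continuousOn.mono hfκ)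
  have hsub : κ '' tsupport f ⊆ κ.target := by
    rintro _ ⟨b, hb, rfl⟩
    exact κ.map_source (hfκ hb)
  let η : ℂ → ℂ →L[ℝ] ℝ := κ.target.indicator fun y => f (κ.symm y) • θ κ y
  have h0 : ∀ y ∉ κ '' tsupport f, η y = 0 := by
    intro y hy
    by_cases h : y ∈ κ.target
    · simp only [η, indicator_of_mem h]
      rw [image_eq_zero_of_notMem_tsupport fun h' => hy ⟨_, h', κ.right_inv h⟩, zero_smul]
    · exact indicator_of_notMem h _
  have hev : ∀ y ∈ κ.target, η =ᶠ[𝓝 y] fun y => f (κ.symm y) • θ κ y := fun y hy => by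
    filter_upwards [κ.open_target.mem_nhds hy] with z hz
    exact indicator_of_mem hz _
  have hη : ContDiff ℝ 1 η := by
    rw [contDiff_iff_contDiffAt]
    intro y
    by_cases hy : y ∈ κ '' tsupport f
    · exact (((hθ.smul h𝒦 hf).contDiffOn κ hκ).contDiffAt
        (κ.open_target.mem_nhds (hsub hy))).congr_of_eventuallyEq (hev y (hsub hy))
    · refine (contDiffAt_const (c := 0)).congr_of_eventuallyEq ?_
      filter_upwards [hK.isClosed.isOpen_compl.mem_nhds hy] with z hz
      exact h0 z hz
  have hc : HasCompactSupport η := HasCompactSupport.intro hK h0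
  have h1 : ∀ y ∉ κ.target, planeCurl η y = 0 := fun y hy => by
    refine planeCurl_eq_zero ?_
    filter_upwards [hK.isClosed.isOpen_compl.mem_nhds fun h => hy (hsub h)] with z hz
    exact h0 z hz
  rw [← integral_planeCurl hη hc, ← setIntegral_eq_integral_of_forall_compl_eq_zero h1]
  exact setIntegral_congr_fun κ.open_target.measurableSet fun y hy =>
    (planeCurl_congr (hev y hy)).symm

/-- On a compact oriented surface, a form of degree one whose exterior derivative is nonnegative
is closed. -/
theorem IsOneForm.planeCurl_eq_zero_of_nonneg [CompactSpace S] [T2Space S]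
    [IsManifold (𝓡 2) ∞ S] (h𝒦 : IsOrientedAtlas 𝒦) (hcov : ∀ x, ∃ κ ∈ 𝒦, x ∈ κ.source)
    (hθ : IsOneForm 𝒦 θ) (hpos : ∀ κ ∈ 𝒦, ∀ y ∈ κ.target, 0 ≤ planeCurl (θ κ) y)
    {κ : OpenPartialHomeomorph S ℂ} (hκ : κ ∈ 𝒦) {y : ℂ} (hy : y ∈ κ.target) :
    planeCurl (θ κ) y = 0 := by
  choose c hc hcs using hcov
  obtain ⟨t, χ, hχ, hsum⟩ := exists_finite_smoothPartitionOfUnity (fun x => (c x).source)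
    (fun x => (c x).open_source) hcs
  have hχs : ∀ k, ContMDiff (𝓡 2) 𝓘(ℝ, ℝ) ∞ (χ k) := fun k => (χ k).contMDiff
  have hχ0 : ∀ (k : t) b, b ∉ (c k).source → χ k b = 0 := fun k b hb =>
    image_eq_zero_of_notMem_tsupport fun h => hb (hχ k h)
  let D : t → OpenPartialHomeomorph S ℂ → ℂ → ℝ := fun k κ =>
    planeCurl fun y => χ k (κ.symm y) • θ κ y
  have hDc : ∀ k, ∀ κ ∈ 𝒦, ContinuousOn (D k κ) κ.target := fun k κ hκ =>
    continuousOn_planeCurl κ.open_target ((hθ.smul h𝒦 (hχs k)).contDiffOn κ hκ)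
  have hD0 : ∀ k κ y, y ∈ κ.target → κ.symm y ∉ tsupport (χ k) → D k κ y = 0 :=
    fun k κ y hy h => planeCurl_smul_eq_zero hy h _
  have hχc : ∀ k, ∀ κ ∈ 𝒦, ContinuousOn (fun y => χ k (κ.symm y)) κ.target := fun k κ hκ =>
    (h𝒦.contDiffOn_comp κ hκ _ (hχs k)).continuousOn
  have hsub : ∀ κ ∈ 𝒦, ∀ y ∈ κ.target, ∑ k, D k κ y = planeCurl (θ κ) y := by
    intro κ hκ y hy
    rw [← planeCurl_sum]
    · simp only [← Finset.sum_smul, hsum, one_smul]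
    · intro k _
      exact (((hθ.smul h𝒦 (hχs k)).contDiffOn κ hκ).contDiffAt
        (κ.open_target.mem_nhds hy)).differentiableAt (by simp)
  have hint : ∀ k m : t, IntegrableOn (fun y => χ m ((c k).symm y) * D k (c k) y) (c k).target :=
    fun k m => integrableOn_target (isClosed_tsupport (χ k)).isCompact (hχ k)
      ((hχc m _ (hc k)).mul (hDc k _ (hc k)))
      fun y hy h => by rw [hD0 k _ y hy h, mul_zero]
  have hint' : ∀ k m : t, IntegrableOn (fun y => χ m ((c m).symm y) * D k (c m) y) (c m).target :=
    fun k m => integrableOn_target (isClosed_tsupport (χ m)).isCompact (hχ m)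
      ((hχc m _ (hc m)).mul (hDc k _ (hc m)))
      fun y hy h => by rw [image_eq_zero_of_notMem_tsupport h, zero_mul]
  -- The density `χ m` times the curl of `χ k • θ` can be integrated in either chart, because
  -- coordinate changes preserve orientation.
  have hswap : ∀ k m : t, ∫ y in (c k).target, χ m ((c k).symm y) * D k (c k) y =
      ∫ y in (c m).target, χ m ((c m).symm y) * D k (c m) y := by
    intro k m
    refine setIntegral_target_eq (fun y hy => ((h𝒦.contDiffOn_trans _ (hc k) _ (hc m)).contDiffAt
      (((c k).symm.trans (c m)).open_source.mem_nhds hy)).differentiableAt (by simp))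
      (h𝒦.det_pos _ (hc k) _ (hc m)) (fun y hy h => ?_) (fun y hy h => ?_) fun y hy => ?_
    · rw [hχ0 m _ h, zero_mul]
    · rw [hD0 k _ y hy fun h' => h (hχ k h'), mul_zero]
    · have h1 : (c m).symm ((c k).symm.trans (c m) y) = (c k).symm y :=
        (c m).left_inv (by simpa using hy.2)
      simp only [D]
      rw [(hθ.smul h𝒦 (hχs k)).planeCurl_eq h𝒦 (hc k) (hc m) hy, h1]
      ring
  -- Split the form by one partition of unity and the integration by the other, exchange the two,
  -- and apply Stokes to each localized form.
  have htotal : ∑ m : t, ∫ y in (c m).target, χ m ((c m).symm y) * planeCurl (θ (c m)) y = 0 := by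
    calc _ = ∑ m : t, ∑ k : t, ∫ y in (c m).target, χ m ((c m).symm y) * D k (c m) y := by
          refine Finset.sum_congr rfl fun m _ => ?_
          rw [← integral_finsetSum _ fun k _ => hint' k m]
          refine setIntegral_congr_fun (c m).open_target.measurableSet fun y hy => ?_
          rw [← Finset.mul_sum, hsub _ (hc m) y hy]
      _ = ∑ k : t, ∑ m : t, ∫ y in (c k).target, χ m ((c k).symm y) * D k (c k) y := by
          rw [Finset.sum_comm]
          exact Finset.sum_congr rfl fun k _ => Finset.sum_congr rfl fun m _ => (hswap k m).symm
      _ = ∑ k : t, ∫ y in (c k).target, D k (c k) y := by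
          refine Finset.sum_congr rfl fun k _ => ?_
          rw [← integral_finsetSum _ fun m _ => hint k m]
          simp only [← Finset.sum_mul, hsum, one_mul]
      _ = 0 := Finset.sum_eq_zero fun k _ =>
          setIntegral_planeCurl_smul h𝒦 hθ (hχs k) (hc k) (hχ k)
  have hnn : ∀ m : t, ∀ y ∈ (c m).target, 0 ≤ χ m ((c m).symm y) * planeCurl (θ (c m)) y :=
    fun m y hy => mul_nonneg (χ.nonneg m _) (hpos _ (hc m) y hy)
  have hb : κ.symm y ∈ κ.source := κ.map_target hy
  obtain ⟨m, -, hm⟩ := Finset.exists_ne_zero_of_sum_ne_zero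
    (show ∑ k, χ k (κ.symm y) ≠ 0 by rw [hsum]; exact one_ne_zero)
  have hbm : κ.symm y ∈ (c m).source := by_contra fun h => hm (hχ0 m _ h)
  have hint0 := (Finset.sum_eq_zero_iff_of_nonneg fun (m : t) _ =>
    setIntegral_nonneg (c m).open_target.measurableSet (hnn m)).1 htotal m (Finset.mem_univ m)
  have hmc : ContinuousOn (fun y => χ m ((c m).symm y) * planeCurl (θ (c m)) y) (c m).target :=
    (hχc m _ (hc m)).mul (continuousOn_planeCurl (c m).open_target (hθ.contDiffOn _ (hc m)))
  have hmi : IntegrableOn (fun y => χ m ((c m).symm y) * planeCurl (θ (c m)) y) (c m).target :=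
    integrableOn_target (isClosed_tsupport (χ m)).isCompact (hχ m) hmc
      fun y hy h => by rw [image_eq_zero_of_notMem_tsupport h, zero_mul]
  have hae := (setIntegral_eq_zero_iff_of_nonneg_ae
    ((ae_restrict_iff' (c m).open_target.measurableSet).2 (Filter.Eventually.of_forall (hnn m)))
    hmi).1 hint0
  -- Nonnegative densities with vanishing total integral vanish almost everywhere, hence everywhere
  -- by continuity.
  have heq := Measure.eqOn_open_of_ae_eq hae (c m).open_target hmc continuousOn_const
  have h1 := heq ((c m).map_source hbm)
  simp only [(c m).left_inv hbm, Pi.zero_apply] at h1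
  have hys : y ∈ (κ.symm.trans (c m)).source := by simp [hy, hbm]
  rw [hθ.planeCurl_eq h𝒦 hκ (hc m) hys]
  exact mul_eq_zero_of_right _ ((mul_eq_zero.1 h1).resolve_left hm)

end

end

/-! ### The truncated argument form -/

section

/-- A continuously differentiable function that coincides with the inverse on `[1, ∞)` and has no
pole. -/
noncomputable def truncatedInv (t : ℝ) : ℝ := if t ≤ 1 then 2 - t else t⁻¹

theorem truncatedInv_of_le {t : ℝ} (ht : t ≤ 1) : truncatedInv t = 2 - t := if_pos ht

theorem truncatedInv_of_ge {t : ℝ} (ht : 1 ≤ t) : truncatedInv t = t⁻¹ := by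
  rcases ht.eq_or_lt with rfl | ht
  · rw [truncatedInv_of_le le_rfl]; norm_num
  · exact if_neg ht.not_ge

/-- The line `2 - t` is tangent to the hyperbola at `1`, so the branches join to first order. -/
theorem hasDerivAt_truncatedInv (t : ℝ) :
    HasDerivAt truncatedInv (-((max 1 t) ^ 2)⁻¹) t := by
  have h1 : ∀ t ≤ 1, HasDerivWithinAt truncatedInv (-((max 1 t) ^ 2)⁻¹) (Iic 1) t := by
    intro t ht
    rw [max_eq_left ht]
    have h := ((hasDerivAt_id t).const_sub 2).hasDerivWithinAt (s := Iic 1)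
    norm_num at h ⊢
    exact h.congr (fun x hx => truncatedInv_of_le hx) (truncatedInv_of_le ht)
  have h2 : ∀ t, 1 ≤ t → HasDerivWithinAt truncatedInv (-((max 1 t) ^ 2)⁻¹) (Ici 1) t := by
    intro t ht
    rw [max_eq_right ht]
    have h := (hasDerivAt_inv (show t ≠ 0 by positivity)).hasDerivWithinAt (s := Ici 1)
    exact h.congr (fun x hx => truncatedInv_of_ge hx) (truncatedInv_of_ge ht)
  rcases lt_trichotomy t 1 with h | rfl | h
  · exact (h1 t h.le).hasDerivAt (Iic_mem_nhds h)
  · have := (h1 1 le_rfl).union (h2 1 le_rfl)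
    rwa [Iic_union_Ici, hasDerivWithinAt_univ] at this
  · exact (h2 t h.le).hasDerivAt (Ici_mem_nhds h)

theorem contDiff_truncatedInv : ContDiff ℝ 1 truncatedInv := by
  rw [contDiff_one_iff_deriv]
  refine ⟨fun t => (hasDerivAt_truncatedInv t).differentiableAt, ?_⟩
  rw [funext fun t => (hasDerivAt_truncatedInv t).deriv]
  refine (Continuous.inv₀ (by fun_prop) fun t => ?_).neg
  have := le_max_left 1 t
  positivity

theorem planeCurl_smul {g : ℂ → ℝ} {η : ℂ → ℂ →L[ℝ] ℝ} {y : ℂ} (hg : DifferentiableAt ℝ g y)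
    (hη : DifferentiableAt ℝ η y) :
    planeCurl (fun z => g z • η z) y = fderiv ℝ g y 1 * η y Complex.I -
      fderiv ℝ g y Complex.I * η y 1 + g y * planeCurl η y := by
  simp only [planeCurl]
  rw [(hg.hasFDerivAt.fun_smul hη.hasFDerivAt).fderiv]
  simp
  ring

theorem planeCurl_sub {η η' : ℂ → ℂ →L[ℝ] ℝ} {y : ℂ} (hη : DifferentiableAt ℝ η y)
    (hη' : DifferentiableAt ℝ η' y) :
    planeCurl (fun z => η z - η' z) y = planeCurl η y - planeCurl η' y := by
  simp only [planeCurl]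
  rw [(hη.hasFDerivAt.fun_sub hη'.hasFDerivAt).fderiv]
  simp
  ring

theorem planeCurl_fderiv {g : ℂ → ℝ} {y : ℂ} (hg : ContDiffAt ℝ 2 g y) :
    planeCurl (fderiv ℝ g) y = 0 := by
  rw [planeCurl, (hg.isSymmSndFDerivAt (by simp)).eq, sub_self]

/-- For a complex valued function `f`, the form `d arg f`, modified where `f` is small. -/
noncomputable def argForm (f : ℂ → ℂ) (y : ℂ) : ℂ →L[ℝ] ℝ :=
  truncatedInv ((f y).re ^ 2 + (f y).im ^ 2) •
    ((f y).re • fderiv ℝ (fun z => (f z).im) y - (f y).im • fderiv ℝ (fun z => (f z).re) y)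

theorem ContDiffAt.complex_re {f : ℂ → ℂ} {y : ℂ} {n : WithTop ℕ∞} (hf : ContDiffAt ℝ n f y) :
    ContDiffAt ℝ n (fun z => (f z).re) y := Complex.reCLM.contDiff.contDiffAt.comp y hf

theorem ContDiffAt.complex_im {f : ℂ → ℂ} {y : ℂ} {n : WithTop ℕ∞} (hf : ContDiffAt ℝ n f y) :
    ContDiffAt ℝ n (fun z => (f z).im) y := Complex.imCLM.contDiff.contDiffAt.comp y hf

theorem argForm_congr {f g : ℂ → ℂ} {y : ℂ} (h : f =ᶠ[𝓝 y] g) : argForm f y = argForm g y := by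
  have h1 : (fun z => (f z).re) =ᶠ[𝓝 y] fun z => (g z).re := h.fun_comp Complex.re
  have h2 : (fun z => (f z).im) =ᶠ[𝓝 y] fun z => (g z).im := h.fun_comp Complex.im
  rw [argForm, argForm, h.eq_of_nhds, h1.fderiv_eq, h2.fderiv_eq]

/-- A unit factor rotates the real and imaginary parts, which changes neither the modulus nor the
angular form. This is why the form is defined on flat hermitian bundles. -/
theorem argForm_const_mul {C : ℂ} (hC : ‖C‖ = 1) {f : ℂ → ℂ} {y : ℂ}
    (hf : ContDiffAt ℝ 1 f y) : argForm (fun z => C * f z) y = argForm f y := by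
  have h1 := (hf.complex_re.differentiableAt (by simp)).hasFDerivAt
  have h2 := (hf.complex_im.differentiableAt (by simp)).hasFDerivAt
  have hC2 : C.re ^ 2 + C.im ^ 2 = 1 := by
    have := Complex.sq_norm C
    rw [hC, Complex.normSq_apply] at this
    linarith
  have h3 : fderiv ℝ (fun z => (C * f z).re) y =
      C.re • fderiv ℝ (fun z => (f z).re) y - C.im • fderiv ℝ (fun z => (f z).im) y := by
    simp only [Complex.mul_re]
    exact ((h1.const_mul C.re).sub (h2.const_mul C.im)).fderiv
  have h4 : fderiv ℝ (fun z => (C * f z).im) y =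
      C.re • fderiv ℝ (fun z => (f z).im) y + C.im • fderiv ℝ (fun z => (f z).re) y := by
    simp only [Complex.mul_im]
    exact ((h2.const_mul C.re).add (h1.const_mul C.im)).fderiv
  have h5 : (C * f y).re ^ 2 + (C * f y).im ^ 2 = (f y).re ^ 2 + (f y).im ^ 2 := by
    rw [Complex.mul_re, Complex.mul_im]
    linear_combination ((f y).re ^ 2 + (f y).im ^ 2) * hC2
  rw [argForm, argForm, h3, h4, h5, Complex.mul_re, Complex.mul_im]
  congr 1
  ext1 v
  simp
  linear_combination ((f y).re * fderiv ℝ (fun z => (f z).im) y v -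
    (f y).im * fderiv ℝ (fun z => (f z).re) y v) * hC2

theorem argForm_comp {f τ : ℂ → ℂ} {y : ℂ} (hf : ContDiffAt ℝ 1 f (τ y))
    (hτ : DifferentiableAt ℝ τ y) :
    argForm (fun z => f (τ z)) y = (argForm f (τ y)).comp (fderiv ℝ τ y) := by
  have h1 := fderiv_comp y (hf.complex_re.differentiableAt (by simp)) hτ
  have h2 := fderiv_comp y (hf.complex_im.differentiableAt (by simp)) hτ
  simp only [Function.comp_def] at h1 h2
  rw [argForm, argForm, h1, h2]
  ext1 v
  simp

theorem contDiffAt_argForm {f : ℂ → ℂ} {y : ℂ} (hf : ContDiffAt ℝ 2 f y) :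
    ContDiffAt ℝ 1 (argForm f) y := by
  have h1 := hf.complex_re
  have h2 := hf.complex_im
  have h12 : (1 : WithTop ℕ∞) ≤ 2 := by norm_num
  exact (contDiff_truncatedInv.contDiffAt.comp y
    (((h1.of_le h12).pow 2).add ((h2.of_le h12).pow 2))).smul
    (((h1.of_le h12).smul (h2.fderiv_right (by norm_num))).sub
      ((h2.of_le h12).smul (h1.fderiv_right (by norm_num))))

/-- With `t` the squared modulus and `φ` the truncated inverse, the exterior derivative is `2 * (t *
φ' + φ)` times the Jacobian. The factor vanishes where `φ` is the true inverse and is positive where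
`t < 1`. -/
theorem planeCurl_argForm {f : ℂ → ℂ} {y : ℂ} (hf : ContDiffAt ℝ 2 f y) :
    planeCurl (argForm f) y = 4 * (1 - min 1 (‖f y‖ ^ 2)) * (fderiv ℝ f y).det := by
  have h1 := hf.complex_re
  have h2 := hf.complex_im
  have d1 := h1.differentiableAt (by simp)
  have d2 := h2.differentiableAt (by simp)
  have e1 := (h1.fderiv_right (m := 1) (by norm_num)).differentiableAt (by simp)
  have e2 := (h2.fderiv_right (m := 1) (by norm_num)).differentiableAt (by simp)
  have dt : HasFDerivAt (fun z => (f z).re ^ 2 + (f z).im ^ 2)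
      ((2 * (f y).re) • fderiv ℝ (fun z => (f z).re) y +
        (2 * (f y).im) • fderiv ℝ (fun z => (f z).im) y) y := by
    have := (d1.hasFDerivAt.pow 2).fun_add (d2.hasFDerivAt.pow 2)
    simpa using this
  have dφ := (hasDerivAt_truncatedInv ((f y).re ^ 2 + (f y).im ^ 2)).comp_hasFDerivAt y dt
  have hre : ∀ v, fderiv ℝ (fun z => (f z).re) y v = (fderiv ℝ f y v).re := fun v => by
    have := (Complex.reCLM.hasFDerivAt.comp y (hf.differentiableAt (by simp)).hasFDerivAt).fderiv
    exact congr($this v)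
  have him : ∀ v, fderiv ℝ (fun z => (f z).im) y v = (fderiv ℝ f y v).im := fun v => by
    have := (Complex.imCLM.hasFDerivAt.comp y (hf.differentiableAt (by simp)).hasFDerivAt).fderiv
    exact congr($this v)
  have hnorm : ‖f y‖ ^ 2 = (f y).re ^ 2 + (f y).im ^ 2 := by
    rw [Complex.sq_norm, Complex.normSq_apply]; ring
  have hφd := dφ.differentiableAt
  simp only [Function.comp_def] at hφd
  unfold argForm
  rw [planeCurl_smul hφd ((d1.fun_smul e2).fun_sub (d2.fun_smul e1)),
    planeCurl_sub (d1.fun_smul e2) (d2.fun_smul e1), planeCurl_smul d1 e2, planeCurl_smul d2 e1, planeCurl_fderiv h1,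
    planeCurl_fderiv h2]
  have hφ := dφ.fderiv
  simp only [Function.comp_def] at hφ
  rw [hφ, det_eq_re_mul_im, hnorm]
  simp only [smul_apply, add_apply, sub_apply, smul_eq_mul, hre, him]
  set t := (f y).re ^ 2 + (f y).im ^ 2 with ht
  have key : t * -((max 1 t) ^ 2)⁻¹ + truncatedInv t = 2 * (1 - min 1 t) := by
    rcases le_total t 1 with h | h
    · rw [truncatedInv_of_le h, max_eq_left h, min_eq_right h]; ring
    · rw [truncatedInv_of_ge h, max_eq_right h, min_eq_left h]
      field_simp
      ring
  rw [ht] at key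
  linear_combination (2 * ((fderiv ℝ f y 1).re * (fderiv ℝ f y Complex.I).im -
    (fderiv ℝ f y Complex.I).re * (fderiv ℝ f y 1).im)) * key

end

/-! ### Smooth sections and the exclusion of a single positive zero -/

section

namespace FlatLineCocycle

variable {S : Type u} [TopologicalSpace S] {ι : Type v} (Z : FlatLineCocycle S ι)

/-- A global section that is smooth in the given charts. -/
structure IsSmoothSection (𝒦 : Set (OpenPartialHomeomorph S ℂ)) (s : ι → S → ℂ) : Prop where
  contDiffOn : ∀ κ ∈ 𝒦, ∀ i,
    ContDiffOn ℝ ∞ (fun y => s i (κ.symm y)) (κ.target ∩ κ.symm ⁻¹' Z.U i)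
  eq_mul : ∀ i j b, b ∈ Z.U i → b ∈ Z.U j → s i b = Z.C i j b * s j b

/-- The form `d arg s`, modified where the section `s` is small. -/
noncomputable def sectionForm (s : ι → S → ℂ) (κ : OpenPartialHomeomorph S ℂ) (y : ℂ) :
    ℂ →L[ℝ] ℝ :=
  argForm (fun z => s (Z.exists_mem (κ.symm y)).choose (κ.symm z)) y

variable {Z} {𝒦 : Set (OpenPartialHomeomorph S ℂ)} {s : ι → S → ℂ}

theorem IsSmoothSection.contDiffAt (hs : Z.IsSmoothSection 𝒦 s) {κ : OpenPartialHomeomorph S ℂ}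
    (hκ : κ ∈ 𝒦) {y : ℂ} (hy : y ∈ κ.target) {i : ι} (hi : κ.symm y ∈ Z.U i) :
    ContDiffAt ℝ ∞ (fun y => s i (κ.symm y)) y :=
  (hs.contDiffOn κ hκ i).contDiffAt
    ((κ.isOpen_inter_preimage_symm (Z.isOpen_U i)).mem_nhds ⟨hy, hi⟩)

/-- Transition functions are locally constant of modulus one, so the arbitrary index in the
definition does not matter. -/
theorem IsSmoothSection.sectionForm_eq (hs : Z.IsSmoothSection 𝒦 s)
    {κ : OpenPartialHomeomorph S ℂ} (hκ : κ ∈ 𝒦) {y : ℂ} (hy : y ∈ κ.target) {i : ι}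
    (hi : κ.symm y ∈ Z.U i) : Z.sectionForm s κ y = argForm (fun z => s i (κ.symm z)) y := by
  have hj := (Z.exists_mem (κ.symm y)).choose_spec
  rw [sectionForm]
  set j := (Z.exists_mem (κ.symm y)).choose
  rw [← argForm_const_mul (Z.norm_C j i (κ.symm y))
    ((hs.contDiffAt hκ hy hi).of_le (by norm_cast))]
  refine argForm_congr ?_
  have h := (Z.eventually_eq j i (κ.symm y) ⟨hj, hi⟩).and
    (((Z.isOpen_U j).eventually_mem hj).and ((Z.isOpen_U i).eventually_mem hi))
  filter_upwards [(κ.continuousAt_symm hy).eventually h] with z hz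
  rw [hs.eq_mul j i _ hz.2.1 hz.2.2, hz.1]

theorem IsSmoothSection.sectionForm_eventuallyEq (hs : Z.IsSmoothSection 𝒦 s)
    {κ : OpenPartialHomeomorph S ℂ} (hκ : κ ∈ 𝒦) {y : ℂ} (hy : y ∈ κ.target) {i : ι}
    (hi : κ.symm y ∈ Z.U i) :
    Z.sectionForm s κ =ᶠ[𝓝 y] argForm fun z => s i (κ.symm z) := by
  filter_upwards [(κ.isOpen_inter_preimage_symm (Z.isOpen_U i)).mem_nhds ⟨hy, hi⟩] with z hz
  exact hs.sectionForm_eq hκ hz.1 hz.2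

theorem IsSmoothSection.isOneForm [ChartedSpace (EuclideanSpace ℝ (Fin 2)) S]
    (h𝒦 : IsOrientedAtlas 𝒦) (hs : Z.IsSmoothSection 𝒦 s) : IsOneForm 𝒦 (Z.sectionForm s) where
  contDiffOn κ hκ y hy := by
    obtain ⟨i, hi⟩ := Z.exists_mem (κ.symm y)
    exact ((contDiffAt_argForm ((hs.contDiffAt hκ hy hi).of_le (by norm_cast))).congr_of_eventuallyEq
      (hs.sectionForm_eventuallyEq hκ hy hi)).contDiffWithinAt
  pullback κ hκ κ' hκ' y hy := by
    obtain ⟨i, hi⟩ := Z.exists_mem (κ.symm y)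
    have hn := (κ.symm.trans κ').open_source.mem_nhds hy
    have heq : ∀ z ∈ (κ.symm.trans κ').source, κ'.symm (κ.symm.trans κ' z) = κ.symm z :=
      fun z hz => κ'.left_inv (by simpa using hz.2)
    have hy' : κ.symm.trans κ' y ∈ κ'.target := ((κ.symm.trans κ').map_source hy).1
    have hi' : κ'.symm (κ.symm.trans κ' y) ∈ Z.U i := by rwa [heq y hy]
    rw [hs.sectionForm_eq hκ hy.1 hi, hs.sectionForm_eq hκ' hy' hi', ← argForm_comp
      ((hs.contDiffAt hκ' hy' hi').of_le (by norm_cast))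
      (((h𝒦.contDiffOn_trans κ hκ κ' hκ').contDiffAt hn).differentiableAt (by simp))]
    refine argForm_congr ?_
    filter_upwards [hn] with z hz
    rw [heq z hz]

theorem det_fderiv_const_mul_pow (c : ℂ) (n : ℕ) (y : ℂ) :
    (fderiv ℝ (fun z : ℂ => c * z ^ n) y).det = ‖c * (n * y ^ (n - 1))‖ ^ 2 := by
  have h := ((hasDerivAt_pow n y).const_mul c).complexToReal_fderiv.fderiv
  rw [h, det_eq_re_mul_im, Complex.sq_norm, Complex.normSq_apply]
  simp
  ring

/-- A section of a flat line bundle on a compact oriented surface cannot have a single zero where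
it is a positive power of an oriented coordinate. -/
theorem IsSmoothSection.false_of_eq_pow [ChartedSpace (EuclideanSpace ℝ (Fin 2)) S]
    [IsManifold (𝓡 2) ∞ S] [CompactSpace S] [T2Space S]
    (h𝒦 : IsOrientedAtlas 𝒦) (hcov : ∀ x, ∃ κ ∈ 𝒦, x ∈ κ.source) (hs : Z.IsSmoothSection 𝒦 s)
    {κ₀ : OpenPartialHomeomorph S ℂ} (hκ₀ : κ₀ ∈ 𝒦) {δ : ℝ} (hδ : 0 < δ)
    (hball : Metric.ball 0 δ ⊆ κ₀.target) {i₀ : ι} (hi₀ : κ₀.symm '' Metric.ball 0 δ ⊆ Z.U i₀)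
    {c : ℂ} (hc : c ≠ 0) {n : ℕ} (hn : n ≠ 0)
    (hpow : ∀ y ∈ Metric.ball 0 δ, s i₀ (κ₀.symm y) = c * y ^ n)
    (hlarge : ∀ b ∉ κ₀.symm '' Metric.ball 0 δ, ∀ i, b ∈ Z.U i → 1 ≤ ‖s i b‖) : False := by
  have hform := hs.isOneForm h𝒦
  have hcurl : ∀ κ ∈ 𝒦, ∀ y ∈ κ.target, ∀ i, κ.symm y ∈ Z.U i →
      planeCurl (Z.sectionForm s κ) y = 4 * (1 - min 1 (‖s i (κ.symm y)‖ ^ 2)) *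
        (fderiv ℝ (fun z => s i (κ.symm z)) y).det := fun κ hκ y hy i hi => by
    rw [planeCurl_congr (hs.sectionForm_eventuallyEq hκ hy hi),
      planeCurl_argForm ((hs.contDiffAt hκ hy hi).of_le (by norm_cast))]
  have hcurl₀ : ∀ y ∈ Metric.ball 0 δ, planeCurl (Z.sectionForm s κ₀) y =
      4 * (1 - min 1 (‖c * y ^ n‖ ^ 2)) * ‖c * (n * y ^ (n - 1))‖ ^ 2 := fun y hy => by
    rw [hcurl κ₀ hκ₀ y (hball hy) i₀ (hi₀ ⟨y, hy, rfl⟩), hpow y hy, ← det_fderiv_const_mul_pow]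
    congr 2
    refine Filter.EventuallyEq.fderiv_eq ?_
    filter_upwards [Metric.isOpen_ball.mem_nhds hy] with z hz
    exact hpow z hz
  -- Inside the disc the Jacobian of a complex power is nonnegative, and orientation carries this to
  -- other charts; outside it the modulus is at least one and the form is closed.
  have hnonneg : ∀ κ ∈ 𝒦, ∀ y ∈ κ.target, 0 ≤ planeCurl (Z.sectionForm s κ) y := by
    intro κ hκ y hy
    by_cases hb : κ.symm y ∈ κ₀.symm '' Metric.ball 0 δ
    · obtain ⟨z, hz, hzy⟩ := hb
      have hsrc : y ∈ (κ.symm.trans κ₀).source := by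
        simp only [OpenPartialHomeomorph.trans_source, OpenPartialHomeomorph.symm_source]
        exact ⟨hy, (congrArg (· ∈ κ₀.source) hzy).mp (κ₀.map_target (hball hz))⟩
      have hτ : κ.symm.trans κ₀ y = z := by
        change κ₀ (κ.symm y) = z
        rw [← hzy, κ₀.right_inv (hball hz)]
      rw [hform.planeCurl_eq h𝒦 hκ hκ₀ hsrc, hτ, hcurl₀ z hz]
      have h1 := (h𝒦.det_pos κ hκ κ₀ hκ₀ y hsrc).le
      have h2 : 0 ≤ 1 - min 1 (‖c * z ^ n‖ ^ 2) := sub_nonneg.2 (min_le_left _ _)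
      positivity
    · obtain ⟨i, hi⟩ := Z.exists_mem (κ.symm y)
      have h1 := hlarge _ hb i hi
      rw [hcurl κ hκ y hy i hi, min_eq_left (by nlinarith)]
      simp
  -- Close to the zero, but not at it, both the truncation factor and the Jacobian are positive,
  -- which contradicts the vanishing of the exterior derivative.
  obtain ⟨y, hy, hy0, hy1⟩ : ∃ y ∈ Metric.ball (0 : ℂ) δ, y ≠ 0 ∧ ‖c * y ^ n‖ < 1 := by
    have h1 : ∀ᶠ y : ℂ in 𝓝 0, ‖c * y ^ n‖ < 1 := by
      have : Continuous fun y : ℂ => ‖c * y ^ n‖ := by fun_prop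
      refine this.continuousAt.eventually (gt_mem_nhds ?_)
      simp [hn]
    have h2 : ∀ᶠ y : ℂ in 𝓝[≠] 0, y ∈ Metric.ball (0 : ℂ) δ ∧ y ≠ 0 ∧ ‖c * y ^ n‖ < 1 :=
      ((Metric.isOpen_ball.eventually_mem (Metric.mem_ball_self hδ)).filter_mono
        nhdsWithin_le_nhds).and (eventually_mem_nhdsWithin.and (h1.filter_mono nhdsWithin_le_nhds))
    obtain ⟨y, h⟩ := h2.exists
    exact ⟨y, h⟩
  have h := hform.planeCurl_eq_zero_of_nonneg h𝒦 hcov hnonneg hκ₀ (hball hy)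
  rw [hcurl₀ y hy] at h
  have h1 : 0 < 1 - min 1 (‖c * y ^ n‖ ^ 2) := by
    rw [sub_pos, min_lt_iff]
    right
    exact pow_lt_one₀ (norm_nonneg _) hy1 two_ne_zero
  have h2 : 0 < ‖c * (n * y ^ (n - 1))‖ := by
    rw [norm_pos_iff]
    exact mul_ne_zero hc (mul_ne_zero (by exact_mod_cast hn) (pow_ne_zero _ hy0))
  have : 0 < 4 * (1 - min 1 (‖c * y ^ n‖ ^ 2)) * ‖c * (n * y ^ (n - 1))‖ ^ 2 := by positivity
  exact this.ne' h

/-- Gluing local smooth approximations of a section. -/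
theorem IsSection.exists_isSmoothSection [ChartedSpace (EuclideanSpace ℝ (Fin 2)) S]
    [IsManifold (𝓡 2) ∞ S] [CompactSpace S] [T2Space S] (h𝒦 : IsOrientedAtlas 𝒦)
    (hs : Z.IsSection s univ) {ε : ℝ} {K : Set S}
    (hloc : ∀ x, ∃ (W : Set S) (i : ι) (v : S → ℂ), IsOpen W ∧ x ∈ W ∧ W ⊆ Z.U i ∧
      (∀ κ ∈ 𝒦, ContDiffOn ℝ ∞ (fun y => v (κ.symm y)) (κ.target ∩ κ.symm ⁻¹' W)) ∧
      (∀ b ∈ W, ‖v b - s i b‖ ≤ ε) ∧ ∀ b ∈ W ∩ K, v b = s i b) :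
    ∃ s', Z.IsSmoothSection 𝒦 s' ∧ (∀ i, ∀ b ∈ Z.U i, ‖s' i b - s i b‖ ≤ ε) ∧
      ∀ i, ∀ b ∈ Z.U i ∩ K, s' i b = s i b := by
  choose W i v hW hxW hWi hv hvε hvK using hloc
  obtain ⟨t, χ, hχ, hsum⟩ := exists_finite_smoothPartitionOfUnity W hW hxW
  have hχ0 : ∀ (k : t) b, b ∉ W k → χ k b = 0 := fun k b hb =>
    image_eq_zero_of_notMem_tsupport fun h => hb (hχ k h)
  -- The section is the same convex combination of its own local expressions, so the error is an
  -- average of the local errors.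
  have hdiff : ∀ j, ∀ b ∈ Z.U j, (∑ k, (χ k b : ℂ) * (Z.C j (i k) b * v k b)) - s j b =
      ∑ k, (χ k b : ℂ) * (Z.C j (i k) b * (v k b - s (i k) b)) := by
    intro j b hb
    have h1 : s j b = ∑ k, (χ k b : ℂ) * s j b := by
      rw [← Finset.sum_mul, ← Complex.ofReal_sum, hsum, Complex.ofReal_one, one_mul]
    rw [h1, ← Finset.sum_sub_distrib]
    refine Finset.sum_congr rfl fun k _ => ?_
    by_cases hk : b ∈ W k
    · rw [hs.eq_mul j (i k) b trivial hb (hWi k hk)]; ring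
    · rw [hχ0 k b hk]; simp
  refine ⟨fun j b => ∑ k, (χ k b : ℂ) * (Z.C j (i k) b * v k b), ⟨?_, ?_⟩, ?_, ?_⟩
  · intro κ hκ j y hy
    refine ContDiffAt.contDiffWithinAt (ContDiffAt.sum fun k _ => ?_)
    by_cases hk : κ.symm y ∈ tsupport (χ k)
    · have hkW := hχ k hk
      refine (Complex.ofRealCLM.contDiff.contDiffAt.comp y ((h𝒦.contDiffOn_comp κ hκ _
        (χ k).contMDiff).contDiffAt (κ.open_target.mem_nhds hy.1))).mul (ContDiffAt.mul ?_
        ((hv k κ hκ).contDiffAt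
          ((κ.isOpen_inter_preimage_symm (hW k)).mem_nhds ⟨hy.1, hkW⟩)))
      exact contDiffAt_const.congr_of_eventuallyEq ((κ.continuousAt_symm hy.1).eventually
        (Z.eventually_eq j (i k) _ ⟨hy.2, hWi k hkW⟩))
    · refine (contDiffAt_const (c := 0)).congr_of_eventuallyEq ?_
      filter_upwards [(κ.continuousAt_symm hy.1).preimage_mem_nhds
        ((isClosed_tsupport (χ k)).isOpen_compl.mem_nhds hk)] with z hz
      rw [image_eq_zero_of_notMem_tsupport hz]
      simp
  · intro j l b hj hl
    rw [Finset.mul_sum]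
    refine Finset.sum_congr rfl fun k _ => ?_
    by_cases hk : b ∈ W k
    · rw [← Z.mul_C j l (i k) b ⟨⟨hj, hl⟩, hWi k hk⟩]; ring
    · rw [hχ0 k b hk]; simp
  · intro j b hb
    rw [hdiff j b hb]
    calc _ ≤ ∑ k, ‖(χ k b : ℂ) * (Z.C j (i k) b * (v k b - s (i k) b))‖ := norm_sum_le _ _
      _ ≤ ∑ k, χ k b * ε := Finset.sum_le_sum fun k _ => by
          by_cases hk : b ∈ W k
          · rw [norm_mul, norm_mul, Z.norm_C, one_mul, Complex.norm_real,
              Real.norm_of_nonneg (χ.nonneg k b)]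
            exact mul_le_mul_of_nonneg_left (hvε k b hk) (χ.nonneg k b)
          · rw [hχ0 k b hk]; simp
      _ = ε := by rw [← Finset.sum_mul, hsum, one_mul]
  · intro j b hb
    refine sub_eq_zero.1 ((hdiff j b hb.1).trans (Finset.sum_eq_zero fun k _ => ?_))
    by_cases hk : b ∈ W k
    · rw [hvK k b ⟨hk, hb.2⟩]; simp
    · rw [hχ0 k b hk]; simp

/-- The modulus is independent of the frame because the transition functions have modulus one. -/
theorem IsSection.continuous_norm (hs : Z.IsSection s univ) :
    Continuous fun b => ‖s (Z.exists_mem b).choose b‖ := by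
  rw [continuous_iff_continuousAt]
  intro b
  obtain ⟨i, hi⟩ := Z.exists_mem b
  have h1 : ContinuousAt (s i) b := (hs.continuousOn i).continuousAt
    (by rw [univ_inter]; exact (Z.isOpen_U i).mem_nhds hi)
  refine h1.norm.congr ?_
  filter_upwards [(Z.isOpen_U i).mem_nhds hi] with b' hb'
  rw [hs.eq_mul _ i b' trivial (Z.exists_mem b').choose_spec hb', norm_mul, Z.norm_C, one_mul]

theorem IsSection.norm_eq (hs : Z.IsSection s univ) {i j : ι} {b : S} (hi : b ∈ Z.U i)
    (hj : b ∈ Z.U j) : ‖s i b‖ = ‖s j b‖ := by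
  rw [hs.eq_mul i j b trivial hi hj, norm_mul, Z.norm_C, one_mul]

/-- The section is approximated by a smooth one that keeps the power near the zero, and is rescaled
so that its modulus is at least one away from it. -/
theorem IsSection.false_of_eq_pow [ChartedSpace (EuclideanSpace ℝ (Fin 2)) S]
    [IsManifold (𝓡 2) ∞ S] [CompactSpace S] [T2Space S]
    (h𝒦 : IsOrientedAtlas 𝒦) (hcov : ∀ x, ∃ κ ∈ 𝒦, x ∈ κ.source) (hs : Z.IsSection s univ)
    {κ₀ : OpenPartialHomeomorph S ℂ} (hκ₀ : κ₀ ∈ 𝒦) (hball : Metric.closedBall 0 1 ⊆ κ₀.target)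
    (hz : Z.zeros s univ ⊆ {κ₀.symm 0}) {i₀ : ι} (hi₀ : κ₀.symm '' Metric.closedBall 0 1 ⊆ Z.U i₀)
    {n : ℕ} (hn : n ≠ 0)
    (hpow : ∀ y ∈ Metric.ball (0 : ℂ) (1 / 2), s i₀ (κ₀.symm y) = y ^ n) : False := by
  have hsub₄ : Metric.closedBall (0 : ℂ) (1 / 4) ⊆ Metric.ball 0 (1 / 2) :=
    Metric.closedBall_subset_ball (by norm_num)
  have hsub₂ : Metric.ball (0 : ℂ) (1 / 2) ⊆ Metric.closedBall 0 1 :=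
    Metric.ball_subset_closedBall.trans (Metric.closedBall_subset_closedBall (by norm_num))
  have hsub : Metric.ball (0 : ℂ) (1 / 4) ⊆ Metric.closedBall 0 1 :=
    Metric.ball_subset_closedBall.trans (hsub₄.trans hsub₂)
  have hopen : ∀ {r}, Metric.ball (0 : ℂ) r ⊆ Metric.closedBall 0 1 →
      IsOpen (κ₀.symm '' Metric.ball 0 r) := fun h =>
    κ₀.symm.isOpen_image_of_subset_source Metric.isOpen_ball (h.trans hball)
  have hK : IsClosed (κ₀.symm '' Metric.closedBall 0 (1 / 4)) :=
    ((isCompact_closedBall (0 : ℂ) (1 / 4)).image_of_continuousOn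
      (κ₀.continuousOn_symm.mono ((hsub₄.trans hsub₂).trans hball))).isClosed
  -- Half the minimum modulus off the small disc: an approximation within `ε` still has modulus at
  -- least `ε` there, which the factor `ε⁻¹` raises to one.
  obtain ⟨ε, hε, hεs⟩ : ∃ ε > 0, ∀ b ∉ κ₀.symm '' Metric.ball 0 (1 / 4), ∀ i, b ∈ Z.U i →
      2 * ε ≤ ‖s i b‖ := by
    have hc : IsCompact (κ₀.symm '' Metric.ball 0 (1 / 4))ᶜ := (hopen hsub).isClosed_compl.isCompact
    rcases (κ₀.symm '' Metric.ball 0 (1 / 4))ᶜ.eq_empty_or_nonempty with h | h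
    · exact ⟨1, one_pos, fun b hb => by
        have : b ∈ (κ₀.symm '' Metric.ball 0 (1 / 4))ᶜ := hb
        rw [h] at this; exact this.elim⟩
    · obtain ⟨b, hb, hmin⟩ := hc.exists_isMinOn h hs.continuous_norm.continuousOn
      have hpos : 0 < ‖s (Z.exists_mem b).choose b‖ := norm_pos_iff.2 fun h0 => by
        have h1 := hz ⟨trivial, _, (Z.exists_mem b).choose_spec, h0⟩
        exact hb ⟨0, by simp, h1.symm⟩
      refine ⟨_, half_pos hpos, fun b' hb' i hi => ?_⟩
      have h2 := hmin hb'
      simp only [mem_ofPred_eq] at h2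
      rw [hs.norm_eq hi (Z.exists_mem b').choose_spec]
      linarith
  obtain ⟨s', hs', hclose, heq⟩ := hs.exists_isSmoothSection h𝒦 (ε := ε)
    (K := κ₀.symm '' Metric.closedBall 0 (1 / 4)) (fun x => by
      -- Near the zero the section is its own smooth model; elsewhere a constant approximates it, on
      -- neighbourhoods that avoid the closed quarter disc where equality is required.
      by_cases hx : x ∈ κ₀.symm '' Metric.ball 0 (1 / 2)
      · have hval : ∀ b ∈ κ₀.symm '' Metric.ball 0 (1 / 2), κ₀ b ^ n = s i₀ b := by
          rintro _ ⟨y, hy, rfl⟩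
          rw [hpow y hy, κ₀.right_inv (hball (hsub₂ hy))]
        refine ⟨_, i₀, fun b => κ₀ b ^ n, hopen hsub₂, hx, (image_mono hsub₂).trans hi₀, ?_, ?_,
          fun b hb => hval b hb.1⟩
        · intro κ hκ
          refine ((h𝒦.contDiffOn_trans κ hκ κ₀ hκ₀).mono ?_).pow n
          rintro y ⟨hy, z, hz, hzy⟩
          simp only [OpenPartialHomeomorph.trans_source, OpenPartialHomeomorph.symm_source]
          exact ⟨hy, (congrArg (· ∈ κ₀.source) hzy).mp (κ₀.map_target (hball (hsub₂ hz)))⟩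
        · intro b hb
          beta_reduce
          rw [hval b hb, sub_self, norm_zero]
          exact hε.le
      · obtain ⟨i, hi⟩ := Z.exists_mem x
        have h1 : ContinuousAt (s i) x := (hs.continuousOn i).continuousAt
          (by rw [univ_inter]; exact (Z.isOpen_U i).mem_nhds hi)
        have h2 : {b | b ∈ Z.U i ∧ dist (s i b) (s i x) < ε ∧
            b ∉ κ₀.symm '' Metric.closedBall 0 (1 / 4)} ∈ 𝓝 x :=
          Filter.inter_mem ((Z.isOpen_U i).mem_nhds hi) (Filter.inter_mem
            (h1.eventually (Metric.ball_mem_nhds _ hε))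
            (hK.isOpen_compl.mem_nhds fun h => hx (image_mono hsub₄ h)))
        obtain ⟨W, hWsub, hW, hxW⟩ := mem_nhds_iff.1 h2
        refine ⟨W, i, fun _ => s i x, hW, hxW, fun b hb => (hWsub hb).1,
          fun κ _ => contDiffOn_const, fun b hb => ?_, fun b hb => ((hWsub hb.1).2.2 hb.2).elim⟩
        rw [← dist_eq_norm, dist_comm]
        exact (hWsub hb).2.1.le)
  have hε0 : ((ε⁻¹ : ℝ) : ℂ) ≠ 0 := by exact_mod_cast (inv_pos.2 hε).ne'
  have hs'' : Z.IsSmoothSection 𝒦 fun i b => ((ε⁻¹ : ℝ) : ℂ) * s' i b :=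
    ⟨fun κ hκ i => contDiffOn_const.mul (hs'.contDiffOn κ hκ i), fun i j b hi hj => by
      rw [hs'.eq_mul i j b hi hj]; ring⟩
  refine hs''.false_of_eq_pow h𝒦 hcov hκ₀ (δ := 1 / 4) (by norm_num) (hsub.trans hball)
    ((image_mono hsub).trans hi₀) hε0 hn (fun y hy => ?_) fun b hb i hi => ?_
  · have hy' : y ∈ Metric.closedBall (0 : ℂ) (1 / 4) := Metric.ball_subset_closedBall hy
    rw [heq i₀ _ ⟨hi₀ ⟨y, hsub hy, rfl⟩, y, hy', rfl⟩, hpow y (hsub₄ hy')]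
  · rw [norm_mul, Complex.norm_real, Real.norm_of_nonneg (inv_pos.2 hε).le, inv_mul_eq_div,
      one_le_div hε]
    have h1 := hclose i b hi
    have h2 := hεs b hb i hi
    have h3 := norm_sub_norm_le (s i b) (s' i b)
    rw [norm_sub_rev] at h3
    linarith

/-- A flat line bundle on a compact oriented surface has a section without zeros. -/
theorem exists_isSection_zeros_eq_empty [ChartedSpace (EuclideanSpace ℝ (Fin 2)) S]
    [IsManifold (𝓡 2) ∞ S] [CompactSpace S] [T2Space S] [ConnectedSpace S]
    (hS : IsOrientableSurface S) : ∃ s, Z.IsSection s univ ∧ Z.zeros s univ = ∅ := by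
  obtain ⟨𝒦, h𝒦, hdisc⟩ := exists_isOrientedAtlas hS
  have hcov : ∀ x, ∃ κ ∈ 𝒦, x ∈ κ.source := fun x => by
    obtain ⟨κ, h1, h2, -⟩ := hdisc x univ Filter.univ_mem
    exact ⟨κ, h1, h2⟩
  obtain ⟨s, hs, h | ⟨κ, hκ, hball, hz, i, hi, n, hn, hpow | hpow⟩⟩ :=
    Z.exists_isSection_eq_zpow hdisc
  · exact ⟨s, hs, h⟩
  · exact (hs.false_of_eq_pow h𝒦 hcov hκ hball hz hi hn hpow).elim
  · refine (hs.conj.false_of_eq_pow h𝒦 hcov hκ hball ?_ hi hn fun y hy => ?_).elim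
    · rintro b ⟨hb, j, hj, h⟩
      exact hz ⟨hb, j, hj, by simpa using h⟩
    · rw [hpow y hy]; simp

end FlatLineCocycle

end

/-! ### Splitting flat circle cocycles -/

section

/-- The cochain is the direction of a nowhere vanishing section of the associated flat line bundle;
the transition rule for sections becomes additive for directions. -/
theorem flatCocyclesSplit {S : Type u} [TopologicalSpace S] [T2Space S] [CompactSpace S]
    [ConnectedSpace S] [ChartedSpace (EuclideanSpace ℝ (Fin 2)) S] [IsManifold (𝓡 2) ∞ S]
    (hS : IsOrientableSurface S) : FlatCocyclesSplit S := by
  intro ι U c hU hcov hc hmul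
  let Z : FlatLineCocycle S ι :=
    { U := U
      isOpen_U := hU
      exists_mem := hcov
      C := fun i j b => AddCircle.toCircle (c i j b)
      norm_C := fun i j b => Circle.norm_coe _
      eventually_eq := fun i j b hb => (hc i j b hb).mono fun b' h => by rw [h]
      mul_C := fun i j k b hb => by
        rw [← hmul i j k b hb, AddCircle.toCircle_add, Circle.coe_mul] }
  obtain ⟨s, hs, hz⟩ := Z.exists_isSection_zeros_eq_empty hS
  have h0 : ∀ i, ∀ b ∈ U i, s i b ≠ 0 := fun i b hb h => by
    have : b ∈ Z.zeros s univ := ⟨trivial, i, hb, h⟩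
    rw [hz] at this
    exact this
  refine ⟨fun i b => (s i b).direction, fun i b hb => ?_, fun i j b hb => ?_⟩
  · have h1 : ContinuousWithinAt (s i) (U i) b := by
      have := hs.continuousOn i b ⟨trivial, hb⟩
      rwa [univ_inter] at this
    exact (Complex.continuousAt_direction (h0 i b hb)).comp_continuousWithinAt h1
  · beta_reduce
    rw [hs.eq_mul i j b trivial hb.1 hb.2]
    change ((AddCircle.toCircle (c i j b) : ℂ) * s j b).direction - _ = _
    rw [Complex.direction_toCircle_mul _ (h0 j b hb.2), add_sub_cancel_right]

end

theorem theorem4p1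
    {S : Type u} [TopologicalSpace S] [T2Space S] [CompactSpace S] [ConnectedSpace S]
    [ChartedSpace (EuclideanSpace ℝ (Fin 2)) S] [IsManifold (𝓡 2) ∞ S]
    (hS : IsOrientableSurface S) (hχ : eulerCharacteristic S < 0)
    {M : Type v} [TopologicalSpace M] [T2Space M]
    [ChartedSpace (EuclideanSpace ℝ (Fin 3)) M] [IsManifold (𝓡 3) ∞ M]
    (p : M → S) (hp : IsCircleBundle p)
    (hnontrivial : ¬ IsHomeomorphicTrivialFiberBundle Circle p)
    (h : M ≃ₜ M) (hh : IsotopicToId h)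
    (Λ : SurfaceLamination M) (hΛ : Λ.IsHorizontal p) (hmin : Λ.IsMinimal)
    (hinv : Λ.IsInvariant h) :
    ∃ k : ℕ, 1 ≤ k ∧ ∀ L ∈ Λ.leaves, h^[k] '' L = L :=
  exists_pos_iterate_image_leaf_eq (flatCocyclesSplit hS) p hp.1.continuous
    (fun x => (hp.2 x).imp fun _ he => he.1) hnontrivial h hh Λ hΛ hmin hinv
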